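/- Let $\gamma$ be a random variable with values in $[0,\infty]$ on a probability space $(\Omega,\mathscr F,\mathsf P)$ with $\mathsf P(\gamma>0)>0$. Let $\mathscr F_t$ ($t\ge 0$) consist of the sets $A\in\mathscr F$ for which $A\cap\{t<\gamma\}$ is either $\varnothing$ or $\{t<\gamma\}$; $\mathbb F=(\mathscr F_t)_{t\ge0}$ is the single jump filtration, and all notions below refer to $\mathbb F$ (no completion). Put $G(t)=\mathsf P(\gamma\le t)$ and $\overline G=1-G$ on $\mathbb R_+=[0,\infty)$, $t_G=\sup\{t\in\mathbb R_+: G(t)<1\}$, $\mathcal T=\{t\in\mathbb R_+:\mathsf P(\gamma\ge t)>0\}$. *Processes.* Paths are càdlàg almost surely. A local martingale is an adapted process $M$ such that, for some stopping times $T_n\uparrow\infty$ a.s., every stopped process $M^{T_n}$ is a uniformly integrable martingale. A semimartingale is the sum of a local martingale and an adapted process of finite variation on compact intervals; for the filtration $\mathbb F$ all semimartingales have finite variation. A $\sigma$-martingale is a semimartingale $M$ for which there are predictable sets $\Sigma_1\subseteq\Sigma_2\subseteq\cdots$ with $\bigcup_n\Sigma_n=\Omega\times\mathbb R_+$ such that,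 for every $n$, the Lebesgue–Stieltjes integral process $t\mapsto\int_{(0,t]}\mathbf 1_{\Sigma_n}\,dM$ is (up to indistinguishability) a uniformly integrable martingale. *Condition M.* $L^1_{\rm loc}(dG)$ is the set of Borel functions $z$ on $\mathcal T$ with $\int_{[0,t]}|z|\,dG<\infty$ for all $t\in\mathcal T$. A pair of functions $F:[0,t_G)\to\mathbb R$, $H:\mathcal T\to\mathbb R$ satisfies Condition M if: there is $z\in L^1_{\rm loc}(dG)$ with $F(t)=F(0)+\int_{(0,t]}z\,dG$ for all $t<t_G$; $H\in L^1_{\rm loc}(dG)$; $F(t)\overline G(t)+\int_{(0,t]}H\,dG=F(0)\overline G(0)$ for all $t<t_G$; and, if $t_G<\infty$ and $\mathsf P(\gamma=t_G)>0$, $\lim_{t\uparrow t_G,\,t<t_G}F(t)=H(t_G)$. For a random variable $X$ with $\mathsf E[|X|\,|\,\gamma]<\infty$ a.s. (not necessarily integrable) put $\mathsf E[X|\gamma]=\mathsf E[X^+|\gamma]-\mathsf E[X^-|\gamma]$. **Theorem.** Let $M=(M_t)_{t\in\mathbb R_+}$ be an adapted right-continuous process. (1) $M$ is a $\sigma$-martingale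 if and only if there are a pair $(F,H)$ satisfying Condition M and a (finite) random variable $L'$ with $$\mathsf E\bigl[|L'|\mathbf 1_{\{\gamma>0\}}\,\big|\,\gamma\bigr]<\infty\quad\text{and}\quad \mathsf E\bigl[L'\mathbf 1_{\{\gamma>0\}}\,\big|\,\gamma\bigr]=0\quad\text{a.s.}$$ such that, up to indistinguishability, $$M_t=F(t)\mathbf 1_{\{t<\gamma\}}+\bigl(H(\gamma)+L'\bigr)\mathbf 1_{\{t\ge\gamma\}},\qquad t\in\mathbb R_+ .$$ (2) $M$ is a $\sigma$-martingale and $M_0$ is integrable if and only if there is such a representation with $\mathsf E[|L'|\,|\,\gamma]<\infty$ and $\mathsf E[L'|\gamma]=0$ a.s. on the whole of $\Omega$. (3) If $\mathscr F=\sigma\{\gamma\}$, then every $\sigma$-martingale $M$ with $M_0$ integrable is a local martingale. -/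

import Mathlib

open Set Filter Topology MeasureTheory ProbabilityTheory
open scoped NNReal ENNReal

namespace SingleJump

noncomputable section

/-! ### The single jump filtration -/

/-- The single jump filtration generated by `γ` and the ambient `σ`-field: `A` belongs to `𝓕 t`
iff `A` is measurable and `A ∩ {t < γ}` is either empty or the whole of `{t < γ}`. -/
def filtration {Ω : Type*} [mΩ : MeasurableSpace Ω] (γ : Ω → ℝ≥0∞) :
    Filtration ℝ≥0 mΩ where
  seq t :=
    { MeasurableSet' := fun A => MeasurableSet[mΩ] A ∧
        (A ∩ {ω | (t : ℝ≥0∞) < γ ω} = ∅ ∨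
          A ∩ {ω | (t : ℝ≥0∞) < γ ω} = {ω | (t : ℝ≥0∞) < γ ω})
      measurableSet_empty := ⟨MeasurableSet.empty, Or.inl (empty_inter _)⟩
      measurableSet_compl := by
        rintro A ⟨hA, h | h⟩
        · refine ⟨hA.compl, Or.inr ?_⟩
          rw [inter_eq_right]
          intro ω hω hωA
          have : ω ∈ A ∩ {ω | (t : ℝ≥0∞) < γ ω} := ⟨hωA, hω⟩
          rw [h] at this
          exact this
        · refine ⟨hA.compl, Or.inl ?_⟩
          rw [inter_eq_right] at h
          ext ω
          exact ⟨fun hω => hω.1 (h hω.2), fun hω => hω.elim⟩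
      measurableSet_iUnion := by
        intro f hf
        refine ⟨MeasurableSet.iUnion fun i => (hf i).1, ?_⟩
        by_cases hex : ∃ i, f i ∩ {ω | (t : ℝ≥0∞) < γ ω} = {ω | (t : ℝ≥0∞) < γ ω}
        · obtain ⟨i, hi⟩ := hex
          right
          rw [inter_eq_right] at hi ⊢
          exact hi.trans (subset_iUnion f i)
        · left
          rw [iUnion_inter, iUnion_eq_empty]
          intro i
          rcases (hf i).2 with h | h
          · exact h
          · exact (hex ⟨i, h⟩).elim }
  mono' := by
    rintro s t hst A ⟨hA, h⟩
    have hsub : {ω | (t : ℝ≥0∞) < γ ω} ⊆ {ω | (s : ℝ≥0∞) < γ ω} := fun ω hω =>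
      lt_of_le_of_lt (ENNReal.coe_le_coe.2 hst) hω
    refine ⟨hA, ?_⟩
    rcases h with h | h
    · left
      exact subset_empty_iff.1 (h ▸ inter_subset_inter_right A hsub)
    · right
      rw [inter_eq_right] at h ⊢
      exact hsub.trans h
  le' := fun _ _ hA => hA.1

/-! ### Martingales, semimartingales and `σ`-martingales -/

/-- `f` is right-continuous everywhere and has finite left limits at every `t > 0`. -/
def IsCadlag (f : ℝ≥0 → ℝ) : Prop :=
  (∀ t, ContinuousWithinAt f (Ici t) t) ∧ ∀ t, 0 < t → ∃ l : ℝ, Tendsto f (𝓝[<] t) (𝓝 l)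

section Processes

variable {Ω : Type*} [mΩ : MeasurableSpace Ω]

/-- Uniformly integrable martingales with almost surely càdlàg paths. -/
def IsUIMartingale (𝓕 : Filtration ℝ≥0 mΩ) (P : Measure Ω) (M : ℝ≥0 → Ω → ℝ) : Prop :=
  Martingale M 𝓕 P ∧ UniformIntegrable M 1 P ∧ ∀ᵐ ω ∂P, IsCadlag fun t => M t ω

/-- Local martingales: the stopped processes `M^{τ n}` are uniformly integrable martingales for
some stopping times `τ n` increasing almost surely to infinity. -/
def IsLocalMartingale (𝓕 : Filtration ℝ≥0 mΩ) (P : Measure Ω) (M : ℝ≥0 → Ω → ℝ) : Prop :=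
  StronglyAdapted 𝓕 M ∧ (∀ᵐ ω ∂P, IsCadlag fun t => M t ω) ∧
    ∃ τ : ℕ → Ω → WithTop ℝ≥0, IsLocalizingSequence 𝓕 τ P ∧
      ∀ n, IsUIMartingale 𝓕 P (stoppedProcess M (τ n))

/-- Adapted processes whose almost all paths are càdlàg and of finite variation on every compact
interval. They need not start from `0`. -/
def IsFiniteVariation (𝓕 : Filtration ℝ≥0 mΩ) (P : Measure Ω) (A : ℝ≥0 → Ω → ℝ) : Prop :=
  StronglyAdapted 𝓕 A ∧
    ∀ᵐ ω ∂P, IsCadlag (fun t => A t ω) ∧ LocallyBoundedVariationOn (fun t => A t ω) univ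

/-- Semimartingales: sums of a local martingale and of a process with finite variation. -/
def IsSemimartingale (𝓕 : Filtration ℝ≥0 mΩ) (P : Measure Ω) (M : ℝ≥0 → Ω → ℝ) : Prop :=
  ∃ N A : ℝ≥0 → Ω → ℝ, IsLocalMartingale 𝓕 P N ∧ IsFiniteVariation 𝓕 P A ∧
    ∀ t ω, M t ω = N t ω + A t ω

open scoped Classical in
/-- The Lebesgue–Stieltjes integral `∫_{(0,t]} 1_S df` of the indicator function of a Borel set
`S` with respect to a right-continuous function `f` of finite variation on `[0,t]`: the value at
`S ∩ (0,t]` of the signed measure generated by `s ↦ f (s ∧ t)`. (It is `0` by convention if `f`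
has infinite variation on `[0,t]`.) -/
def lsIntegral (S : Set ℝ≥0) (f : ℝ≥0 → ℝ) (t : ℝ≥0) : ℝ :=
  if h : BoundedVariationOn (fun s => f (min s t)) univ then h.vectorMeasure (S ∩ Ioc 0 t) else 0

/-- `σ`-martingales: semimartingales `M` for which there are predictable sets `Σ n` increasing to
`ℝ₊ × Ω` such that every integral process `1_{Σ n} · M` is (indistinguishable from) a uniformly
integrable martingale. With respect to a single jump filtration all semimartingales have paths of
finite variation almost surely, so that the integral is the pathwise Lebesgue–Stieltjes one. -/
def IsSigmaMartingale (𝓕 : Filtration ℝ≥0 mΩ) (P : Measure Ω) (M : ℝ≥0 → Ω → ℝ) : Prop :=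
  IsSemimartingale 𝓕 P M ∧
    ∃ S : ℕ → Set (ℝ≥0 × Ω), (∀ n, MeasurableSet[𝓕.predictable] (S n)) ∧ Monotone S ∧
      (⋃ n, S n) = univ ∧
      ∀ n, ∃ Y : ℝ≥0 → Ω → ℝ, IsUIMartingale 𝓕 P Y ∧
        ∀ᵐ ω ∂P, ∀ t, Y t ω = lsIntegral {s | (s, ω) ∈ S n} (fun s => M s ω) t

end Processes

/-! ### Generalized conditional expectations -/

/-- `E[|X| | m] < ∞` almost surely. -/
def CondIntegrable {Ω : Type*} {mΩ : MeasurableSpace Ω} (m : MeasurableSpace Ω)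
    (P : Measure[mΩ] Ω) (X : Ω → ℝ) : Prop :=
  ∀ᵐ ω ∂P, condLExp m P (fun ω' => ENNReal.ofReal |X ω'|) ω < ∞

/-- The generalized conditional expectation `E[X | m] = E[X⁺ | m] - E[X⁻ | m]`, for `X` such that
`E[|X| | m] < ∞` almost surely; `X` need not be integrable. -/
def genCondExp {Ω : Type*} {mΩ : MeasurableSpace Ω} (m : MeasurableSpace Ω)
    (P : Measure[mΩ] Ω) (X : Ω → ℝ) (ω : Ω) : ℝ :=
  (condLExp m P (fun ω' => ENNReal.ofReal (X ω')) ω).toReal -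
    (condLExp m P (fun ω' => ENNReal.ofReal (-X ω')) ω).toReal

/-! ### Condition M, for a law `μ` on `[0,∞]` -/

/-- The distribution function `G(t) = μ [0,t]`. -/
def G (μ : Measure ℝ≥0∞) (t : ℝ≥0) : ℝ := μ.real (Iic (t : ℝ≥0∞))

/-- The measure `dG` on `ℝ₊`: the restriction of `μ` to finite values. -/
def dG (μ : Measure ℝ≥0∞) : Measure ℝ≥0 := μ.comap ((↑) : ℝ≥0 → ℝ≥0∞)

/-- The right endpoint `t_G = sup {t ∈ ℝ₊ : G(t) < 1}`. -/
def tG (μ : Measure ℝ≥0∞) : ℝ≥0∞ := sSup ((↑) '' {t : ℝ≥0 | G μ t < 1})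

/-- `𝒯 = {t ∈ ℝ₊ : μ [t,∞] > 0}`. -/
def domT (μ : Measure ℝ≥0∞) : Set ℝ≥0 := {t | 0 < μ (Ici (t : ℝ≥0∞))}

/-- `L¹_loc(dG)`: Borel functions on `𝒯` which are `dG`-integrable over `[0,t]` for all `t ∈ 𝒯`.
The values outside `𝒯` are irrelevant. -/
def L1loc (μ : Measure ℝ≥0∞) (z : ℝ≥0 → ℝ) : Prop :=
  Measurable ((domT μ).domRestrict z) ∧ ∀ t ∈ domT μ, IntegrableOn z (Icc 0 t) (dG μ)

/-- Local absolute continuity of `Z` on `[0,t_G)` with respect to `G`. -/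
def LocAC (μ : Measure ℝ≥0∞) (Z : ℝ≥0 → ℝ) : Prop :=
  ∃ z, L1loc μ z ∧ ∀ t : ℝ≥0, (t : ℝ≥0∞) < tG μ → Z t = Z 0 + ∫ s in Ioc 0 t, z s ∂(dG μ)

/-- Condition M for `F : [0,t_G) → ℝ` and `H : 𝒯 → ℝ`; only the values of `F` on `[0,t_G)` and of
`H` on `𝒯` are involved. -/
structure ConditionM (μ : Measure ℝ≥0∞) (F H : ℝ≥0 → ℝ) : Prop where
  locAC : LocAC μ F
  l1loc : L1loc μ H
  balance : ∀ t : ℝ≥0, (t : ℝ≥0∞) < tG μ →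
    F t * (1 - G μ t) + ∫ s in Ioc 0 t, H s ∂(dG μ) = F 0 * (1 - G μ 0)
  caseB : tG μ < ∞ → 0 < μ {tG μ} →
    Tendsto F (𝓝[<] (tG μ).toNNReal) (𝓝 (H (tG μ).toNNReal))

/-- Up to indistinguishability, `M_t = F(t) 1_{t < γ} + (H(γ) + L') 1_{t ≥ γ}`. -/
def Represents {Ω : Type*} [MeasurableSpace Ω] (P : Measure Ω) (γ : Ω → ℝ≥0∞)
    (F H : ℝ≥0 → ℝ) (L' : Ω → ℝ) (M : ℝ≥0 → Ω → ℝ) : Prop :=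
  ∀ᵐ ω ∂P, ∀ t : ℝ≥0,
    ((t : ℝ≥0∞) < γ ω → M t ω = F t) ∧
      (γ ω ≤ (t : ℝ≥0∞) → M t ω = H (γ ω).toNNReal + L' ω)

end

end SingleJump

namespace SingleJump

/-! ### Signed measures on the half-line -/

/-! The filtration is so coarse that every object is deterministic before the jump. An adapted
process equals a function `F` on `{t < γ}`. All measurable subsets of `{γ ≤ s}` lie in the `σ`-field
at time `s`, so a uniformly integrable martingale is a.s. constant from `γ` on
(`IsUIMartingale.ae_const_after`), and so is a `σ`-martingale, by letting the predictable sets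
increase. Hence `M` is `F` before `γ` and a random variable `ξ` afterwards. On `(0,γ]` a predictable
set is a deterministic set of times `B` (`exists_of_predictable`), so the integral of its indicator
is the explicit path `restrictedPath`.

Conversely, a suitably dominated càdlàg process that is deterministic before `γ` and constant
afterwards is a martingale as soon as its expectation is constant (`isUIMartingale_of_integral_eq`):
an event of time `s`, or its complement, is contained in `{γ ≤ s}`. The martingale property of
`restrictedPath` is therefore a single family of scalar identities. Let `μ` be the law of `γ` and
`ν` the signed measure of increments of `F`. By Fubini the mean of the part before the jump is `avg
μ ν C = ∫_C μ(s,∞] dν(s)`, and with `H(γ) = E[ξ|γ]` the identities say that the tail of `μ` times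
`dν` equals `(F₋ - H) dG` on the sets `B n ∩ (0,t]`.

This measure equation is Condition M. As `avg μ ν` has finite total variation, the exhausting sets
`B n` can be dropped (`signedMeasure_eq_integral_of_cover`). Dividing by the tail yields the
absolute continuity of `F`, evaluating on `(0,t]` yields the balance equation by integration by
parts, and evaluating at an atom at `t_G`, where the tail vanishes, yields `F(t_G-) = H(t_G)`. The
two directions are `conditionM_of_avg` and `ConditionM.exists_signedMeasure`.

The remainder `L' = ξ - H(γ)` has conditional mean zero on `{γ > 0}` but need not be integrable;
integrating only over `γ`-sets on which it is integrable is exactly what the `σ`-localization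
permits. At `γ = 0` nothing is integrated, so `L'` is free there; if `M 0` is integrable, moving its
mean on `{γ = 0}` into `H 0` centres it. If `γ` generates the `σ`-field then the centred `L'`
vanishes, and stopping at deterministic times exhausting `𝒯` localizes `M`. -/

lemma tendsto_signedMeasure {α ι : Type*} [MeasurableSpace α] (ν : SignedMeasure α) {L : Filter ι}
    [L.IsCountablyGenerated] {As : ι → Set α} {A : Set α} (hAs : ∀ i, MeasurableSet (As i))
    (hA : MeasurableSet A) (h : ∀ x, ∀ᶠ i in L, x ∈ As i ↔ x ∈ A) :
    Tendsto (fun i => ν (As i)) L (𝓝 (ν A)) := by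
  have key : ∀ p : Measure α, IsFiniteMeasure p →
      Tendsto (fun i => p.real (As i)) L (𝓝 (p.real A)) := fun p hp =>
    (ENNReal.tendsto_toReal (measure_ne_top p A)).comp
      (tendsto_measure_of_tendsto_indicator_of_isFiniteMeasure L p hAs h)
  rw [ν.apply_eq_posPart_real_sub_negPart_real hA]
  simp_rw [fun i => ν.apply_eq_posPart_real_sub_negPart_real (hAs i)]
  exact (key _ inferInstance).sub (key _ inferInstance)

lemma abs_signedMeasure_le {α : Type*} [MeasurableSpace α] (ν : SignedMeasure α) (A : Set α) :
    |ν A| ≤ ν.totalVariation.real univ := by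
  by_cases hA : MeasurableSet A
  · rw [ν.apply_eq_posPart_real_sub_negPart_real hA, SignedMeasure.totalVariation,
      measureReal_add_apply]
    have h1 : ν.toJordanDecomposition.posPart.real A ≤ ν.toJordanDecomposition.posPart.real univ :=
      measureReal_mono (subset_univ _)
    have h2 : ν.toJordanDecomposition.negPart.real A ≤ ν.toJordanDecomposition.negPart.real univ :=
      measureReal_mono (subset_univ _)
    rw [abs_le]
    constructor <;>
      linarith [measureReal_nonneg (μ := ν.toJordanDecomposition.posPart) (s := A),
        measureReal_nonneg (μ := ν.toJordanDecomposition.negPart) (s := A)]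
  · rw [ν.not_measurable hA, abs_zero]
    exact measureReal_nonneg

lemma tendsto_signedMeasure_Ioc_left (ν : SignedMeasure ℝ≥0) (t : ℝ≥0) :
    Tendsto (fun u => ν (Ioc 0 u)) (𝓝[<] t) (𝓝 (ν (Ioo 0 t))) := by
  refine tendsto_signedMeasure ν (fun _ => measurableSet_Ioc) measurableSet_Ioo fun x => ?_
  rcases lt_or_ge x t with hx | hx
  · filter_upwards [Ico_mem_nhdsLT hx] with u hu
    simp [hu.1, hx]
  · filter_upwards [self_mem_nhdsWithin] with u hu
    simp [hx.not_gt, (lt_of_lt_of_le (mem_Iio.1 hu) hx).not_ge]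

lemma isCadlag_signedMeasure_Ioc (ν : SignedMeasure ℝ≥0) : IsCadlag fun t => ν (Ioc 0 t) := by
  refine ⟨fun t => ?_, fun t _ => ⟨_, tendsto_signedMeasure_Ioc_left ν t⟩⟩
  refine tendsto_signedMeasure ν (fun _ => measurableSet_Ioc) measurableSet_Ioc fun x => ?_
  rcases le_or_gt x t with hx | hx
  · filter_upwards [self_mem_nhdsWithin] with u hu
    simp [hx, hx.trans hu]
  · filter_upwards [mem_nhdsWithin_of_mem_nhds (Iio_mem_nhds hx)] with u hu
    simp [hx.not_ge, (mem_Iio.1 hu).not_ge]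

/-- After restriction to `(0,T)` this is uniqueness on the π-system of the rays `Iic u`; the total
mass is the limit of the values on `(0,u]` as `u` increases to `T`. The endpoint `T` is left out
because `ν` is not known there. -/
lemma signedMeasure_eq_zero_of_Ioo (ν : SignedMeasure ℝ≥0) {T : ℝ≥0}
    (h : ∀ u < T, ν (Ioc 0 u) = 0) {C : Set ℝ≥0} (hC : MeasurableSet C) (hCT : C ⊆ Ioo 0 T) :
    ν C = 0 := by
  have h0 : ν (Ioo 0 T) = 0 := by
    rcases eq_or_ne T 0 with rfl | hT
    · simp
    have : (𝓝[<] T).NeBot := nhdsLT_neBot_of_exists_lt ⟨0, pos_iff_ne_zero.2 hT⟩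
    refine tendsto_nhds_unique (tendsto_signedMeasure_Ioc_left ν T)
      (tendsto_const_nhds.congr' ?_)
    filter_upwards [self_mem_nhdsWithin] with u hu using (h u hu).symm
  have key : ν.restrict (Ioo 0 T) = 0 := by
    refine VectorMeasure.ext_of_generateFrom (range Iic) ?_
      (BorelSpace.measurable_eq.trans (borel_eq_generateFrom_Iic ℝ≥0)) isPiSystem_Iic ?_
    · rintro _ ⟨u, rfl⟩
      rw [VectorMeasure.restrict_apply _ measurableSet_Ioo measurableSet_Iic]
      rcases lt_or_ge u T with hu | hu
      · have : Iic u ∩ Ioo 0 T = Ioc 0 u := by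
          ext x; simp only [mem_inter_iff, mem_Iic, mem_Ioo, mem_Ioc]
          exact ⟨fun hx => ⟨hx.2.1, hx.1⟩, fun hx => ⟨hx.2, hx.1, hx.2.trans_lt hu⟩⟩
        rw [this, h u hu]; simp
      · have : Iic u ∩ Ioo 0 T = Ioo 0 T :=
          inter_eq_right.2 fun x hx => (hx.2.trans_le hu).le
        rw [this, h0]; simp
    · rw [VectorMeasure.restrict_apply_univ, h0]; simp
  rw [← VectorMeasure.restrict_eq_self _ measurableSet_Ioo hC hCT, key]; simp

lemma signedMeasure_eq_zero_of_Ioc (ν : SignedMeasure ℝ≥0) {T : ℝ≥0}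
    (h : ∀ u ≤ T, ν (Ioc 0 u) = 0) {C : Set ℝ≥0} (hC : MeasurableSet C) (hCT : C ⊆ Ioc 0 T) :
    ν C = 0 := by
  have key : ∀ C, MeasurableSet C → C ⊆ Ioo 0 T → ν C = 0 := fun C hC hCT =>
    signedMeasure_eq_zero_of_Ioo ν (fun u hu => h u hu.le) hC hCT
  rw [← VectorMeasure.of_add_of_sdiff (A := C ∩ Iio T) (B := C) (hC.inter measurableSet_Iio) hC
    inter_subset_left, key _ (hC.inter measurableSet_Iio) fun x hx => ⟨(hCT hx.1).1, hx.2⟩, zero_add]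
  rcases eq_or_ne T 0 with rfl | hT
  · rw [show C \ (C ∩ Iio 0) = ∅ from
      eq_empty_of_forall_notMem fun x hx => absurd (hCT hx.1) (by simp)]
    simp
  by_cases hTC : T ∈ C
  · have h1 : C \ (C ∩ Iio T) = Ioc 0 T \ Ioo 0 T := by
      ext x
      simp only [Set.mem_sdiff, mem_inter_iff, mem_Iio, mem_Ioc, mem_Ioo, not_and, not_lt]
      constructor
      · rintro ⟨hx, hx'⟩
        exact ⟨hCT hx, fun _ => hx' hx⟩
      · rintro ⟨hx, hx'⟩
        obtain rfl : x = T := le_antisymm hx.2 (hx' hx.1)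
        exact ⟨hTC, fun _ => le_rfl⟩
    rw [h1, VectorMeasure.of_sdiff measurableSet_Ioo measurableSet_Ioc Ioo_subset_Ioc_self,
      h T le_rfl, key _ measurableSet_Ioo le_rfl, sub_zero]
  · rw [show C \ (C ∩ Iio T) = ∅ from eq_empty_of_forall_notMem fun x hx =>
      hx.2 ⟨hx.1, lt_of_le_of_ne (hCT hx.1).2 fun h => hTC (h ▸ hx.1)⟩]
    simp

/-! ### The measure `dG` -/

lemma measurableEmbedding_coe : MeasurableEmbedding ((↑) : ℝ≥0 → ℝ≥0∞) :=
  ENNReal.isOpenEmbedding_coe.measurableEmbedding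

lemma dG_apply (μ : Measure ℝ≥0∞) (C : Set ℝ≥0) :
    dG μ C = μ (((↑) : ℝ≥0 → ℝ≥0∞) '' C) :=
  measurableEmbedding_coe.comap_apply _ _

instance isFiniteMeasure_dG (μ : Measure ℝ≥0∞) [IsFiniteMeasure μ] : IsFiniteMeasure (dG μ) :=
  ⟨by rw [dG_apply]; exact measure_lt_top _ _⟩

lemma map_dG_restrict (μ : Measure ℝ≥0∞) (C : Set ℝ≥0) :
    ((dG μ).restrict C).map ((↑) : ℝ≥0 → ℝ≥0∞) = μ.restrict (((↑) : ℝ≥0 → ℝ≥0∞) '' C) := by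
  ext A hA
  rw [Measure.map_apply measurable_coe_nnreal_ennreal hA,
    Measure.restrict_apply (measurable_coe_nnreal_ennreal hA), dG_apply, Measure.restrict_apply hA,
    image_preimage_inter]

lemma setIntegral_dG (μ : Measure ℝ≥0∞) (h : ℝ≥0 → ℝ) (C : Set ℝ≥0) :
    ∫ s in C, h s ∂(dG μ) = ∫ x in ((↑) : ℝ≥0 → ℝ≥0∞) '' C, h x.toNNReal ∂μ := by
  rw [← map_dG_restrict, measurableEmbedding_coe.integral_map]
  simp

lemma integrableOn_dG (μ : Measure ℝ≥0∞) (h : ℝ≥0 → ℝ) (C : Set ℝ≥0) :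
    IntegrableOn h C (dG μ) ↔
      IntegrableOn (fun x => h x.toNNReal) (((↑) : ℝ≥0 → ℝ≥0∞) '' C) μ := by
  rw [IntegrableOn, IntegrableOn, ← map_dG_restrict, measurableEmbedding_coe.integrable_map_iff]
  simp [Function.comp_def]

/-! ### Tails of the law -/

lemma one_sub_G (μ : Measure ℝ≥0∞) [IsProbabilityMeasure μ] (t : ℝ≥0) :
    1 - G μ t = μ.real (Ioi (t : ℝ≥0∞)) := by
  rw [G, ← compl_Iic, probReal_compl_eq_one_sub measurableSet_Iic]

/-- Continuity from below: `(t,∞]` is the union of the rays `(t + 1/(n+1), ∞]`. The gain of a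
strictly larger `s` is what makes `t` lie strictly below the supremum `t_G`. -/
lemma exists_tail_pos_of_tail_pos {μ : Measure ℝ≥0∞} {t : ℝ≥0} (h : 0 < μ (Ioi (t : ℝ≥0∞))) :
    ∃ s : ℝ≥0, t < s ∧ 0 < μ (Ioi (s : ℝ≥0∞)) := by
  by_contra! hc
  refine h.ne' (measure_mono_null (t := ⋃ n : ℕ, Ioi (((t + 1 / (n + 1) : ℝ≥0)) : ℝ≥0∞)) ?_
    (measure_iUnion_null fun n => nonpos_iff_eq_zero.1 (hc _ ?_)))
  · intro x hx
    rw [mem_iUnion]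
    induction x with
    | top => exact ⟨0, ENNReal.coe_lt_top⟩
    | coe x =>
      have hx' : t < x := ENNReal.coe_lt_coe.1 hx
      obtain ⟨n, hn⟩ := exists_nat_one_div_lt (tsub_pos_of_lt hx')
      exact ⟨n, ENNReal.coe_lt_coe.2 (lt_tsub_iff_left.1 hn)⟩
  · exact lt_add_of_pos_right _ (by positivity)

lemma lt_tG_iff (μ : Measure ℝ≥0∞) [IsProbabilityMeasure μ] (t : ℝ≥0) :
    (t : ℝ≥0∞) < tG μ ↔ 0 < μ (Ioi (t : ℝ≥0∞)) := by
  have key : ∀ s, G μ s < 1 ↔ 0 < μ (Ioi (s : ℝ≥0∞)) := fun s => by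
    rw [← sub_pos, one_sub_G, measureReal_def, ENNReal.toReal_pos_iff]
    simp [measure_lt_top]
  constructor
  · intro h
    obtain ⟨_, ⟨s, hs, rfl⟩, hts⟩ := lt_sSup_iff.1 h
    exact ((key s).1 hs).trans_le (measure_mono (Ioi_subset_Ioi hts.le))
  · intro h
    obtain ⟨s, hts, hs⟩ := exists_tail_pos_of_tail_pos h
    exact lt_of_lt_of_le (ENNReal.coe_lt_coe.2 hts) (le_sSup ⟨s, (key s).2 hs, rfl⟩)

lemma mem_domT {μ : Measure ℝ≥0∞} {t : ℝ≥0} : t ∈ domT μ ↔ 0 < μ (Ici (t : ℝ≥0∞)) := Iff.rfl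

lemma mem_domT_of_le {μ : Measure ℝ≥0∞} {s t : ℝ≥0} (hst : s ≤ t) (ht : t ∈ domT μ) :
    s ∈ domT μ :=
  lt_of_lt_of_le (mem_domT.1 ht) (measure_mono (Ici_subset_Ici.2 (ENNReal.coe_le_coe.2 hst)))

lemma zero_mem_domT (μ : Measure ℝ≥0∞) [IsProbabilityMeasure μ] : (0 : ℝ≥0) ∈ domT μ := by
  rw [mem_domT]; simp

lemma mem_domT_of_tail_pos {μ : Measure ℝ≥0∞} {t : ℝ≥0} (h : 0 < μ (Ioi (t : ℝ≥0∞))) :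
    t ∈ domT μ :=
  h.trans_le (measure_mono Ioi_subset_Ici_self)

lemma tail_pos_of_lt {μ : Measure ℝ≥0∞} {s T : ℝ≥0} (hT : T ∈ domT μ) (hs : s < T) :
    0 < μ (Ioi (s : ℝ≥0∞)) :=
  lt_of_lt_of_le (mem_domT.1 hT) (measure_mono (Ici_subset_Ioi.2 (ENNReal.coe_lt_coe.2 hs)))

lemma ordConnected_domT (μ : Measure ℝ≥0∞) : (domT μ).OrdConnected :=
  ⟨fun _ _ _ hy _ hz => mem_domT_of_le hz.2 hy⟩

lemma measurableSet_domT (μ : Measure ℝ≥0∞) : MeasurableSet (domT μ) :=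
  (ordConnected_domT μ).measurableSet

lemma exists_seq_domT (μ : Measure ℝ≥0∞) [IsProbabilityMeasure μ] :
    ∃ u : ℕ → ℝ≥0, Monotone u ∧ (∀ n, u n ∈ domT μ) ∧ ∀ t ∈ domT μ, ∃ n, t ≤ u n := by
  have := ordConnected_domT μ
  have : Nonempty (domT μ) := ⟨⟨0, zero_mem_domT μ⟩⟩
  obtain ⟨u, hu, hu'⟩ := exists_seq_monotone_tendsto_atTop_atTop (domT μ)
  refine ⟨fun n => u n, fun m n h => hu h, fun n => (u n).2, fun t ht => ?_⟩
  obtain ⟨n, hn⟩ := (hu'.eventually (eventually_ge_atTop (⟨t, ht⟩ : domT μ))).exists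
  exact ⟨n, hn⟩

/-- The quantifier over `t` is uncountable and stands inside the almost sure event, so the
exceptional set has to be a single ray. It starts at the infimum of the complement of `𝒯`, and is
closed or open according to whether that infimum is outside or inside `𝒯`. -/
lemma ae_mem_domT (μ : Measure ℝ≥0∞) [IsProbabilityMeasure μ] :
    ∀ᵐ x ∂μ, ∀ t : ℝ≥0, (t : ℝ≥0∞) ≤ x → t ∈ domT μ := by
  by_cases hex : ∃ t, t ∉ domT μ
  swap
  · push Not at hex
    exact Eventually.of_forall fun x t _ => hex t
  have hlow : ∀ t, t ∉ domT μ → μ (Ici (t : ℝ≥0∞)) = 0 := fun t ht => by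
    simpa [mem_domT] using ht
  set m := sInf (domT μ)ᶜ with hm
  have hlt : ∀ t < m, t ∈ domT μ := fun t ht => by
    by_contra hc
    exact (csInf_le' hc).not_gt ht
  have hgt : ∀ t, m < t → t ∉ domT μ := fun t ht hc => by
    obtain ⟨s, hs, hst⟩ := exists_lt_of_csInf_lt hex ht
    exact hs (mem_domT_of_le hst.le hc)
  have h0 : μ (Ioi (m : ℝ≥0∞)) = 0 := by
    by_contra hc
    obtain ⟨s, hs, hs'⟩ := exists_tail_pos_of_tail_pos (pos_iff_ne_zero.2 hc)
    exact hgt s hs (mem_domT_of_tail_pos hs')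
  by_cases hmT : m ∈ domT μ
  · have : ∀ᵐ x ∂μ, x ≤ (m : ℝ≥0∞) := by
      simpa [ae_iff, Ioi] using h0
    filter_upwards [this] with x hx t ht
    exact mem_domT_of_le (ENNReal.coe_le_coe.1 (ht.trans hx)) hmT
  · have : ∀ᵐ x ∂μ, x < (m : ℝ≥0∞) := by
      simpa [ae_iff, Ici] using hlow m hmT
    filter_upwards [this] with x hx t ht
    exact hlt t (ENNReal.coe_lt_coe.1 (ht.trans_lt hx))

/-! ### Averages of signed measures over the region before the jump -/

/-- The times strictly before `x`. -/
def pre (x : ℝ≥0∞) : Set ℝ≥0 := {s | (s : ℝ≥0∞) < x}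

lemma measurableSet_pre (x : ℝ≥0∞) : MeasurableSet (pre x) :=
  measurableSet_lt measurable_coe_nnreal_ennreal measurable_const

lemma measurable_tail (μ : Measure ℝ≥0∞) : Measurable fun s : ℝ≥0 => μ (Ioi (s : ℝ≥0∞)) :=
  Antitone.measurable fun _ _ h => measure_mono (Ioi_subset_Ioi (ENNReal.coe_le_coe.2 h))

instance isFiniteMeasure_withDensity_tail (μ : Measure ℝ≥0∞) [IsFiniteMeasure μ] (p : Measure ℝ≥0)
    [IsFiniteMeasure p] : IsFiniteMeasure (p.withDensity fun s => μ (Ioi (s : ℝ≥0∞))) :=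
  isFiniteMeasure_withDensity <| ne_of_lt <|
    lt_of_le_of_lt (lintegral_mono fun _ => measure_mono (subset_univ _))
      (by rw [lintegral_const]; exact ENNReal.mul_lt_top (measure_lt_top _ _) (measure_lt_top _ _))

/-- Tonelli on the region `{(x, s) | s ∈ C, s < x}`: a fixed `s` is counted with the `μ`-mass of the
`x` beyond it. -/
lemma lintegral_measure_inter_pre (μ : Measure ℝ≥0∞) [IsFiniteMeasure μ] (p : Measure ℝ≥0)
    [IsFiniteMeasure p] {C : Set ℝ≥0} (hC : MeasurableSet C) :
    ∫⁻ x, p (C ∩ pre x) ∂μ = (p.withDensity fun s => μ (Ioi (s : ℝ≥0∞))) C := by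
  have hm : MeasurableSet {y : ℝ≥0∞ × ℝ≥0 | y.2 ∈ C ∧ (y.2 : ℝ≥0∞) < y.1} :=
    (measurable_snd hC).inter
      (measurableSet_lt (measurable_coe_nnreal_ennreal.comp measurable_snd) measurable_fst)
  have h1 := Measure.prod_apply (μ := μ) (ν := p) hm
  rw [Measure.prod_apply_symm hm] at h1
  rw [withDensity_apply _ hC, ← lintegral_indicator hC]
  refine h1.symm.trans (lintegral_congr fun s => ?_)
  by_cases hs : s ∈ C
  · simp [hs, preimage, Ioi]
  · simp [hs, preimage]

lemma measurable_measure_inter_pre (p : Measure ℝ≥0) (C : Set ℝ≥0) :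
    Measurable fun x => p (C ∩ pre x) :=
  Monotone.measurable fun _ _ h =>
    measure_mono (inter_subset_inter_right _ fun _ hs => lt_of_lt_of_le hs h)

lemma integral_measureReal_inter_pre (μ : Measure ℝ≥0∞) [IsFiniteMeasure μ] (p : Measure ℝ≥0)
    [IsFiniteMeasure p] {C : Set ℝ≥0} (hC : MeasurableSet C) :
    ∫ x, p.real (C ∩ pre x) ∂μ = (p.withDensity fun s => μ (Ioi (s : ℝ≥0∞))).real C := by
  rw [measureReal_def, ← lintegral_measure_inter_pre μ p hC]
  exact integral_toReal (measurable_measure_inter_pre p C).aemeasurable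
    (Eventually.of_forall fun _ => measure_lt_top _ _)

lemma measurable_signedMeasure_inter_pre (ν : SignedMeasure ℝ≥0) {C : Set ℝ≥0}
    (hC : MeasurableSet C) : Measurable fun x => ν (C ∩ pre x) := by
  simp_rw [fun x => ν.apply_eq_posPart_real_sub_negPart_real (hC.inter (measurableSet_pre x))]
  exact (measurable_measure_inter_pre _ C).ennreal_toReal.sub
    (measurable_measure_inter_pre _ C).ennreal_toReal

lemma integrable_signedMeasure_inter_pre (μ : Measure ℝ≥0∞) [IsFiniteMeasure μ]
    (ν : SignedMeasure ℝ≥0) {C : Set ℝ≥0} (hC : MeasurableSet C) :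
    Integrable (fun x => ν (C ∩ pre x)) μ :=
  Integrable.of_bound (measurable_signedMeasure_inter_pre ν hC).aestronglyMeasurable
    (ν.totalVariation.real univ) (Eventually.of_forall fun _ => abs_signedMeasure_le ν _)

/-- The signed measure `C ↦ ∫ ν (C ∩ [0,x)) dμ(x)`. -/
noncomputable def avg (μ : Measure ℝ≥0∞) [IsFiniteMeasure μ] (ν : SignedMeasure ℝ≥0) :
    SignedMeasure ℝ≥0 :=
  (ν.toJordanDecomposition.posPart.withDensity fun s => μ (Ioi (s : ℝ≥0∞))).toSignedMeasure -
    (ν.toJordanDecomposition.negPart.withDensity fun s => μ (Ioi (s : ℝ≥0∞))).toSignedMeasure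

lemma avg_apply_eq_sub (μ : Measure ℝ≥0∞) [IsFiniteMeasure μ] (ν : SignedMeasure ℝ≥0)
    {C : Set ℝ≥0} (hC : MeasurableSet C) :
    avg μ ν C =
      (ν.toJordanDecomposition.posPart.withDensity fun s => μ (Ioi (s : ℝ≥0∞))).real C -
      (ν.toJordanDecomposition.negPart.withDensity fun s => μ (Ioi (s : ℝ≥0∞))).real C :=
  Measure.toSignedMeasure_sub_apply hC

lemma avg_apply (μ : Measure ℝ≥0∞) [IsFiniteMeasure μ] (ν : SignedMeasure ℝ≥0)
    {C : Set ℝ≥0} (hC : MeasurableSet C) : avg μ ν C = ∫ x, ν (C ∩ pre x) ∂μ := by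
  have hint : ∀ p : Measure ℝ≥0, IsFiniteMeasure p →
      Integrable (fun x => p.real (C ∩ pre x)) μ := fun p hp =>
    Integrable.of_bound (measurable_measure_inter_pre p C).ennreal_toReal.aestronglyMeasurable
      (p.real univ) (Eventually.of_forall fun x => by
        rw [Real.norm_of_nonneg measureReal_nonneg]
        exact measureReal_mono (subset_univ _))
  rw [avg_apply_eq_sub μ ν hC, ← integral_measureReal_inter_pre μ _ hC,
    ← integral_measureReal_inter_pre μ _ hC,
    ← integral_sub (hint _ inferInstance) (hint _ inferInstance)]
  refine integral_congr_ae (Eventually.of_forall fun x => ?_)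
  exact (ν.apply_eq_posPart_real_sub_negPart_real (hC.inter (measurableSet_pre x))).symm

lemma Ioc_inter_pre_of_lt {t : ℝ≥0} {x : ℝ≥0∞} (h : (t : ℝ≥0∞) < x) :
    Ioc 0 t ∩ pre x = Ioc 0 t :=
  inter_eq_left.2 fun _ hs => lt_of_le_of_lt (ENNReal.coe_le_coe.2 hs.2) h

lemma Ioc_inter_pre_coe {t x : ℝ≥0} (h : x ≤ t) : Ioc 0 t ∩ pre (x : ℝ≥0∞) = Ioo 0 x := by
  ext s
  simp only [pre, mem_inter_iff, mem_Ioc, mem_ofPred_eq, ENNReal.coe_lt_coe, mem_Ioo]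
  exact ⟨fun hs => ⟨hs.1.1, hs.2⟩, fun hs => ⟨⟨hs.1, hs.2.le.trans h⟩, hs.2⟩⟩

lemma measurable_signedMeasure_Ioo (ν : SignedMeasure ℝ≥0) : Measurable fun s => ν (Ioo 0 s) := by
  have : (fun s : ℝ≥0 => ν (Ioo 0 s)) = fun s : ℝ≥0 => ν (Ioi 0 ∩ pre (s : ℝ≥0∞)) := by
    ext s
    congr 1
    ext x
    simp [pre]
  rw [this]
  exact (measurable_signedMeasure_inter_pre ν measurableSet_Ioi).comp measurable_coe_nnreal_ennreal

lemma image_coe_Iic (t : ℝ≥0) : ((↑) : ℝ≥0 → ℝ≥0∞) '' Iic t = Iic (t : ℝ≥0∞) := by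
  ext x
  constructor
  · rintro ⟨s, hs, rfl⟩
    exact ENNReal.coe_le_coe.2 hs
  · intro hx
    lift x to ℝ≥0 using ne_top_of_le_ne_top ENNReal.coe_ne_top hx
    exact ⟨x, ENNReal.coe_le_coe.1 hx, rfl⟩

lemma setIntegral_Iic_eq_Ioc {ρ : Measure ℝ≥0} {h : ℝ≥0 → ℝ} (h0 : h 0 = 0) (t : ℝ≥0) :
    ∫ s in Iic t, h s ∂ρ = ∫ s in Ioc 0 t, h s ∂ρ := by
  rw [← integral_indicator measurableSet_Iic, ← integral_indicator measurableSet_Ioc]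
  congr 1
  ext s
  rcases eq_or_ne s 0 with rfl | hs
  · simp [indicator, h0]
  · simp [indicator, pos_iff_ne_zero.2 hs]

/-- Integration by parts in disguise: points `x > t` see the whole of `(0,t]`, points `x ≤ t` see
only `(0,x)`. -/
lemma avg_Ioc (μ : Measure ℝ≥0∞) [IsFiniteMeasure μ] (ν : SignedMeasure ℝ≥0) (t : ℝ≥0) :
    avg μ ν (Ioc 0 t) =
      ν (Ioc 0 t) * μ.real (Ioi (t : ℝ≥0∞)) + ∫ s in Ioc 0 t, ν (Ioo 0 s) ∂(dG μ) := by
  rw [avg_apply μ ν measurableSet_Ioc, ← integral_add_compl (measurableSet_Ioi (a := (t : ℝ≥0∞)))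
    (integrable_signedMeasure_inter_pre μ ν measurableSet_Ioc), compl_Ioi]
  congr 1
  · rw [setIntegral_congr_fun measurableSet_Ioi (g := fun _ => ν (Ioc 0 t))
      fun x hx => by simp only [Ioc_inter_pre_of_lt hx]]
    simp [mul_comm]
  -- An atom of `μ` at `0` does no harm since `ν (Ioo 0 0) = 0`.
  · rw [← setIntegral_Iic_eq_Ioc (by simp), setIntegral_dG, image_coe_Iic]
    refine setIntegral_congr_fun measurableSet_Iic fun x hx => ?_
    lift x to ℝ≥0 using ne_top_of_le_ne_top ENNReal.coe_ne_top hx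
    simp only [ENNReal.toNNReal_coe, Ioc_inter_pre_coe (ENNReal.coe_le_coe.1 hx)]

/-! ### Condition M in terms of signed measures -/

lemma dG_real_Ioc (μ : Measure ℝ≥0∞) [IsProbabilityMeasure μ] (t : ℝ≥0) :
    (dG μ).real (Ioc 0 t) = μ.real (Ioi (0 : ℝ≥0∞)) - μ.real (Ioi (t : ℝ≥0∞)) := by
  have h : ((↑) : ℝ≥0 → ℝ≥0∞) '' Ioc 0 t = Ioi (0 : ℝ≥0∞) \ Ioi (t : ℝ≥0∞) := by
    ext x
    constructor
    · rintro ⟨s, hs, rfl⟩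
      simpa using hs
    · rintro ⟨h0, hx⟩
      lift x to ℝ≥0 using ne_top_of_le_ne_top ENNReal.coe_ne_top (not_lt.1 hx)
      exact ⟨x, by simpa using And.intro h0 hx, rfl⟩
  rw [measureReal_def, dG_apply, h, ← measureReal_def,
    measureReal_sdiff (Ioi_subset_Ioi zero_le) measurableSet_Ioi]

lemma integrable_add_signedMeasure_Ioo (ρ : Measure ℝ≥0) [IsFiniteMeasure ρ]
    (ν : SignedMeasure ℝ≥0) (c : ℝ) : Integrable (fun s => c + ν (Ioo 0 s)) ρ :=
  (integrable_const c).add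
    (Integrable.of_bound (measurable_signedMeasure_Ioo ν).aestronglyMeasurable
      (ν.totalVariation.real univ) (Eventually.of_forall fun _ => abs_signedMeasure_le ν _))

/-- The balance equation is the measure equation evaluated on `(0,t]`: by `avg_Ioc` the integrals of
`ν (Ioo 0 s)` cancel, and the constant `F 0` contributes `F 0` times the drop of the tail between
`0` and `t`. -/
lemma avg_Ioc_eq_integral_iff (μ : Measure ℝ≥0∞) [IsProbabilityMeasure μ] (ν : SignedMeasure ℝ≥0)
    {F H : ℝ≥0 → ℝ} {t : ℝ≥0} (hF : F t = F 0 + ν (Ioc 0 t))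
    (hH : IntegrableOn H (Ioc 0 t) (dG μ)) :
    avg μ ν (Ioc 0 t) = ∫ s in Ioc 0 t, (F 0 + ν (Ioo 0 s) - H s) ∂(dG μ) ↔
      F t * (1 - G μ t) + ∫ s in Ioc 0 t, H s ∂(dG μ) = F 0 * (1 - G μ 0) := by
  have hν : IntegrableOn (fun s => ν (Ioo 0 s)) (Ioc 0 t) (dG μ) :=
    (Integrable.of_bound (measurable_signedMeasure_Ioo ν).aestronglyMeasurable
      (ν.totalVariation.real univ)
      (Eventually.of_forall fun _ => abs_signedMeasure_le ν _)).integrableOn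
  have hc : IntegrableOn (fun _ : ℝ≥0 => F 0) (Ioc 0 t) (dG μ) := integrableOn_const (by finiteness)
  rw [avg_Ioc, integral_sub (integrable_add_signedMeasure_Ioo _ ν _).integrableOn hH,
    integral_add hc hν, setIntegral_const, dG_real_Ioc,
    one_sub_G, one_sub_G, hF, smul_eq_mul, ENNReal.coe_zero]
  constructor <;> intro h <;> linarith

lemma avg_singleton (μ : Measure ℝ≥0∞) [IsFiniteMeasure μ] (ν : SignedMeasure ℝ≥0) {T : ℝ≥0}
    (hT : μ (Ioi (T : ℝ≥0∞)) = 0) : avg μ ν {T} = 0 := by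
  rw [avg_apply μ ν (measurableSet_singleton T)]
  refine integral_eq_zero_of_ae ?_
  have : ∀ᵐ x ∂μ, x ≤ (T : ℝ≥0∞) := by simpa [ae_iff, Ioi] using hT
  filter_upwards [this] with x hx
  have : ({T} : Set ℝ≥0) ∩ pre x = ∅ := by
    rw [singleton_inter_eq_empty]
    exact hx.not_gt
  rw [this]; simp

/-- Removes the localization by `B n`. Integrability of `w` is not assumed on `(0,T]`: the finite
total variation of `a` bounds the integrals of `|w|` over all `B n`, and monotone exhaustion gives
the rest. -/
lemma signedMeasure_eq_integral_of_cover {ρ : Measure ℝ≥0} [IsFiniteMeasure ρ]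
    {a : SignedMeasure ℝ≥0} {w : ℝ≥0 → ℝ} (hw : Measurable w) {B : ℕ → Set ℝ≥0}
    (hB : ∀ n, MeasurableSet (B n)) (hBm : Monotone B) {T : ℝ≥0}
    (hcov : ∀ s ∈ Ioc 0 T, ∃ n, s ∈ B n)
    (hint : ∀ n, IntegrableOn w (B n ∩ Ioc 0 T) ρ)
    (heq : ∀ n, ∀ t ≤ T, a (B n ∩ Ioc 0 t) = ∫ s in B n ∩ Ioc 0 t, w s ∂ρ) :
    IntegrableOn w (Ioc 0 T) ρ ∧
      ∀ C, MeasurableSet C → C ⊆ Ioc 0 T → a C = ∫ s in C, w s ∂ρ := by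
  have key : ∀ n C, MeasurableSet C → C ⊆ Ioc 0 T →
      a (B n ∩ C) = ∫ s in B n ∩ C, w s ∂ρ := by
    intro n C hC hCT
    have h1 : ∀ D, MeasurableSet D → D ⊆ Ioc 0 T →
        (a.restrict (B n) - (ρ.restrict (B n ∩ Ioc 0 T)).withDensityᵥ w) D =
          a (B n ∩ D) - ∫ s in B n ∩ D, w s ∂ρ := by
      intro D hD hDT
      rw [_root_.sub_apply, VectorMeasure.restrict_apply _ (hB n) hD,
        withDensityᵥ_apply (hint n) hD, Measure.restrict_restrict hD, inter_comm D (B n)]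
      congr 3
      ext x
      exact ⟨fun hx => ⟨hx.2.1, hx.1⟩, fun hx => ⟨hx.2, hx.1, hDT hx.2⟩⟩
    have h2 := signedMeasure_eq_zero_of_Ioc
      (a.restrict (B n) - (ρ.restrict (B n ∩ Ioc 0 T)).withDensityᵥ w) (T := T) (fun u hu => by
        rw [h1 _ measurableSet_Ioc (Ioc_subset_Ioc_right hu), heq n u hu, sub_self]) hC hCT
    rw [h1 C hC hCT] at h2
    linarith
  have hae : AECover (ρ.restrict (Ioc 0 T)) atTop B := by
    refine ⟨?_, hB⟩
    filter_upwards [ae_restrict_mem measurableSet_Ioc] with s hs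
    obtain ⟨n, hn⟩ := hcov s hs
    filter_upwards [eventually_ge_atTop n] with m hm using hBm hm hn
  have hw_int : IntegrableOn w (Ioc 0 T) ρ := by
    -- The integral of `|w|` over `B n` is `a` of the part where `w ≥ 0` minus `a` of the part where
    -- `w ≤ 0`; each is at most the total variation of `a`, whence the factor `2`.
    refine hae.integrable_of_integral_norm_bounded
      (2 * a.totalVariation.real univ) (fun n => ?_) (Eventually.of_forall fun n => ?_)
    · rw [IntegrableOn, Measure.restrict_restrict (hB n)]
      exact hint n
    · rw [Measure.restrict_restrict (hB n), integral_norm_eq_pos_sub_neg (hint n),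
        Measure.restrict_restrict (measurableSet_le measurable_const hw),
        Measure.restrict_restrict (measurableSet_le hw measurable_const), inter_left_comm,
        inter_left_comm _ (B n),
        ← key n _ ((measurableSet_le measurable_const hw).inter measurableSet_Ioc)
          inter_subset_right,
        ← key n _ ((measurableSet_le hw measurable_const).inter measurableSet_Ioc)
          inter_subset_right]
      have h1 := abs_le.1 (abs_signedMeasure_le a (B n ∩ ({x | 0 ≤ w x} ∩ Ioc 0 T)))
      have h2 := abs_le.1 (abs_signedMeasure_le a (B n ∩ ({x | w x ≤ 0} ∩ Ioc 0 T)))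
      linarith [h1.2, h2.1]
  refine ⟨hw_int, fun C hC hCT => ?_⟩
  have hlim : ∀ x, ∀ᶠ n in atTop, x ∈ B n ∩ C ↔ x ∈ C := by
    intro x
    by_cases hx : x ∈ C
    · obtain ⟨n, hn⟩ := hcov x (hCT hx)
      filter_upwards [eventually_ge_atTop n] with m hm
      simp [hx, hBm hm hn]
    · simp [hx]
  have hval : ∀ D, MeasurableSet D → D ⊆ C →
      ((ρ.restrict (Ioc 0 T)).withDensityᵥ w) D = ∫ s in D, w s ∂ρ := fun D hD hDC => by
    rw [withDensityᵥ_apply hw_int hD, Measure.restrict_restrict hD,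
      inter_eq_left.2 (hDC.trans hCT)]
  refine tendsto_nhds_unique
    (tendsto_signedMeasure a (L := atTop) (fun n => (hB n).inter hC) hC hlim) ?_
  have := tendsto_signedMeasure ((ρ.restrict (Ioc 0 T)).withDensityᵥ w) (L := atTop)
    (fun n => (hB n).inter hC) hC hlim
  rw [hval C hC le_rfl] at this
  refine this.congr fun n => ?_
  rw [hval _ ((hB n).inter hC) inter_subset_right, key n C hC hCT]

/-- If the tail at `T` vanishes, then a point `s ≤ T` with positive tail is strictly below `T`, and
the mass of `[T,∞]` serves as the bound. -/
lemma exists_tail_lower_bound {μ : Measure ℝ≥0∞} [IsFiniteMeasure μ] {T : ℝ≥0}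
    (hT : T ∈ domT μ) :
    ∃ c > 0, ∀ s ≤ T, 0 < μ (Ioi (s : ℝ≥0∞)) → c ≤ μ.real (Ioi (s : ℝ≥0∞)) := by
  by_cases h : 0 < μ (Ioi (T : ℝ≥0∞))
  · exact ⟨_, ENNReal.toReal_pos h.ne' (measure_ne_top _ _), fun s hs _ =>
      measureReal_mono (Ioi_subset_Ioi (ENNReal.coe_le_coe.2 hs))⟩
  · refine ⟨_, ENNReal.toReal_pos (mem_domT.1 hT).ne' (measure_ne_top _ _), fun s hs hs' => ?_⟩
    refine measureReal_mono (Ici_subset_Ioi.2 (ENNReal.coe_lt_coe.2 (lt_of_le_of_ne hs ?_)))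
    rintro rfl
    exact h hs'

/-- Recovers `ν` from its multiple by the tail. The negative terms are moved across so that the
hypothesis becomes an equality of positive measures; integrating the reciprocal of the tail against
both sides divides by it. On `(0,t]` the tail is at least its positive value at `t`, so nothing
infinite appears. -/
lemma signedMeasure_Ioc_eq_integral_div_tail {μ : Measure ℝ≥0∞} [IsFiniteMeasure μ]
    {ν : SignedMeasure ℝ≥0} {w : ℝ≥0 → ℝ} (hw : Measurable w) {t : ℝ≥0}
    (ht : 0 < μ (Ioi (t : ℝ≥0∞))) (hwi : IntegrableOn w (Ioc 0 t) (dG μ))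
    (h : ∀ C, MeasurableSet C → C ⊆ Ioc 0 t → avg μ ν C = ∫ s in C, w s ∂(dG μ)) :
    ν (Ioc 0 t) = ∫ s in Ioc 0 t, w s / μ.real (Ioi (s : ℝ≥0∞)) ∂(dG μ) := by
  set g : ℝ≥0 → ℝ≥0∞ := fun s => μ (Ioi (s : ℝ≥0∞)) with hg
  have hgm : Measurable g := measurable_tail μ
  have hgi : Measurable fun s => (g s)⁻¹ := hgm.inv
  set p := ν.toJordanDecomposition.posPart
  set q := ν.toJordanDecomposition.negPart
  set E := Ioc (0 : ℝ≥0) t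
  have hE : MeasurableSet E := measurableSet_Ioc
  set ρ := (dG μ).restrict E with hρ
  have hgE : ∀ s ∈ E, g s ≠ 0 := fun s hs =>
    (ht.trans_le (measure_mono (Ioi_subset_Ioi (ENNReal.coe_le_coe.2 hs.2)))).ne'
  have hgt : ∀ s, g s ≠ ∞ := fun s => measure_ne_top _ _
  have hfin : ∀ f : ℝ≥0 → ℝ, Integrable f ρ → ∫⁻ s, ENNReal.ofReal (f s) ∂ρ ≠ ∞ := fun f hf =>
    ((lintegral_mono fun s => Real.ofReal_le_enorm (f s)).trans_lt hf.2).ne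
  have hm : (p.withDensity g).restrict E + ρ.withDensity (fun s => ENNReal.ofReal (-w s)) =
      (q.withDensity g).restrict E + ρ.withDensity (fun s => ENNReal.ofReal (w s)) := by
    ext C hC
    have h1 := h (C ∩ E) (hC.inter hE) inter_subset_right
    rw [avg_apply_eq_sub μ ν (hC.inter hE), ← Measure.restrict_restrict hC, ← hρ,
      integral_eq_lintegral_pos_part_sub_lintegral_neg_part (Integrable.restrict hwi)] at h1
    have hwr : Integrable w (ρ.restrict C) := Integrable.restrict hwi
    have f1 : ∫⁻ s in C, ENNReal.ofReal (w s) ∂ρ ≠ ∞ :=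
      ((setLIntegral_le_lintegral _ _).trans_lt (hfin w hwi).lt_top).ne
    have f2 : ∫⁻ s in C, ENNReal.ofReal (-w s) ∂ρ ≠ ∞ :=
      ((setLIntegral_le_lintegral _ _).trans_lt (hfin _ hwi.neg).lt_top).ne
    rw [Measure.add_apply, Measure.add_apply, Measure.restrict_apply hC, Measure.restrict_apply hC,
      withDensity_apply _ hC, withDensity_apply _ hC,
      ← ENNReal.toReal_eq_toReal_iff' (by finiteness) (by finiteness),
      ENNReal.toReal_add (by finiteness) f2, ENNReal.toReal_add (by finiteness) f1]
    simp only [measureReal_def] at h1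
    linarith
  have h1 : ∀ p : Measure ℝ≥0, ∫⁻ s, (g s)⁻¹ ∂((p.withDensity g).restrict E) = p E := fun p => by
    rw [setLIntegral_withDensity_eq_setLIntegral_mul _ hgm hgi hE]
    refine (setLIntegral_congr_fun hE (g := fun _ => 1) fun s hs =>
      ENNReal.mul_inv_cancel (hgE s hs) (hgt s)).trans ?_
    simp
  have h2 : ∀ f : ℝ≥0 → ℝ, Measurable f →
      ∫⁻ s, (g s)⁻¹ ∂(ρ.withDensity (fun s => ENNReal.ofReal (f s))) =
        ∫⁻ s, ENNReal.ofReal (f s / (g s).toReal) ∂ρ := fun f hf => by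
    rw [lintegral_withDensity_eq_lintegral_mul _ hf.ennreal_ofReal hgi]
    refine setLIntegral_congr_fun hE fun s hs => ?_
    simp only [Pi.mul_apply]
    rw [ENNReal.ofReal_div_of_pos (ENNReal.toReal_pos (hgE s hs) (hgt s)),
      ENNReal.ofReal_toReal (hgt s), div_eq_mul_inv]
  have hlin := congrArg (fun m : Measure ℝ≥0 => ∫⁻ s, (g s)⁻¹ ∂m) hm
  simp only [lintegral_add_measure, h1, h2 w hw, h2 (fun s => -w s) hw.neg] at hlin
  have hz : Integrable (fun s => w s / (g s).toReal) ρ := by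
    refine Integrable.mono' (hwi.norm.div_const (g t).toReal)
      (hw.div hgm.ennreal_toReal).aestronglyMeasurable ?_
    filter_upwards [ae_restrict_mem hE] with s hs
    rw [norm_div, Real.norm_of_nonneg (ENNReal.toReal_nonneg (a := g s))]
    exact div_le_div_of_nonneg_left (norm_nonneg _) (ENNReal.toReal_pos ht.ne' (hgt t))
      (ENNReal.toReal_mono (hgt s) (measure_mono (Ioi_subset_Ioi (ENNReal.coe_le_coe.2 hs.2))))
  have e1 := hfin _ hz
  have e2 : ∫⁻ s, ENNReal.ofReal (-w s / (g s).toReal) ∂ρ ≠ ∞ := by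
    simpa only [Pi.neg_apply, ← neg_div] using hfin _ hz.neg
  have hreal := congrArg ENNReal.toReal hlin
  rw [ENNReal.toReal_add (by finiteness) e2, ENNReal.toReal_add (by finiteness) e1] at hreal
  have hI := integral_eq_lintegral_pos_part_sub_lintegral_neg_part hz
  simp only [← neg_div] at hI
  change _ = ∫ s, w s / (g s).toReal ∂ρ
  rw [hI, ν.apply_eq_posPart_real_sub_negPart_real hE, measureReal_def, measureReal_def]
  linarith

lemma integrableOn_Icc_of_Ioc {ρ : Measure ℝ≥0} [IsFiniteMeasure ρ] {f : ℝ≥0 → ℝ} {T : ℝ≥0}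
    (h : IntegrableOn f (Ioc 0 T) ρ) : IntegrableOn f (Icc 0 T) ρ := by
  rw [← Icc_union_Ioc_eq_Icc le_rfl zero_le, Icc_self]
  exact (integrableOn_singleton (by finiteness)).union h

/-- From the measure equation to Condition M: dividing by the tail gives the density of `F`, the
sets `(0,t]` give the balance, and the singleton at `t_G` gives the boundary condition. -/
theorem conditionM_of_avg (μ : Measure ℝ≥0∞) [IsProbabilityMeasure μ] {F H : ℝ≥0 → ℝ}
    (hH : Measurable H) {B : ℕ → Set ℝ≥0} (hB : ∀ n, MeasurableSet (B n)) (hBm : Monotone B)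
    (hcov : ∀ s ∈ domT μ, 0 < s → ∃ n, s ∈ B n)
    (h : ∀ T ∈ domT μ, ∃ ν : SignedMeasure ℝ≥0,
      (∀ s ≤ T, 0 < μ (Ioi (s : ℝ≥0∞)) → F s = F 0 + ν (Ioc 0 s)) ∧
      ∀ n, IntegrableOn (fun s => F 0 + ν (Ioo 0 s) - H s) (B n ∩ Ioc 0 T) (dG μ) ∧
        ∀ t ≤ T, avg μ ν (B n ∩ Ioc 0 t) =
          ∫ s in B n ∩ Ioc 0 t, (F 0 + ν (Ioo 0 s) - H s) ∂(dG μ)) :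
    ConditionM μ F H := by
  choose! ν hνF hν using h
  have hwm : ∀ T, Measurable fun s => F 0 + ν T (Ioo 0 s) - H s := fun T =>
    ((measurable_signedMeasure_Ioo (ν T)).const_add _).sub hH
  have key := fun T hT => signedMeasure_eq_integral_of_cover (hwm T) hB hBm (T := T)
    (fun s hs => hcov s (mem_domT_of_le hs.2 hT) hs.1) (fun n => (hν T hT n).1)
    (fun n => (hν T hT n).2)
  have hleft : ∀ T ∈ domT μ, Tendsto F (𝓝[<] T) (𝓝 (F 0 + ν T (Ioo 0 T))) := fun T hT => by
    refine ((tendsto_signedMeasure_Ioc_left (ν T) T).const_add (F 0)).congr' ?_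
    filter_upwards [self_mem_nhdsWithin] with s hs
    exact (hνF T hT s hs.le (tail_pos_of_lt hT hs)).symm
  -- The measure `ν T` depends on the horizon `T`, but `F 0 + ν T (Ioo 0 s)` is the left limit of
  -- `F` at `s`. This gives one density for all `T` at once. At `s = 0` the left limit is by
  -- convention `F 0`.
  have hIoo : ∀ T ∈ domT μ, ∀ s ≤ T, F 0 + ν T (Ioo 0 s) = F.leftLim s := fun T hT s hs => by
    rcases eq_or_ne s 0 with rfl | hs0
    · rw [leftLim_eq_of_isBot (fun _ => zero_le)]; simp
    have : (𝓝[<] s).NeBot := nhdsLT_neBot_of_exists_lt ⟨0, pos_iff_ne_zero.2 hs0⟩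
    refine (leftLim_eq_of_tendsto ?_).symm
    refine ((tendsto_signedMeasure_Ioc_left (ν T) s).const_add (F 0)).congr' ?_
    filter_upwards [self_mem_nhdsWithin] with r hr
    exact (hνF T hT r (hr.le.trans hs) (tail_pos_of_lt (mem_domT_of_le hs hT) hr)).symm
  obtain ⟨u, hum, huT, hu⟩ := exists_seq_domT μ
  have hlm : Measurable ((domT μ).indicator F.leftLim) := by
    refine measurable_of_tendsto_metrizable (f := fun n =>
      (domT μ).indicator fun s => F 0 + ν (u n) (Ioo 0 s)) (fun n =>
      ((measurable_signedMeasure_Ioo (ν (u n))).const_add _).indicator (measurableSet_domT μ)) ?_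
    rw [tendsto_pi_nhds]
    intro s
    by_cases hs : s ∈ domT μ
    · obtain ⟨n, hn⟩ := hu s hs
      refine tendsto_const_nhds.congr' ?_
      filter_upwards [eventually_ge_atTop n] with m hm
      rw [indicator_of_mem hs, indicator_of_mem hs, hIoo _ (huT m) s (hn.trans (hum hm))]
    · simp [hs]
  have hHi : ∀ T ∈ domT μ, IntegrableOn H (Ioc 0 T) (dG μ) := fun T hT => by
    have h1 : IntegrableOn (fun s => F 0 + ν T (Ioo 0 s)) (Ioc 0 T) (dG μ) :=
      (integrable_add_signedMeasure_Ioo _ (ν T) _).integrableOn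
    refine (h1.sub (key T hT).1).congr (Eventually.of_forall fun s => ?_)
    simp
  -- The density is `(F₋ - H)` over the tail. Where the tail is zero the value does not enter the
  -- formula for `F`, and `0` keeps the density integrable.
  refine ⟨⟨fun s => if 0 < μ (Ioi (s : ℝ≥0∞)) then
      ((domT μ).indicator F.leftLim s - H s) / μ.real (Ioi (s : ℝ≥0∞)) else 0, ⟨?_, ?_⟩, ?_⟩,
    ⟨hH.comp measurable_subtype_coe, fun T hT => integrableOn_Icc_of_Ioc (hHi T hT)⟩, ?_, ?_⟩
  · exact (Measurable.ite (measurableSet_lt measurable_const (measurable_tail μ))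
      ((hlm.sub hH).div (measurable_tail μ).ennreal_toReal) measurable_const).comp
      measurable_subtype_coe
  · intro T hT
    obtain ⟨c, hc, hcT⟩ := exists_tail_lower_bound hT
    refine integrableOn_Icc_of_Ioc (Integrable.mono' ((key T hT).1.norm.div_const c) ?_ ?_)
    · exact (Measurable.ite (measurableSet_lt measurable_const (measurable_tail μ))
        ((hlm.sub hH).div (measurable_tail μ).ennreal_toReal)
        measurable_const).aestronglyMeasurable
    · filter_upwards [ae_restrict_mem measurableSet_Ioc] with s hs
      split_ifs with hs'
      · rw [indicator_of_mem (mem_domT_of_le hs.2 hT), ← hIoo T hT s hs.2, norm_div,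
          Real.norm_of_nonneg (measureReal_nonneg (μ := μ))]
        exact div_le_div_of_nonneg_left (norm_nonneg _) hc (hcT s hs.2 hs')
      · rw [norm_zero]; positivity
  · intro t ht
    have ht' := (lt_tG_iff μ t).1 ht
    have htT := mem_domT_of_tail_pos ht'
    rw [hνF t htT t le_rfl ht', signedMeasure_Ioc_eq_integral_div_tail (hwm t) ht' (key t htT).1
      (key t htT).2]
    congr 1
    refine setIntegral_congr_fun measurableSet_Ioc fun s hs => ?_
    have : 0 < μ (Ioi (s : ℝ≥0∞)) :=
      ht'.trans_le (measure_mono (Ioi_subset_Ioi (ENNReal.coe_le_coe.2 hs.2)))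
    simp only [if_pos this, indicator_of_mem (mem_domT_of_le hs.2 htT), hIoo t htT s hs.2]
  · intro t ht
    have ht' := (lt_tG_iff μ t).1 ht
    have htT := mem_domT_of_tail_pos ht'
    exact (avg_Ioc_eq_integral_iff μ (ν t) (hνF t htT t le_rfl ht') (hHi t htT)).1
      ((key t htT).2 _ measurableSet_Ioc le_rfl)
  · intro htop hpos
    lift tG μ to ℝ≥0 using htop.ne with T hT
    rw [ENNReal.toNNReal_coe]
    have hTT : T ∈ domT μ := hpos.trans_le (measure_mono (by simp))
    have htail : μ (Ioi (T : ℝ≥0∞)) = 0 := by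
      by_contra hc
      exact ((lt_tG_iff μ T).2 (pos_iff_ne_zero.2 hc)).ne hT
    rcases eq_or_ne T 0 with rfl | hT0
    · simp
    -- At `T = t_G` the tail is zero, so the left side of the measure equation has no mass at `T`;
    -- as `dG` does have mass there, its density `F₋ - H` must vanish at `T`.
    have h1 := (key T hTT).2 {T} (measurableSet_singleton T)
      (singleton_subset_iff.2 ⟨pos_iff_ne_zero.2 hT0, le_rfl⟩)
    rw [avg_singleton μ _ htail, integral_singleton, smul_eq_mul, measureReal_def, dG_apply,
      image_singleton] at h1
    have h2 : F 0 + ν T (Ioo 0 T) - H T = 0 :=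
      (mul_eq_zero.1 h1.symm).resolve_left (ENNReal.toReal_pos hpos.ne' (measure_ne_top _ _)).ne'
    rw [← sub_eq_zero.1 h2]
    exact hleft T hTT

/-- With `ν = z dG` the balance equation gives the measure equation on each `(0,u]` with positive
tail at `u`. As `T ∈ 𝒯`, only `u = T` can have zero tail. Then, for `T > 0`, `T = t_G` is an atom of
`μ`, and the boundary condition makes the density vanish there. -/
theorem ConditionM.exists_signedMeasure {μ : Measure ℝ≥0∞} [IsProbabilityMeasure μ]
    {F H : ℝ≥0 → ℝ} (h : ConditionM μ F H) {T : ℝ≥0} (hT : T ∈ domT μ) :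
    ∃ ν : SignedMeasure ℝ≥0,
      (∀ s ≤ T, 0 < μ (Ioi (s : ℝ≥0∞)) → F s = F 0 + ν (Ioc 0 s)) ∧
      IntegrableOn (fun s => F 0 + ν (Ioo 0 s) - H s) (Ioc 0 T) (dG μ) ∧
      ∀ C, MeasurableSet C → C ⊆ Ioc 0 T →
        avg μ ν C = ∫ s in C, (F 0 + ν (Ioo 0 s) - H s) ∂(dG μ) := by
  obtain ⟨⟨z, hz, hFz⟩, hH, hbal, hcase⟩ := h
  have hzi : IntegrableOn z (Ioc 0 T) (dG μ) := (hz.2 T hT).mono_set Ioc_subset_Icc_self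
  have hHi : IntegrableOn H (Ioc 0 T) (dG μ) := (hH.2 T hT).mono_set Ioc_subset_Icc_self
  set ν : SignedMeasure ℝ≥0 := ((dG μ).restrict (Ioc 0 T)).withDensityᵥ z with hν
  have hF : ∀ s ≤ T, 0 < μ (Ioi (s : ℝ≥0∞)) → F s = F 0 + ν (Ioc 0 s) := fun s hs hs' => by
    rw [hFz s ((lt_tG_iff μ s).2 hs'), hν, withDensityᵥ_apply hzi measurableSet_Ioc,
      Measure.restrict_restrict measurableSet_Ioc, inter_eq_left.2 (Ioc_subset_Ioc_right hs)]
  have hνi : IntegrableOn (fun s => F 0 + ν (Ioo 0 s)) (Ioc 0 T) (dG μ) :=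
    (integrable_add_signedMeasure_Ioo _ ν _).integrableOn
  have hwi := hνi.sub hHi
  refine ⟨ν, hF, hwi, ?_⟩
  set w : ℝ≥0 → ℝ := fun s => F 0 + ν (Ioo 0 s) - H s with hw
  replace hwi : IntegrableOn w (Ioc 0 T) (dG μ) := hwi
  set a := avg μ ν - ((dG μ).restrict (Ioc 0 T)).withDensityᵥ w with ha
  have hval : ∀ C, MeasurableSet C → C ⊆ Ioc 0 T →
      a C = avg μ ν C - ∫ s in C, w s ∂(dG μ) := fun C hC hCT => by
    rw [ha, _root_.sub_apply, withDensityᵥ_apply hwi hC, Measure.restrict_restrict hC,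
      inter_eq_left.2 hCT]
  have hpos : ∀ u ≤ T, 0 < μ (Ioi (u : ℝ≥0∞)) → a (Ioc 0 u) = 0 := fun u hu hu' => by
    rw [hval _ measurableSet_Ioc (Ioc_subset_Ioc_right hu), sub_eq_zero,
      avg_Ioc_eq_integral_iff μ ν (hF u hu hu') (hHi.mono_set (Ioc_subset_Ioc_right hu))]
    exact hbal u ((lt_tG_iff μ u).2 hu')
  intro C hC hCT
  rw [← sub_eq_zero, ← hval C hC hCT]
  refine signedMeasure_eq_zero_of_Ioc a (fun u hu => ?_) hC hCT
  by_cases hu' : 0 < μ (Ioi (u : ℝ≥0∞))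
  · exact hpos u hu hu'
  obtain rfl : u = T := by
    by_contra hne
    exact hu' (tail_pos_of_lt hT (lt_of_le_of_ne hu hne))
  rcases eq_or_ne u 0 with rfl | hu0
  · simp
  have hu0' : 0 < u := pos_iff_ne_zero.2 hu0
  have hlt : ∀ s < u, a (Ioc 0 s) = 0 := fun s hs => hpos s hs.le (tail_pos_of_lt hT hs)
  rw [← Ioo_union_right hu0', VectorMeasure.of_union (by simp) measurableSet_Ioo
    (measurableSet_singleton u), signedMeasure_eq_zero_of_Ioo a hlt measurableSet_Ioo le_rfl,
    zero_add, hval _ (measurableSet_singleton u) (by simp [hu0']),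
    avg_singleton μ ν (by simpa using hu'), integral_singleton]
  have htG : tG μ = u := by
    refine le_antisymm (not_lt.1 fun hc => hu' ((lt_tG_iff μ u).1 hc)) ?_
    refine le_of_forall_lt fun x hx => ?_
    lift x to ℝ≥0 using hx.ne_top
    exact (lt_tG_iff μ x).2 (tail_pos_of_lt hT (ENNReal.coe_lt_coe.1 hx))
  have hatom : 0 < μ {(u : ℝ≥0∞)} := by
    have h1 := mem_domT.1 hT
    rw [← Ioi_union_left] at h1
    have h2 := h1.trans_le (measure_union_le _ _)
    rwa [show μ (Ioi (u : ℝ≥0∞)) = 0 by simpa using hu', zero_add] at h2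
  have hlim := hcase (by simp [htG]) (by rwa [htG])
  rw [htG, ENNReal.toNNReal_coe] at hlim
  have : (𝓝[<] u).NeBot := nhdsLT_neBot_of_exists_lt ⟨0, hu0'⟩
  have hlim2 : Tendsto F (𝓝[<] u) (𝓝 (F 0 + ν (Ioo 0 u))) := by
    refine ((tendsto_signedMeasure_Ioc_left ν u).const_add (F 0)).congr' ?_
    filter_upwards [self_mem_nhdsWithin] with s hs
    exact (hF s hs.le (tail_pos_of_lt hT hs)).symm
  have hwu : w u = 0 := by
    rw [hw]
    simp only
    rw [tendsto_nhds_unique hlim2 hlim, sub_self]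
  rw [hwu]; simp

/-! ### Generalized conditional expectations -/

section CondExp

lemma setLIntegral_ofReal_ne_top {Ω : Type*} {mΩ : MeasurableSpace Ω} {P : Measure Ω} {X : Ω → ℝ}
    {A : Set Ω} (hX : IntegrableOn X A P) : ∫⁻ ω in A, ENNReal.ofReal (X ω) ∂P ≠ ∞ :=
  ((lintegral_mono fun ω => Real.ofReal_le_enorm (X ω)).trans_lt hX.2).ne

variable {Ω : Type*} {m mΩ : MeasurableSpace Ω} {P : Measure Ω} [IsFiniteMeasure P]

lemma measurable_genCondExp (P : Measure Ω) (X : Ω → ℝ) : Measurable[m] (genCondExp m P X) :=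
  (measurable_condLExp m P _).ennreal_toReal.sub (measurable_condLExp m P _).ennreal_toReal

lemma ae_condLExp_lt_top_of_setLIntegral (hm : m ≤ mΩ) {Z : Ω → ℝ≥0∞} {D : Set Ω}
    (hD : MeasurableSet[m] D) (hZ : ∫⁻ ω in D, Z ω ∂P ≠ ∞) :
    ∀ᵐ ω ∂P.restrict D, condLExp m P Z ω < ∞ := by
  refine ae_lt_top ((measurable_condLExp m P Z).mono hm le_rfl) ?_
  rwa [setLIntegral_condLExp hm P Z hD]

lemma ae_condLExp_abs_lt_top (hm : m ≤ mΩ) {X : Ω → ℝ} {D : Set Ω} (hD : MeasurableSet[m] D)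
    (hX : IntegrableOn X D P) :
    ∀ᵐ ω ∂P, ω ∈ D → condLExp m P (fun ω' => ENNReal.ofReal |X ω'|) ω < ∞ :=
  (ae_restrict_iff' (hm D hD)).1
    (ae_condLExp_lt_top_of_setLIntegral hm hD (setLIntegral_ofReal_ne_top hX.abs))

lemma integrableOn_condLExp_toReal (hm : m ≤ mΩ) {X : Ω → ℝ} {D : Set Ω}
    (hD : MeasurableSet[m] D) (hX : IntegrableOn X D P) :
    IntegrableOn (fun ω => (condLExp m P (fun ω' => ENNReal.ofReal (X ω')) ω).toReal) D P :=
  integrable_toReal_of_lintegral_ne_top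
    ((measurable_condLExp m P _).mono hm le_rfl).aemeasurable
    (by rw [setLIntegral_condLExp hm P _ hD]; exact setLIntegral_ofReal_ne_top hX)

lemma setIntegral_condLExp_toReal (hm : m ≤ mΩ) {X : Ω → ℝ} {D : Set Ω}
    (hD : MeasurableSet[m] D) (hX : IntegrableOn X D P) :
    ∫ ω in D, (condLExp m P (fun ω' => ENNReal.ofReal (X ω')) ω).toReal ∂P =
      (∫⁻ ω in D, ENNReal.ofReal (X ω) ∂P).toReal := by
  rw [integral_toReal ((measurable_condLExp m P _).mono hm le_rfl).aemeasurable
    (ae_condLExp_lt_top_of_setLIntegral hm hD (setLIntegral_ofReal_ne_top hX)),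
    setLIntegral_condLExp hm P _ hD]

lemma integrableOn_genCondExp (hm : m ≤ mΩ) {X : Ω → ℝ} {D : Set Ω} (hD : MeasurableSet[m] D)
    (hX : IntegrableOn X D P) : IntegrableOn (genCondExp m P X) D P :=
  (integrableOn_condLExp_toReal hm hD hX).sub (integrableOn_condLExp_toReal hm hD hX.neg)

lemma setIntegral_genCondExp (hm : m ≤ mΩ) {X : Ω → ℝ} {D : Set Ω} (hD : MeasurableSet[m] D)
    (hX : IntegrableOn X D P) : ∫ ω in D, genCondExp m P X ω ∂P = ∫ ω in D, X ω ∂P := by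
  rw [integral_eq_lintegral_pos_part_sub_lintegral_neg_part hX,
    ← setIntegral_condLExp_toReal hm hD hX]
  have h := setIntegral_condLExp_toReal hm hD hX.neg
  simp only [Pi.neg_apply] at h
  rw [← h]
  exact integral_sub (integrableOn_condLExp_toReal hm hD hX)
    (integrableOn_condLExp_toReal hm hD hX.neg)

lemma condIntegrable_of_cover (hm : m ≤ mΩ) {X : Ω → ℝ} {ι : Type*} [Countable ι] {D : ι → Set Ω}
    (hD : ∀ i, MeasurableSet[m] (D i)) (hcov : ∀ᵐ ω ∂P, ∃ i, ω ∈ D i)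
    (hX : ∀ i, IntegrableOn X (D i) P) : CondIntegrable m P X := by
  filter_upwards [hcov, ae_all_iff.2 fun i => ae_condLExp_abs_lt_top hm (hD i) (hX i)]
    with ω ⟨i, hi⟩ h using h i hi

/-- On each `D i` the generalized conditional expectation is integrable and has the same integrals
over `m`-measurable subsets as `X`, so the usual uniqueness argument applies piece by piece; `X`
need not be integrable globally. -/
lemma genCondExp_ae_eq_zero_of_cover (hm : m ≤ mΩ) {X : Ω → ℝ} {ι : Type*} [Countable ι]
    {D : ι → Set Ω} (hD : ∀ i, MeasurableSet[m] (D i)) (hcov : ∀ᵐ ω ∂P, ∃ i, ω ∈ D i)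
    (hX : ∀ i, IntegrableOn X (D i) P)
    (h0 : ∀ i A, MeasurableSet[m] A → A ⊆ D i → ∫ ω in A, X ω ∂P = 0) :
    genCondExp m P X =ᵐ[P] 0 := by
  have key : ∀ i, (D i).indicator (genCondExp m P X) =ᵐ[P] 0 := fun i => by
    have hi : Integrable ((D i).indicator (genCondExp m P X)) P :=
      (integrable_indicator_iff (hm _ (hD i))).2 (integrableOn_genCondExp hm (hD i) (hX i))
    have hs : StronglyMeasurable[m] ((D i).indicator (genCondExp m P X)) :=
      Measurable.stronglyMeasurable (Measurable.indicator (measurable_genCondExp P X) (hD i))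
    refine ae_eq_of_forall_setIntegral_eq_of_sigmaFinite' hm (fun s _ _ => hi.integrableOn)
      (fun s _ _ => (integrable_zero _ _ _).integrableOn) (fun s hs _ => ?_)
      hs.aestronglyMeasurable
      stronglyMeasurable_zero.aestronglyMeasurable
    rw [setIntegral_indicator (hm _ (hD i)),
      setIntegral_genCondExp hm (hs.inter (hD i)) ((hX i).mono_set inter_subset_right),
      h0 i _ (hs.inter (hD i)) inter_subset_right]
    simp
  filter_upwards [hcov, ae_all_iff.2 key] with ω ⟨i, hi⟩ h
  have := h i
  rwa [indicator_of_mem hi] at this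

lemma setIntegral_eq_zero_of_genCondExp (hm : m ≤ mΩ) {X : Ω → ℝ} {D : Set Ω}
    (hD : MeasurableSet[m] D) (hX : IntegrableOn X D P) (h0 : genCondExp m P X =ᵐ[P] 0) :
    ∫ ω in D, X ω ∂P = 0 := by
  rw [← setIntegral_genCondExp hm hD hX]
  exact integral_eq_zero_of_ae (ae_restrict_of_ae h0)

lemma integrableOn_of_condLExp_le (hm : m ≤ mΩ) {X : Ω → ℝ} (hX : Measurable X) {D : Set Ω}
    (hD : MeasurableSet[m] D) {c : ℝ≥0∞} (hc : c ≠ ∞)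
    (h : ∀ᵐ ω ∂P, ω ∈ D → condLExp m P (fun ω' => ENNReal.ofReal |X ω'|) ω ≤ c) :
    IntegrableOn X D P := by
  refine ⟨hX.aestronglyMeasurable, ?_⟩
  have h1 : ∫⁻ ω in D, ‖X ω‖ₑ ∂P =
      ∫⁻ ω in D, condLExp m P (fun ω' => ENNReal.ofReal |X ω'|) ω ∂P := by
    rw [setLIntegral_condLExp hm P _ hD]
    exact lintegral_congr fun ω => by rw [Real.enorm_eq_ofReal_abs]
  rw [HasFiniteIntegral, h1]
  calc _ ≤ ∫⁻ _ in D, c ∂P := lintegral_mono_ae ((ae_restrict_iff' (hm D hD)).2 h)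
    _ < ∞ := by rw [setLIntegral_const]; finiteness

end CondExp

/-! ### Paths of finite variation -/

lemma locallyBoundedVariationOn_add {f g : ℝ≥0 → ℝ} {s : Set ℝ≥0}
    (hf : LocallyBoundedVariationOn f s) (hg : LocallyBoundedVariationOn g s) :
    LocallyBoundedVariationOn (fun t => f t + g t) s := by
  intro a b ha hb
  refine ne_top_of_le_ne_top (ENNReal.add_ne_top.2 ⟨hf a b ha hb, hg a b ha hb⟩) ?_
  refine iSup_le fun p => ?_
  calc _ ≤ ∑ i ∈ Finset.range p.1, (edist (f (p.2.1 (i + 1))) (f (p.2.1 i)) +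
        edist (g (p.2.1 (i + 1))) (g (p.2.1 i))) := Finset.sum_le_sum fun i _ =>
        edist_add_add_le _ _ _ _
    _ ≤ _ := by
        rw [Finset.sum_add_distrib]
        exact add_le_add (eVariationOn.sum_le p.2.2.1 p.2.2.2)
          (eVariationOn.sum_le p.2.2.1 p.2.2.2)

lemma locallyBoundedVariationOn_sub {p q : ℝ≥0 → ℝ} (hp : Monotone p) (hq : Monotone q) :
    LocallyBoundedVariationOn (fun t => p t - q t) univ := by
  have hq' : LocallyBoundedVariationOn (fun t => -q t) univ := fun a b ha hb =>
    (LipschitzWith.id.neg (α := ℝ)).comp_locallyBoundedVariationOn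
      (hq.monotoneOn univ).locallyBoundedVariationOn a b ha hb
  simpa only [sub_eq_add_neg] using
    locallyBoundedVariationOn_add (hp.monotoneOn univ).locallyBoundedVariationOn hq'

/-- The comparison functions `g` have locally bounded variation on the whole half-line, past `T`
too; taking `T = x` therefore controls the variation of `m` right up to the jump at `x`, not only on
compact subintervals of `[0,x)`. -/
lemma locallyBoundedVariationOn_of_pre {m : ℝ≥0 → ℝ} {x : ℝ≥0∞} {c : ℝ}
    (hpre : ∀ T : ℝ≥0, (T : ℝ≥0∞) ≤ x →
      ∃ g, LocallyBoundedVariationOn g univ ∧ ∀ s < T, m s = g s)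
    (hpost : ∀ s : ℝ≥0, x ≤ s → m s = c) : LocallyBoundedVariationOn m univ := by
  intro a b ha hb
  rcases lt_or_ge (b : ℝ≥0∞) x with hbx | hxb
  · obtain ⟨T, hbT, hTx⟩ := ENNReal.lt_iff_exists_nnreal_btwn.1 hbx
    obtain ⟨g, hg, hmg⟩ := hpre T hTx.le
    have : eVariationOn m (univ ∩ Icc a b) = eVariationOn g (univ ∩ Icc a b) :=
      eVariationOn.congr fun s hs => hmg s (hs.2.2.trans_lt (ENNReal.coe_lt_coe.1 hbT))
    rw [BoundedVariationOn, this]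
    exact hg a b ha hb
  · lift x to ℝ≥0 using ne_top_of_le_ne_top ENNReal.coe_ne_top hxb
    obtain ⟨g, hg, hmg⟩ := hpre x le_rfl
    obtain ⟨p, q, hp, hq, rfl⟩ := hg.exists_monotoneOn_sub_monotoneOn
    rw [monotoneOn_univ] at hp hq
    -- From `x` on, `p` and `q` are replaced by the constants `R + c` and `R`. This `R` is large
    -- enough for both to remain monotone, and the difference is `c`.
    set R := max (q x) (p x - c)
    have hp' : Monotone fun s => if s < x then p s else R + c := by
      intro s r hsr
      by_cases hr : r < x
      · simp only [hr, hsr.trans_lt hr, if_true]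
        exact hp hsr
      · by_cases hs : s < x
        · simp only [hs, hr, if_true, if_false]
          linarith [hp hs.le, le_max_right (q x) (p x - c)]
        · simp [hs, hr]
    have hq' : Monotone fun s => if s < x then q s else R := by
      intro s r hsr
      by_cases hr : r < x
      · simp only [hr, hsr.trans_lt hr, if_true]
        exact hq hsr
      · by_cases hs : s < x
        · simp only [hs, hr, if_true, if_false]
          exact (hq hs.le).trans (le_max_left _ _)
        · simp [hs, hr]
    have hm : m = (fun s => if s < x then p s else R + c) - fun s => if s < x then q s else R := by
      ext s
      by_cases hs : s < x
      · simp [hs, hmg s hs]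
      · simp [hs, hpost s (ENNReal.coe_le_coe.2 (not_lt.1 hs))]
    rw [hm]
    exact locallyBoundedVariationOn_sub hp' hq' a b ha hb

lemma boundedVariationOn_stopped {f : ℝ≥0 → ℝ} (hf : LocallyBoundedVariationOn f univ) (t : ℝ≥0) :
    BoundedVariationOn (fun s => f (min s t)) univ := by
  refine ne_top_of_le_ne_top (hf 0 t (mem_univ _) (mem_univ _))
    (eVariationOn.comp_le_of_monotoneOn f (fun s => min s t)
      (fun _ _ _ _ h => min_le_min_right t h) fun s _ => ⟨mem_univ _, zero_le, min_le_right _ _⟩)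

lemma isCadlag_of_locallyBoundedVariationOn {f : ℝ≥0 → ℝ}
    (hf : LocallyBoundedVariationOn f univ) (hr : ∀ t, ContinuousWithinAt f (Ici t) t) :
    IsCadlag f := by
  refine ⟨hr, fun t ht => ⟨_, ((boundedVariationOn_stopped hf t).tendsto_leftLim t).congr' ?_⟩⟩
  filter_upwards [self_mem_nhdsWithin] with s hs
  rw [min_eq_left (le_of_lt hs)]

lemma locallyBoundedVariationOn_signedMeasure_Ioc (ν : SignedMeasure ℝ≥0) (a : ℝ) :
    LocallyBoundedVariationOn (fun t => a + ν (Ioc 0 t)) univ := by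
  have key : ∀ p : Measure ℝ≥0, IsFiniteMeasure p → Monotone fun t => p.real (Ioc 0 t) :=
    fun p hp _ _ h => measureReal_mono (Ioc_subset_Ioc_right h)
  refine locallyBoundedVariationOn_add (monotone_const.monotoneOn _).locallyBoundedVariationOn ?_
  simp_rw [fun t => ν.apply_eq_posPart_real_sub_negPart_real (measurableSet_Ioc (a := 0) (b := t))]
  exact locallyBoundedVariationOn_sub (key _ inferInstance) (key _ inferInstance)

lemma continuousWithinAt_stopped {f : ℝ≥0 → ℝ} (hr : ∀ t, ContinuousWithinAt f (Ici t) t)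
    (t s : ℝ≥0) : ContinuousWithinAt (fun s => f (min s t)) (Ici s) s := by
  refine ContinuousWithinAt.comp (t := Ici (min s t)) (hr _)
    (continuous_id.min continuous_const).continuousWithinAt fun r hr => ?_
  exact min_le_min_right t hr

/-- The measure is that of the path stopped at `t`; right-continuity identifies the right limits in
its increments with values of the path. -/
lemma exists_signedMeasure_lsIntegral {f : ℝ≥0 → ℝ} (hf : LocallyBoundedVariationOn f univ)
    (hr : ∀ t, ContinuousWithinAt f (Ici t) t) (t : ℝ≥0) :
    ∃ κ : SignedMeasure ℝ≥0, (∀ a b, a ≤ b → κ (Ioc a b) = f (min b t) - f (min a t)) ∧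
      ∀ S, lsIntegral S f t = κ (S ∩ Ioc 0 t) := by
  have h := boundedVariationOn_stopped hf t
  refine ⟨h.vectorMeasure, fun a b hab => ?_, fun S => by rw [lsIntegral, dif_pos h]⟩
  have hl : ∀ s, Function.rightLim (fun s => f (min s t)) s = f (min s t) := fun s =>
    ContinuousWithinAt.rightLim_eq (continuousWithinAt_stopped hr t s)
  rw [h.vectorMeasure_Ioc hab, hl, hl]

/-- The measures of the paths stopped at `t` and at `r` agree on `(0,r]`, so equality of the
integrals kills `S n ∩ (r,t]` for each `n`; letting `n` grow, the increment over `(r,t]` is zero. -/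
lemma eq_of_lsIntegral_eq {f : ℝ≥0 → ℝ} (hf : LocallyBoundedVariationOn f univ)
    (hr : ∀ t, ContinuousWithinAt f (Ici t) t) {S : ℕ → Set ℝ≥0} (hS : ∀ n, MeasurableSet (S n))
    (hSm : Monotone S) (hSu : ⋃ n, S n = univ) {r t : ℝ≥0} (hrt : r ≤ t)
    (h : ∀ n, lsIntegral (S n) f t = lsIntegral (S n) f r) : f t = f r := by
  obtain ⟨κ, hκ, hκS⟩ := exists_signedMeasure_lsIntegral hf hr t
  obtain ⟨κ', hκ', hκS'⟩ := exists_signedMeasure_lsIntegral hf hr r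
  have h0 : ∀ n, κ (S n ∩ Ioc r t) = 0 := fun n => by
    have h1 : (κ - κ') (S n ∩ Ioc 0 r) = 0 := by
      refine signedMeasure_eq_zero_of_Ioc (T := r) (κ - κ') (fun u hu => ?_)
        ((hS n).inter measurableSet_Ioc) inter_subset_right
      rw [_root_.sub_apply, hκ _ _ zero_le, hκ' _ _ zero_le, min_eq_left hu,
        min_eq_left (hu.trans hrt), min_eq_left zero_le, min_eq_left zero_le, sub_self]
    have h2 := h n
    rw [hκS, hκS', ← Ioc_union_Ioc_eq_Ioc zero_le hrt, inter_union_distrib_left,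
      VectorMeasure.of_union ((Ioc_disjoint_Ioc_of_le le_rfl).mono inter_subset_right
        inter_subset_right) ((hS n).inter measurableSet_Ioc)
        ((hS n).inter measurableSet_Ioc)] at h2
    rw [_root_.sub_apply] at h1
    linarith
  have h1 : κ (Ioc r t) = 0 := by
    refine tendsto_nhds_unique (tendsto_signedMeasure κ (L := atTop)
      (fun n => (hS n).inter measurableSet_Ioc) measurableSet_Ioc (A := Ioc r t)
      (fun x => ?_)) (tendsto_const_nhds.congr fun n => (h0 n).symm)
    obtain ⟨n, hn⟩ := mem_iUnion.1 (hSu ▸ mem_univ x)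
    filter_upwards [eventually_ge_atTop n] with k hk
    simp [hSm hk hn]
  rw [hκ r t hrt, min_self, min_eq_left hrt] at h1
  linarith

/-- The value at `t` of the integral of `1_B` along the path which starts at `a`, has increments
given by `ν` before time `x`, and is equal to `c` from time `x` on. -/
noncomputable def restrictedPath (ν : SignedMeasure ℝ≥0) (B : Set ℝ≥0) (a : ℝ) (x : ℝ≥0∞) (c : ℝ)
    (t : ℝ≥0) : ℝ :=
  ν (B ∩ Ioc 0 t ∩ pre x) +
    ({y : ℝ≥0∞ | 0 < y ∧ y ≤ t ∧ y.toNNReal ∈ B}.indicator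
      (fun y => c - a - ν (Ioo 0 y.toNNReal)) x)

/-- The interval `(0,t]` is cut into the times before `x`, where the path has the increments of `ν`,
the jump time `x`, and the times after `x`, where the path is constant. Hence only the trace of `S`
on `(0,x]` matters, and there it equals `B`. -/
lemma lsIntegral_eq_restrictedPath {m : ℝ≥0 → ℝ} (hm : LocallyBoundedVariationOn m univ)
    (hr : ∀ t, ContinuousWithinAt m (Ici t) t) {x : ℝ≥0∞} {c : ℝ}
    (hpost : ∀ s : ℝ≥0, x ≤ s → m s = c) {ν : SignedMeasure ℝ≥0} {T : ℝ≥0}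
    (hν : ∀ s : ℝ≥0, s ≤ T → (s : ℝ≥0∞) < x → m s = m 0 + ν (Ioc 0 s)) {B S : Set ℝ≥0}
    (hB : MeasurableSet B) (hBT : B ⊆ Iic T) (hS : MeasurableSet S)
    (hSB : ∀ s : ℝ≥0, 0 < s → (s : ℝ≥0∞) ≤ x → (s ∈ S ↔ s ∈ B)) (t : ℝ≥0) :
    lsIntegral S m t = restrictedPath ν B (m 0) x c t := by
  obtain ⟨κ, hκ, hκS⟩ := exists_signedMeasure_lsIntegral hm hr t
  have hκ0 : ∀ u ≤ t, κ (Ioc 0 u) = m u - m 0 := fun u hu => by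
    rw [hκ _ _ zero_le, min_eq_left hu, min_eq_left zero_le]
  have hpre : ∀ C, MeasurableSet C → C ⊆ Ioc 0 (min t T) → C ⊆ pre x → κ C = ν C := by
    intro C hC hCT hCx
    have hu : ∀ u ≤ min t T, (u : ℝ≥0∞) < x → (κ - ν) (Ioc 0 u) = 0 := fun u hu hux => by
      rw [_root_.sub_apply, hκ0 u (hu.trans (min_le_left _ _)),
        hν u (hu.trans (min_le_right _ _)) hux]
      ring
    rw [← sub_eq_zero, ← _root_.sub_apply]
    rcases lt_or_ge ((min t T : ℝ≥0) : ℝ≥0∞) x with hx | hx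
    · exact signedMeasure_eq_zero_of_Ioc (κ - ν)
        (fun u hut => hu u hut (lt_of_le_of_lt (ENNReal.coe_le_coe.2 hut) hx)) hC hCT
    · lift x to ℝ≥0 using ne_top_of_le_ne_top ENNReal.coe_ne_top hx
      rw [ENNReal.coe_le_coe] at hx
      exact signedMeasure_eq_zero_of_Ioo (κ - ν) (T := x)
        (fun u hut => hu u (hut.le.trans hx) (ENNReal.coe_lt_coe.2 hut)) hC
        fun s hs => ⟨(hCT hs).1, ENNReal.coe_lt_coe.1 (hCx hs)⟩
  have h1 : S ∩ Ioc 0 t ∩ pre x = B ∩ Ioc 0 t ∩ pre x := by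
    ext s
    simp only [mem_inter_iff]
    constructor
    · rintro ⟨⟨h1, h2⟩, h3⟩
      exact ⟨⟨(hSB s h2.1 (le_of_lt h3)).1 h1, h2⟩, h3⟩
    · rintro ⟨⟨h1, h2⟩, h3⟩
      exact ⟨⟨(hSB s h2.1 (le_of_lt h3)).2 h1, h2⟩, h3⟩
  have hSm := hS.inter (measurableSet_Ioc (a := 0) (b := t))
  have h2 : (S ∩ Ioc 0 t) \ (S ∩ Ioc 0 t ∩ pre x) = (S ∩ Ioc 0 t) \ pre x := by
    rw [Set.sdiff_self_inter]
  rw [hκS, ← VectorMeasure.of_add_of_sdiff (hSm.inter (measurableSet_pre x)) hSm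
    inter_subset_left, h2, h1, restrictedPath,
    hpre _ ((hB.inter measurableSet_Ioc).inter (measurableSet_pre x))
      (fun s hs => ⟨hs.1.2.1, le_min hs.1.2.2 (hBT hs.1.1)⟩) inter_subset_right]
  congr 1
  rcases lt_or_ge (t : ℝ≥0∞) x with hx | hx
  · rw [indicator_of_notMem fun h => hx.not_ge h.2.1]
    rw [show (S ∩ Ioc 0 t) \ pre x = ∅ from sdiff_eq_empty.2 fun s hs =>
      lt_of_le_of_lt (ENNReal.coe_le_coe.2 hs.2.2) hx]
    simp
  lift x to ℝ≥0 using ne_top_of_le_ne_top ENNReal.coe_ne_top hx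
  rw [ENNReal.coe_le_coe] at hx
  have hafter : ∀ C, MeasurableSet C → C ⊆ Ioc x t → κ C = 0 := by
    intro C hC hCx
    rw [← VectorMeasure.restrict_eq_self κ measurableSet_Ioi hC (fun s hs => (hCx hs).1)]
    refine signedMeasure_eq_zero_of_Ioc (T := t) (κ.restrict (Ioi x)) (fun u hu => ?_) hC
      fun s hs => ⟨zero_le.trans_lt (hCx hs).1, (hCx hs).2⟩
    rw [VectorMeasure.restrict_apply _ measurableSet_Ioi measurableSet_Ioc]
    rcases le_or_gt x u with hxu | hux
    · rw [show Ioc 0 u ∩ Ioi x = Ioc x u by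
        ext s; simp only [mem_inter_iff, mem_Ioc, mem_Ioi]
        exact ⟨fun h => ⟨h.2, h.1.2⟩, fun h => ⟨⟨zero_le.trans_lt h.1, h.2⟩, h.1⟩⟩,
        hκ _ _ hxu, min_eq_left hu, min_eq_left hx, hpost u (ENNReal.coe_le_coe.2 hxu),
        hpost x le_rfl, sub_self]
    · rw [show Ioc 0 u ∩ Ioi x = ∅ from eq_empty_of_forall_notMem fun s hs =>
        absurd (lt_of_lt_of_le hs.2 hs.1.2) hux.not_gt]
      simp
  have hsplit : (S ∩ Ioc 0 t) \ pre (x : ℝ≥0∞) = (S ∩ Ioc 0 t ∩ {x}) ∪ (S ∩ Ioc x t) := by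
    ext s
    simp only [pre, Set.mem_sdiff, mem_inter_iff, mem_Ioc, mem_ofPred_eq, ENNReal.coe_lt_coe,
      not_lt, mem_union, mem_singleton_iff]
    constructor
    · rintro ⟨⟨h1, h2, h3⟩, h4⟩
      rcases h4.eq_or_lt with rfl | h4
      · exact Or.inl ⟨⟨h1, h2, h3⟩, rfl⟩
      · exact Or.inr ⟨h1, h4, h3⟩
    · rintro (⟨h1, h2⟩ | ⟨h1, h2, h3⟩)
      · exact ⟨h1, h2.ge⟩
      · exact ⟨⟨h1, zero_le.trans_lt h2, h3⟩, h2.le⟩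
  rw [hsplit, VectorMeasure.of_union (disjoint_left.2 fun s hs hs' => by
      obtain rfl : s = x := hs.2
      exact lt_irrefl _ hs'.2.1) (hSm.inter (measurableSet_singleton x))
      (hS.inter measurableSet_Ioc), hafter _ (hS.inter measurableSet_Ioc) inter_subset_right,
    add_zero]
  by_cases hxB : 0 < x ∧ x ∈ B
  · obtain ⟨hx0, hxB⟩ := hxB
    rw [indicator_of_mem (by simpa [hx0, hx] using hxB), ENNReal.toNNReal_coe,
      show S ∩ Ioc 0 t ∩ {x} = Ioc 0 x \ Ioo 0 x by
        rw [inter_eq_right.2 (show ({x} : Set ℝ≥0) ⊆ S ∩ Ioc 0 t from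
          singleton_subset_iff.2 ⟨(hSB x hx0 le_rfl).2 hxB, hx0, hx⟩)]
        ext s
        simp only [mem_singleton_iff, Set.mem_sdiff, mem_Ioc, mem_Ioo, not_and, not_lt]
        constructor
        · rintro rfl
          exact ⟨⟨hx0, le_rfl⟩, fun _ => le_rfl⟩
        · rintro ⟨h1, h2⟩
          exact le_antisymm h1.2 (h2 h1.1),
      VectorMeasure.of_sdiff measurableSet_Ioo measurableSet_Ioc Ioo_subset_Ioc_self, hκ0 x hx,
      hpost x le_rfl, hpre (Ioo 0 x) measurableSet_Ioo
        (fun s hs => ⟨hs.1, le_min (hs.2.le.trans hx) (hs.2.le.trans (hBT hxB))⟩)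
        fun s hs => ENNReal.coe_lt_coe.2 hs.2]
  · rw [indicator_of_notMem fun h => hxB ⟨ENNReal.coe_pos.1 h.1, by simpa using h.2.2⟩,
      show S ∩ Ioc 0 t ∩ {x} = ∅ from eq_empty_of_forall_notMem fun s hs => by
        obtain rfl : s = x := hs.2
        exact hxB ⟨hs.1.2.1, (hSB s hs.1.2.1 le_rfl).1 hs.1.1⟩]
    simp

/-! ### Measurability for the single jump filtration -/

section FiltrationLemmas

variable {Ω : Type*} [mΩ : MeasurableSpace Ω] {γ : Ω → ℝ≥0∞}

lemma measurableSet_filtration_of_subset {t : ℝ≥0} {A : Set Ω} (hA : MeasurableSet A)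
    (hAt : ∀ ω ∈ A, γ ω ≤ t) : MeasurableSet[filtration γ t] A :=
  ⟨hA, Or.inl (eq_empty_of_forall_notMem fun ω hω => (hAt ω hω.1).not_gt hω.2)⟩

lemma measurableSet_filtration_of_superset {t : ℝ≥0} {A : Set Ω} (hA : MeasurableSet A)
    (hAt : ∀ ω, (t : ℝ≥0∞) < γ ω → ω ∈ A) : MeasurableSet[filtration γ t] A :=
  ⟨hA, Or.inr (inter_eq_right.2 hAt)⟩

lemma measurableSet_filtration_cases {t : ℝ≥0} {A : Set Ω} (hA : MeasurableSet[filtration γ t] A) :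
    (∀ ω ∈ A, γ ω ≤ t) ∨ ∀ ω, (t : ℝ≥0∞) < γ ω → ω ∈ A := by
  rcases hA.2 with h | h
  · refine Or.inl fun ω hω => not_lt.1 fun hc => ?_
    have h' : ω ∈ A ∩ {ω | (t : ℝ≥0∞) < γ ω} := ⟨hω, hc⟩
    rw [h] at h'
    exact h'
  · exact Or.inr fun ω hω => inter_eq_right.1 h hω

lemma stronglyMeasurable_filtration {t : ℝ≥0} {X : Ω → ℝ} (hX : Measurable X) {c : ℝ}
    (hc : ∀ ω, (t : ℝ≥0∞) < γ ω → X ω = c) : StronglyMeasurable[filtration γ t] X := by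
  refine Measurable.stronglyMeasurable fun A hA => ?_
  by_cases h : c ∈ A
  · exact measurableSet_filtration_of_superset (hX hA) fun ω hω => by
      rw [mem_preimage, hc ω hω]; exact h
  · refine measurableSet_filtration_of_subset (hX hA) fun ω hω => not_lt.1 fun hlt => h ?_
    rw [← hc ω hlt]; exact hω

lemma eq_of_stronglyMeasurable_filtration {t : ℝ≥0} {X : Ω → ℝ}
    (hX : StronglyMeasurable[filtration γ t] X) {ω ω' : Ω} (hω : (t : ℝ≥0∞) < γ ω)
    (hω' : (t : ℝ≥0∞) < γ ω') : X ω = X ω' := by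
  have h : MeasurableSet[filtration γ t] (X ⁻¹' {X ω'}) :=
    hX.measurable (measurableSet_singleton _)
  rcases measurableSet_filtration_cases h with h | h
  · exact absurd (h ω' rfl) hω'.not_ge
  · exact h ω hω

lemma exists_pre_of_stronglyAdapted {M : ℝ≥0 → Ω → ℝ} (hM : StronglyAdapted (filtration γ) M) :
    ∃ f : ℝ≥0 → ℝ, ∀ (t : ℝ≥0) ω, (t : ℝ≥0∞) < γ ω → M t ω = f t := by
  have : ∀ t : ℝ≥0, ∃ c, ∀ ω, (t : ℝ≥0∞) < γ ω → M t ω = c := fun t => by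
    by_cases h : ∃ ω', (t : ℝ≥0∞) < γ ω'
    · obtain ⟨ω', hω'⟩ := h
      exact ⟨M t ω', fun ω hω => eq_of_stronglyMeasurable_filtration (hM t) hω hω'⟩
    · push Not at h
      exact ⟨0, fun ω hω => absurd hω (h ω).not_gt⟩
  choose f hf using this
  exact ⟨f, hf⟩

/-! ### Predictable sets -/

lemma measurableSet_of_predictable {S : Set (ℝ≥0 × Ω)}
    (hS : MeasurableSet[(filtration γ).predictable] S) : MeasurableSet S := by
  refine MeasurableSpace.generateFrom_le ?_ S hS
  rintro _ (⟨A, hA, rfl⟩ | ⟨i, A, hA, rfl⟩)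
  · exact (measurableSet_singleton _).prod ((filtration γ).le _ _ hA)
  · exact measurableSet_Ioi.prod ((filtration γ).le _ _ hA)

/-- It suffices to look at generators `(i,∞) × A`. Either `A` is contained in `{γ ≤ i}` and the set
misses `(0,γ]`, or `A` contains `{i < γ}` and on `(0,γ]` the set is `(i,∞)`. Complements and
countable unions preserve the property. -/
lemma exists_of_predictable {S : Set (ℝ≥0 × Ω)}
    (hS : MeasurableSet[(filtration γ).predictable] S) :
    ∃ B : Set ℝ≥0, MeasurableSet B ∧
      ∀ (t : ℝ≥0) ω, 0 < t → (t : ℝ≥0∞) ≤ γ ω → ((t, ω) ∈ S ↔ t ∈ B) := by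
  induction S, hS using MeasurableSpace.generateFrom_induction with
  | hC S hS =>
    rcases hS with ⟨A, hA, rfl⟩ | ⟨i, A, hA, rfl⟩
    · exact ⟨∅, MeasurableSet.empty, fun t ω ht _ => by simp [ht.ne']⟩
    · rcases measurableSet_filtration_cases hA with h | h
      · refine ⟨∅, MeasurableSet.empty, fun t ω ht htω => ?_⟩
        simp only [mem_prod, mem_Ioi, mem_empty_iff_false, iff_false, not_and]
        exact fun hit hω => (ENNReal.coe_lt_coe.2 hit).not_ge (htω.trans (h ω hω))
      · refine ⟨Ioi i, measurableSet_Ioi, fun t ω ht htω => ?_⟩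
        simp only [mem_prod, mem_Ioi, and_iff_left_iff_imp]
        exact fun hit => h ω (lt_of_lt_of_le (ENNReal.coe_lt_coe.2 hit) htω)
  | empty => exact ⟨∅, MeasurableSet.empty, fun _ _ _ _ => by simp⟩
  | compl S _ ih =>
    obtain ⟨B, hB, h⟩ := ih
    exact ⟨Bᶜ, hB.compl, fun t ω ht htω => by simp [h t ω ht htω]⟩
  | iUnion S _ ih =>
    choose B hB h using ih
    exact ⟨⋃ n, B n, MeasurableSet.iUnion hB, fun t ω ht htω => by
      simp only [mem_iUnion, h _ t ω ht htω]⟩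

lemma measurableSet_predictable_prod_univ {B : Set ℝ≥0} (hB : MeasurableSet B) :
    MeasurableSet[(filtration γ).predictable] (B ×ˢ (univ : Set Ω)) := by
  have h : @Measurable (ℝ≥0 × Ω) ℝ≥0 (filtration γ).predictable _ Prod.fst := by
    refine @measurable_of_Ioi ℝ≥0 (ℝ≥0 × Ω) _ _ _ (filtration γ).predictable _ _ _ _ fun t => ?_
    have := measurableSet_predictable_Ioi_prod (𝓕 := filtration γ) (i := t)
      (s := univ) MeasurableSet.univ
    rwa [prod_univ] at this
  rw [prod_univ]
  exact h hB

end FiltrationLemmas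

/-! ### Uniformly integrable martingales -/

lemma eq_of_dense_of_rightContinuous {f : ℝ≥0 → ℝ} (hf : ∀ t, ContinuousWithinAt f (Ici t) t)
    {D : Set ℝ≥0} (hD : Dense D) {x : ℝ≥0∞}
    (h : ∀ q ∈ D, ∀ r ∈ D, x ≤ (q : ℝ≥0∞) → q ≤ r → f r = f q) {s t : ℝ≥0}
    (hs : x ≤ s) (ht : x ≤ t) : f s = f t := by
  have key : ∀ s : ℝ≥0, x ≤ s → ∀ q ∈ D, x ≤ (q : ℝ≥0∞) → f s = f q := by
    intro s hs q hq hxq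
    by_contra hne
    obtain ⟨b, hb, hb'⟩ := mem_nhdsGE_iff_exists_Ico_subset.1
      ((hf s).eventually (isOpen_ne.mem_nhds hne))
    obtain ⟨r, hr, hr'⟩ := hD.exists_between hb
    refine hb' ⟨hr'.1.le, hr'.2⟩ ?_
    rcases le_total q r with hqr | hqr
    · exact h q hq r hr hxq hqr
    · exact (h r hr q hq (hs.trans (ENNReal.coe_le_coe.2 hr'.1.le)) hqr).symm
  obtain ⟨q, hq, hq'⟩ := hD.exists_between (lt_add_one s)
  have hxq : x ≤ (q : ℝ≥0∞) := hs.trans (ENNReal.coe_le_coe.2 hq'.1.le)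
  rw [key s hs q hq hxq, key t ht q hq hxq]

lemma uniformIntegrable_of_dominated {ι Ω : Type*} {mΩ : MeasurableSpace Ω} {P : Measure Ω}
    {f : ι → Ω → ℝ} {Z : Ω → ℝ} (hf : ∀ i, AEStronglyMeasurable (f i) P) (hZ : Integrable Z P)
    (h : ∀ i ω, |f i ω| ≤ Z ω) : UniformIntegrable f 1 P := by
  have hZm : MemLp Z 1 P := memLp_one_iff_integrable.2 hZ
  refine ⟨hf, fun ε hε => ?_, (eLpNorm Z 1 P).toNNReal, fun i => ?_⟩
  · obtain ⟨δ, hδ, hδ'⟩ := unifIntegrable_const (ι := Unit) le_rfl ENNReal.one_ne_top hZm hε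
    refine ⟨δ, hδ, fun i s hs hs' => le_trans (eLpNorm_mono fun ω => ?_) (hδ' () s hs hs')⟩
    by_cases hω : ω ∈ s
    · simp only [indicator_of_mem hω, Real.norm_eq_abs]
      exact (h i ω).trans (le_abs_self _)
    · simp [hω]
  · rw [ENNReal.coe_toNNReal hZm.2.ne]
    exact eLpNorm_mono fun ω => (h i ω).trans (le_abs_self _)

lemma stoppedProcess_eq_of_le {Ω : Type*} {X : ℝ≥0 → Ω → ℝ} {τ : Ω → WithTop ℝ≥0} {t : ℝ≥0} {ω : Ω}
    (h : (t : WithTop ℝ≥0) ≤ τ ω) : stoppedProcess X τ t ω = X t ω := by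
  rw [stoppedProcess, min_eq_left h]
  rfl

section Martingales

variable {Ω : Type*} [mΩ : MeasurableSpace Ω] {P : Measure Ω} {γ : Ω → ℝ≥0∞}

/-- An event of time `s`, or else its complement, lies in `{γ ≤ s}`, where `Y` no longer moves;
constancy of the expectation transfers the identity from the complement to the event. -/
lemma isUIMartingale_of_integral_eq [IsFiniteMeasure P] {Y : ℝ≥0 → Ω → ℝ} (hY : ∀ t, Measurable (Y t))
    {f : ℝ≥0 → ℝ} (hpre : ∀ (t : ℝ≥0) ω, (t : ℝ≥0∞) < γ ω → Y t ω = f t)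
    (hpost : ∀ (s t : ℝ≥0) ω, γ ω ≤ s → s ≤ t → Y t ω = Y s ω)
    (hE : ∀ t, ∫ ω, Y t ω ∂P = ∫ ω, Y 0 ω ∂P) {Z : Ω → ℝ} (hZ : Integrable Z P)
    (hYZ : ∀ t ω, |Y t ω| ≤ Z ω) (hc : ∀ ω, IsCadlag fun t => Y t ω) :
    IsUIMartingale (filtration γ) P Y := by
  have hint : ∀ t, Integrable (Y t) P := fun t =>
    hZ.mono' (hY t).aestronglyMeasurable (Eventually.of_forall (hYZ t))
  have hadp : StronglyAdapted (filtration γ) Y := fun t =>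
    stronglyMeasurable_filtration (hY t) (hpre t)
  refine ⟨⟨hadp, fun s t hst => ?_⟩, uniformIntegrable_of_dominated
    (fun t => (hY t).aestronglyMeasurable) hZ hYZ, Eventually.of_forall hc⟩
  refine (ae_eq_condExp_of_forall_setIntegral_eq ((filtration γ).le s) (hint t)
    (fun _ _ _ => (hint s).integrableOn) (fun A hA _ => ?_) (hadp s).aestronglyMeasurable).symm
  have hsub : ∀ A, MeasurableSet A → (∀ ω ∈ A, γ ω ≤ s) →
      ∫ ω in A, Y s ω ∂P = ∫ ω in A, Y t ω ∂P := fun A hA h =>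
    setIntegral_congr_fun hA fun ω hω => (hpost s t ω (h ω hω) hst).symm
  have hAm := (filtration γ).le s _ hA
  rcases measurableSet_filtration_cases hA with h | h
  · exact hsub A hAm h
  · have h1 := hsub Aᶜ hAm.compl fun ω hω => not_lt.1 fun hc => hω (h ω hc)
    have h2 := integral_add_compl hAm (hint s)
    have h3 := integral_add_compl hAm (hint t)
    have h4 := (hE s).trans (hE t).symm
    linarith

lemma IsUIMartingale.congr {X Y : ℝ≥0 → Ω → ℝ} (hX : StronglyAdapted (filtration γ) X)
    (hY : IsUIMartingale (filtration γ) P Y) (h : ∀ᵐ ω ∂P, ∀ t, X t ω = Y t ω) :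
    IsUIMartingale (filtration γ) P X := by
  have ht : ∀ t, X t =ᵐ[P] Y t := fun t => h.mono fun ω hω => hω t
  refine ⟨⟨hX, fun s t hst => ?_⟩, hY.2.1.ae_eq fun t => (ht t).symm, ?_⟩
  · exact (condExp_congr_ae (ht t)).trans ((hY.1.2 s t hst).trans (ht s).symm)
  · filter_upwards [h, hY.2.2] with ω h1 h2
    rwa [show (fun t => X t ω) = fun t => Y t ω from funext h1]

variable [IsProbabilityMeasure P]

/-- Every measurable subset of `{γ ≤ s}` belongs to the `σ`-field at time `s`, so on that set `X t`
and `X s` have the same integrals. -/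
lemma Martingale.ae_eq_after {X : ℝ≥0 → Ω → ℝ} (hX : Martingale X (filtration γ) P)
    (hγ : Measurable γ) {s t : ℝ≥0} (hst : s ≤ t) : ∀ᵐ ω ∂P, γ ω ≤ s → X t ω = X s ω := by
  have hm : MeasurableSet {ω | γ ω ≤ s} := measurableSet_le hγ measurable_const
  refine (ae_restrict_iff' (p := fun ω => X t ω = X s ω) hm).1 ?_
  refine Integrable.ae_eq_of_forall_setIntegral_eq _ _ (hX.integrable t).restrict
    (hX.integrable s).restrict fun A hA _ => ?_
  rw [Measure.restrict_restrict hA]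
  exact (hX.setIntegral_eq hst
    (measurableSet_filtration_of_subset (hA.inter hm) fun ω hω => hω.2)).symm

lemma IsUIMartingale.ae_const_after {X : ℝ≥0 → Ω → ℝ} (hX : IsUIMartingale (filtration γ) P X)
    (hγ : Measurable γ) :
    ∀ᵐ ω ∂P, ∀ s t : ℝ≥0, γ ω ≤ s → γ ω ≤ t → X s ω = X t ω := by
  obtain ⟨D, hDc, hD⟩ := TopologicalSpace.exists_countable_dense ℝ≥0
  have h : ∀ᵐ ω ∂P, ∀ q ∈ D, ∀ r ∈ D, γ ω ≤ (q : ℝ≥0) → q ≤ r → X r ω = X q ω := by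
    rw [ae_ball_iff hDc]
    intro q _
    rw [ae_ball_iff hDc]
    intro r _
    by_cases hqr : q ≤ r
    · filter_upwards [Martingale.ae_eq_after hX.1 hγ hqr] with ω h1 h2 _ using h1 h2
    · exact Eventually.of_forall fun ω _ h => absurd h hqr
  filter_upwards [h, hX.2.2] with ω h1 h2 s t hs ht
  exact eq_of_dense_of_rightContinuous h2.1 hD h1 hs ht

/-- Constancy of the expectation determines the path before the jump: for `s < T`, `f s` times `P(γ
> s)` equals `c - E[X T; γ ≤ s]`. This is a difference of monotone functions divided by a decreasing
one, hence of locally bounded variation. -/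
lemma IsUIMartingale.exists_pre {X : ℝ≥0 → Ω → ℝ} (hX : IsUIMartingale (filtration γ) P X)
    (hγ : Measurable γ) {T : ℝ≥0} (hT : T ∈ domT (P.map γ)) :
    ∃ g, LocallyBoundedVariationOn g univ ∧
      ∀ s < T, ∀ ω, (s : ℝ≥0∞) < γ ω → X s ω = g s := by
  obtain ⟨f, hf⟩ := exists_pre_of_stronglyAdapted hX.1.1
  have hle : ∀ s : ℝ≥0, MeasurableSet {ω | γ ω ≤ s} := fun s =>
    measurableSet_le hγ measurable_const
  have hint := hX.1.integrable
  -- For `s < T` this is `{s < γ}`. Adding `{T ≤ γ}` keeps the denominator positive at all times, so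
  -- that the formula defines a function on the whole half-line.
  set U : ℝ≥0 → Set Ω := fun s => {ω | (s : ℝ≥0∞) < γ ω} ∪ {ω | (T : ℝ≥0∞) ≤ γ ω} with hU
  have hTpos : 0 < P {ω | (T : ℝ≥0∞) ≤ γ ω} := by
    have := mem_domT.1 hT
    rwa [Measure.map_apply hγ measurableSet_Ici] at this
  have hUpos : ∀ s, 0 < P.real (U s) := fun s =>
    ENNReal.toReal_pos (hTpos.trans_le (measure_mono subset_union_right)).ne' (measure_ne_top _ _)
  have hq : Monotone fun s => (P.real (U s))⁻¹ := fun s r hsr => by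
    refine inv_anti₀ (hUpos r) (measureReal_mono (union_subset_union_left _ fun ω hω => ?_))
    exact lt_of_le_of_lt (ENNReal.coe_le_coe.2 hsr) hω
  have hq0 : ∀ s, 0 ≤ (P.real (U s))⁻¹ := fun s => inv_nonneg.2 measureReal_nonneg
  have ha : ∀ Z : Ω → ℝ, Integrable Z P → (∀ ω, 0 ≤ Z ω) →
      Monotone fun s : ℝ≥0 => ∫ ω in {ω | γ ω ≤ s}, Z ω ∂P := fun Z hZ hZ0 s r hsr =>
    setIntegral_mono_set hZ.integrableOn (Eventually.of_forall hZ0)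
      (Eventually.of_forall fun ω (hω : γ ω ≤ s) => hω.trans (ENNReal.coe_le_coe.2 hsr))
  set c := ∫ ω, X 0 ω ∂P
  set ap : ℝ≥0 → ℝ := fun s => ∫ ω in {ω | γ ω ≤ s}, max (X T ω) 0 ∂P with hap
  set an : ℝ≥0 → ℝ := fun s => ∫ ω in {ω | γ ω ≤ s}, max (-X T ω) 0 ∂P with han
  have hapm : Monotone ap := ha _ (hint T).pos_part fun ω => le_max_right _ _
  have hanm : Monotone an := ha _ (hint T).neg_part fun ω => le_max_right _ _
  have hap0 : ∀ s, 0 ≤ ap s := fun s => integral_nonneg fun ω => le_max_right _ _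
  have han0 : ∀ s, 0 ≤ an s := fun s => integral_nonneg fun ω => le_max_right _ _
  refine ⟨fun s => (max c 0 + an s) * (P.real (U s))⁻¹ - (max (-c) 0 + ap s) * (P.real (U s))⁻¹,
    locallyBoundedVariationOn_sub ?_ ?_, fun s hs ω hω => ?_⟩
  · exact (hanm.const_add _).mul hq (fun s => add_nonneg (le_max_right _ _) (han0 s)) hq0
  · exact (hapm.const_add _).mul hq (fun s => add_nonneg (le_max_right _ _) (hap0 s)) hq0
  · have hUs : U s = {ω | γ ω ≤ s}ᶜ := by
      ext ω
      simp only [hU, mem_union, mem_ofPred_eq, mem_compl_iff, not_le]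
      exact ⟨fun h => h.elim id fun h => (ENNReal.coe_lt_coe.2 hs).trans_le h, Or.inl⟩
    have h1 : ∫ ω, X s ω ∂P = c := by
      have := hX.1.setIntegral_eq (zero_le (a := s)) MeasurableSet.univ
      rw [setIntegral_univ, setIntegral_univ] at this
      exact this.symm
    have h2 := integral_add_compl (hle s) (hint s)
    have h3 : ∫ ω in {ω | γ ω ≤ s}, X s ω ∂P = ap s - an s := by
      rw [hap, han]
      simp only
      rw [← integral_sub (hint T).pos_part.integrableOn (hint T).neg_part.integrableOn]
      refine setIntegral_congr_ae (hle s) ?_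
      filter_upwards [Martingale.ae_eq_after hX.1 hγ hs.le] with ω h hω
      rw [← h hω, max_zero_sub_max_neg_zero_eq_self]
    have h4 : ∫ ω in {ω | γ ω ≤ s}ᶜ, X s ω ∂P = f s * P.real (U s) := by
      rw [setIntegral_congr_fun (g := fun _ => f s) (hle s).compl fun ω hω => hf s ω (not_le.1 hω),
        setIntegral_const, hUs, smul_eq_mul, mul_comm]
    rw [hf s ω hω]
    simp only
    rw [← sub_mul, eq_mul_inv_iff_mul_eq₀ (hUpos s).ne', ← h4]
    have h5 := max_zero_sub_max_neg_zero_eq_self c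
    linarith

/-! ### Local martingales have finite variation -/

lemma IsLocalMartingale.ae_const_after {N : ℝ≥0 → Ω → ℝ}
    (hN : IsLocalMartingale (filtration γ) P N) (hγ : Measurable γ) :
    ∀ᵐ ω ∂P, ∀ s t : ℝ≥0, γ ω ≤ s → γ ω ≤ t → N s ω = N t ω := by
  obtain ⟨-, -, τ, hτ, hX⟩ := hN
  filter_upwards [hτ.tendsto_top, ae_all_iff.2 fun n => (hX n).ae_const_after hγ]
    with ω h1 h2 s t hs ht
  have h3 := h1.eventually (lt_mem_nhds (WithTop.coe_lt_top (max s t)))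
  obtain ⟨n, hn⟩ := h3.exists
  have h4 := h2 n s t hs ht
  rwa [stoppedProcess_eq_of_le ((WithTop.coe_le_coe.2 (le_max_left s t)).trans hn.le),
    stoppedProcess_eq_of_le ((WithTop.coe_le_coe.2 (le_max_right s t)).trans hn.le)] at h4

/-- One outcome `ω₀` with `γ ≥ T` and `τ n > T` suffices: for `s < T` the event `{τ n ≤ s}` cannot
contain all of `{s < γ}`, so it is contained in `{γ ≤ s}`. Thus no outcome with `γ > s` is stopped
before `s`, and the stopped process agrees with `N` there. -/
lemma IsLocalMartingale.exists_pre {N : ℝ≥0 → Ω → ℝ}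
    (hN : IsLocalMartingale (filtration γ) P N) (hγ : Measurable γ) {T : ℝ≥0}
    (hT : T ∈ domT (P.map γ)) :
    ∃ g, LocallyBoundedVariationOn g univ ∧
      ∀ s < T, ∀ ω, (s : ℝ≥0∞) < γ ω → N s ω = g s := by
  obtain ⟨-, -, τ, hτ, hX⟩ := hN
  have hTpos := mem_domT.1 hT
  rw [Measure.map_apply hγ measurableSet_Ici] at hTpos
  have hfreq : ∃ᵐ ω ∂P, (T : ℝ≥0∞) ≤ γ ω := by
    rw [frequently_ae_iff]; exact hTpos.ne'
  obtain ⟨ω₀, hω₀, h1⟩ := (hfreq.and_eventually hτ.tendsto_top).exists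
  obtain ⟨n, hn⟩ := (h1.eventually (lt_mem_nhds (WithTop.coe_lt_top T))).exists
  obtain ⟨g, hg, hgX⟩ := (hX n).exists_pre hγ hT
  refine ⟨g, hg, fun s hs ω hω => ?_⟩
  rw [← hgX s hs ω hω, stoppedProcess_eq_of_le]
  rcases measurableSet_filtration_cases (hτ.isStoppingTime n s) with h | h
  · exact (not_le.1 fun hc => hω.not_ge (h ω hc)).le
  · have h2 := h ω₀ (lt_of_lt_of_le (ENNReal.coe_lt_coe.2 hs) hω₀)
    exact absurd (lt_of_le_of_lt (WithTop.coe_le_coe.2 hs.le) hn) (not_lt.2 h2)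

lemma ae_le_imp_mem_domT (hγ : Measurable γ) :
    ∀ᵐ ω ∂P, ∀ t : ℝ≥0, (t : ℝ≥0∞) ≤ γ ω → t ∈ domT (P.map γ) := by
  have := Measure.isProbabilityMeasure_map (μ := P) hγ.aemeasurable
  exact ae_of_ae_map hγ.aemeasurable (ae_mem_domT (P.map γ))

lemma IsLocalMartingale.ae_locallyBoundedVariationOn {N : ℝ≥0 → Ω → ℝ}
    (hN : IsLocalMartingale (filtration γ) P N) (hγ : Measurable γ) :
    ∀ᵐ ω ∂P, LocallyBoundedVariationOn (fun t => N t ω) univ := by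
  filter_upwards [hN.ae_const_after hγ, ae_le_imp_mem_domT (P := P) hγ] with ω h1 h2
  refine locallyBoundedVariationOn_of_pre (x := γ ω) (c := N (γ ω).toNNReal ω)
    (fun T hT => ?_) fun s hs => ?_
  · obtain ⟨g, hg, hgN⟩ := hN.exists_pre hγ (h2 T hT)
    exact ⟨g, hg, fun s hs => hgN s hs ω (lt_of_lt_of_le (ENNReal.coe_lt_coe.2 hs) hT)⟩
  · have : ((γ ω).toNNReal : ℝ≥0∞) = γ ω :=
      ENNReal.coe_toNNReal (ne_top_of_le_ne_top ENNReal.coe_ne_top hs)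
    exact h1 s _ hs this.ge

lemma IsSemimartingale.ae_locallyBoundedVariationOn {M : ℝ≥0 → Ω → ℝ}
    (hM : IsSemimartingale (filtration γ) P M) (hγ : Measurable γ) :
    ∀ᵐ ω ∂P, LocallyBoundedVariationOn (fun t => M t ω) univ := by
  obtain ⟨N, A, hN, hA, hNA⟩ := hM
  filter_upwards [hN.ae_locallyBoundedVariationOn hγ, hA.2] with ω h1 h2
  simp_rw [hNA]
  exact locallyBoundedVariationOn_add h1 h2.2

end Martingales

/-! ### Càdlàg paths with one jump -/

lemma IsCadlag.add {f g : ℝ≥0 → ℝ} (hf : IsCadlag f) (hg : IsCadlag g) :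
    IsCadlag fun t => f t + g t := by
  refine ⟨fun t => (hf.1 t).add (hg.1 t), fun t ht => ?_⟩
  obtain ⟨l, hl⟩ := hf.2 t ht
  obtain ⟨k, hk⟩ := hg.2 t ht
  exact ⟨l + k, hl.add hk⟩

lemma isCadlag_const (c : ℝ) : IsCadlag fun _ => c :=
  ⟨fun _ => continuousWithinAt_const, fun _ _ => ⟨c, tendsto_const_nhds⟩⟩

open scoped Classical in
lemma isCadlag_step (x : ℝ≥0∞) (k : ℝ) : IsCadlag fun t : ℝ≥0 => if x ≤ t then k else 0 := by
  have hcoe : ∀ t : ℝ≥0, Tendsto ((↑) : ℝ≥0 → ℝ≥0∞) (𝓝 t) (𝓝 (t : ℝ≥0∞)) := fun t =>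
    ENNReal.continuous_coe.tendsto t
  refine ⟨fun t => ?_, fun t _ => ?_⟩
  · rcases le_or_gt x t with h | h
    · refine tendsto_const_nhds.congr' ?_
      filter_upwards [self_mem_nhdsWithin] with s hs
      rw [if_pos h, if_pos (h.trans (ENNReal.coe_le_coe.2 hs))]
    · refine tendsto_const_nhds.congr' ?_
      filter_upwards [mem_nhdsWithin_of_mem_nhds ((hcoe t).eventually (gt_mem_nhds h))] with s hs
      rw [if_neg h.not_ge, if_neg hs.not_ge]
  · rcases lt_or_ge x t with h | h
    · refine ⟨k, tendsto_const_nhds.congr' ?_⟩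
      filter_upwards [mem_nhdsWithin_of_mem_nhds ((hcoe t).eventually (lt_mem_nhds h))] with s hs
      rw [if_pos (le_of_lt hs)]
    · refine ⟨0, tendsto_const_nhds.congr' ?_⟩
      filter_upwards [self_mem_nhdsWithin] with s hs
      rw [if_neg (lt_of_lt_of_le (ENNReal.coe_lt_coe.2 hs) h).not_ge]

lemma image_coe_inter_Ioc (B : Set ℝ≥0) (t : ℝ≥0) :
    ((↑) : ℝ≥0 → ℝ≥0∞) '' (B ∩ Ioc 0 t) = {y : ℝ≥0∞ | 0 < y ∧ y ≤ t ∧ y.toNNReal ∈ B} := by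
  ext y
  constructor
  · rintro ⟨s, ⟨h1, h2, h3⟩, rfl⟩
    exact ⟨ENNReal.coe_pos.2 h2, ENNReal.coe_le_coe.2 h3, by simpa using h1⟩
  · rintro ⟨h1, h2, h3⟩
    lift y to ℝ≥0 using ne_top_of_le_ne_top ENNReal.coe_ne_top h2
    exact ⟨y, ⟨by simpa using h3, ENNReal.coe_pos.1 h1, ENNReal.coe_le_coe.1 h2⟩, rfl⟩

lemma measurableSet_image_coe {C : Set ℝ≥0} (hC : MeasurableSet C) :
    MeasurableSet (((↑) : ℝ≥0 → ℝ≥0∞) '' C) :=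
  measurableEmbedding_coe.measurableSet_image.2 hC

lemma restrictedPath_at_zero (ν : SignedMeasure ℝ≥0) (B : Set ℝ≥0) (a : ℝ) (x : ℝ≥0∞) (c : ℝ) :
    restrictedPath ν B a x c 0 = 0 := by
  rw [restrictedPath, ← image_coe_inter_Ioc]
  simp

lemma restrictedPath_jump_zero (ν : SignedMeasure ℝ≥0) (B : Set ℝ≥0) (a c : ℝ) (t : ℝ≥0) :
    restrictedPath ν B a 0 c t = 0 := by
  simp [restrictedPath, pre]

lemma isCadlag_restrictedPath (ν : SignedMeasure ℝ≥0) {B : Set ℝ≥0} (hB : MeasurableSet B) (a : ℝ)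
    (x : ℝ≥0∞) (c : ℝ) : IsCadlag (restrictedPath ν B a x c) := by
  classical
  have h := (isCadlag_signedMeasure_Ioc (ν.restrict (B ∩ pre x))).add
    (isCadlag_step x (if 0 < x ∧ x.toNNReal ∈ B then c - a - ν (Ioo 0 x.toNNReal) else 0))
  convert h using 2 with t
  rw [VectorMeasure.restrict_apply _ (hB.inter (measurableSet_pre x)) measurableSet_Ioc,
    restrictedPath]
  congr 1
  · congr 1
    ext s
    simp only [mem_inter_iff]
    tauto
  · simp only [indicator, mem_ofPred_eq]
    split_ifs <;> first | rfl | tauto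

/-! ### Integrals with respect to the law of `γ` -/

section Law

variable {Ω : Type*} [mΩ : MeasurableSpace Ω] {P : Measure Ω} {γ : Ω → ℝ≥0∞}

lemma setIntegral_dG_map (hγ : Measurable γ) {h : ℝ≥0 → ℝ} (hh : Measurable h) {C : Set ℝ≥0}
    (hC : MeasurableSet C) :
    ∫ s in C, h s ∂(dG (P.map γ)) = ∫ ω in γ ⁻¹' ((↑) '' C), h (γ ω).toNNReal ∂P := by
  rw [setIntegral_dG]
  exact setIntegral_map (measurableSet_image_coe hC)
    (hh.comp ENNReal.measurable_toNNReal).aestronglyMeasurable hγ.aemeasurable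

lemma integrableOn_dG_map (hγ : Measurable γ) {h : ℝ≥0 → ℝ} (hh : Measurable h) {C : Set ℝ≥0}
    (hC : MeasurableSet C) :
    IntegrableOn h C (dG (P.map γ)) ↔
      IntegrableOn (fun ω => h (γ ω).toNNReal) (γ ⁻¹' ((↑) '' C)) P := by
  rw [integrableOn_dG, IntegrableOn, Measure.restrict_map hγ (measurableSet_image_coe hC)]
  exact integrable_map_measure (hh.comp ENNReal.measurable_toNNReal).aestronglyMeasurable
    hγ.aemeasurable

variable [IsProbabilityMeasure P]

lemma avg_map_apply (hγ : Measurable γ) (ν : SignedMeasure ℝ≥0) {C : Set ℝ≥0}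
    (hC : MeasurableSet C) : avg (P.map γ) ν C = ∫ ω, ν (C ∩ pre (γ ω)) ∂P := by
  rw [avg_apply _ ν hC]
  exact integral_map hγ.aemeasurable
    (measurable_signedMeasure_inter_pre ν hC).aestronglyMeasurable

/-- The hypothesis `havg` says that the mean increment before the jump is compensated by the mean
jump, so the expectation is constant in `t`. The part coming from `ν` is bounded by its total
variation, and the jump part is dominated because `ℓ` is integrable when `γ` lies in `B`. -/
lemma isUIMartingale_restrictedPath (hγ : Measurable γ) (ν : SignedMeasure ℝ≥0) {B : Set ℝ≥0}
    (hB : MeasurableSet B) {ℓ X₀ : Ω → ℝ} (hℓ : Measurable ℓ) (hX₀ : Measurable X₀)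
    (hX₀i : Integrable X₀ P) {a b : ℝ} (hX₀c : ∀ ω, 0 < γ ω → X₀ ω = b)
    (hint : IntegrableOn ℓ (γ ⁻¹' ((↑) '' (B ∩ Ioi 0))) P)
    (havg : ∀ t, avg (P.map γ) ν (B ∩ Ioc 0 t) =
      ∫ ω in γ ⁻¹' ((↑) '' (B ∩ Ioc 0 t)), (a + ν (Ioo 0 (γ ω).toNNReal) - ℓ ω) ∂P) :
    IsUIMartingale (filtration γ) P
      fun t ω => X₀ ω + restrictedPath ν B a (γ ω) (ℓ ω) t := by
  set J : ℝ≥0 → Set Ω := fun t => γ ⁻¹' ((↑) '' (B ∩ Ioc 0 t)) with hJ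
  set D : Set Ω := γ ⁻¹' ((↑) '' (B ∩ Ioi 0)) with hD
  set w : Ω → ℝ := fun ω => a + ν (Ioo 0 (γ ω).toNNReal) - ℓ ω with hw
  set V := ν.totalVariation.real univ
  have hV : 0 ≤ V := measureReal_nonneg
  have hJm : ∀ t, MeasurableSet (J t) := fun t =>
    hγ (measurableSet_image_coe (hB.inter measurableSet_Ioc))
  have hDm : MeasurableSet D := hγ (measurableSet_image_coe (hB.inter measurableSet_Ioi))
  have hJD : ∀ t, J t ⊆ D := fun t =>
    preimage_mono (image_mono (inter_subset_inter_right _ Ioc_subset_Ioi_self))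
  have hνm : Measurable fun ω => ν (Ioo 0 (γ ω).toNNReal) :=
    (measurable_signedMeasure_Ioo ν).comp (ENNReal.measurable_toNNReal.comp hγ)
  have hwm : Measurable w := (hνm.const_add a).sub hℓ
  have hpath : ∀ t ω, restrictedPath ν B a (γ ω) (ℓ ω) t =
      ν (B ∩ Ioc 0 t ∩ pre (γ ω)) - (J t).indicator w ω := fun t ω => by
    rw [restrictedPath, ← image_coe_inter_Ioc, sub_eq_add_neg]
    congr 1
    by_cases h : γ ω ∈ ((↑) : ℝ≥0 → ℝ≥0∞) '' (B ∩ Ioc 0 t)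
    · rw [indicator_of_mem h, indicator_of_mem (show ω ∈ J t from h), hw]
      ring
    · rw [indicator_of_notMem h, indicator_of_notMem (show ω ∉ J t from h), neg_zero]
  have hpm : ∀ t, Measurable fun ω => ν (B ∩ Ioc 0 t ∩ pre (γ ω)) := fun t =>
    (measurable_signedMeasure_inter_pre ν (hB.inter measurableSet_Ioc)).comp hγ
  have hpi : ∀ t, Integrable (fun ω => ν (B ∩ Ioc 0 t ∩ pre (γ ω))) P := fun t =>
    Integrable.of_bound (hpm t).aestronglyMeasurable V
      (Eventually.of_forall fun _ => abs_signedMeasure_le ν _)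
  have hwi : IntegrableOn w D P := by
    refine Integrable.sub ?_ hint
    exact Integrable.of_bound (hνm.const_add a).aestronglyMeasurable (|a| + V)
      (Eventually.of_forall fun ω => (abs_add_le _ _).trans
        (add_le_add_right (abs_signedMeasure_le ν _) _))
  have hE : ∀ t, ∫ ω, (X₀ ω + restrictedPath ν B a (γ ω) (ℓ ω) t) ∂P = ∫ ω, X₀ ω ∂P := fun t => by
    simp_rw [hpath]
    have hwJ : Integrable ((J t).indicator w) P :=
      (hwi.mono_set (hJD t)).integrable_indicator (hJm t)
    rw [integral_add hX₀i (g := fun ω => ν (B ∩ Ioc 0 t ∩ pre (γ ω)) - (J t).indicator w ω)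
      ((hpi t).sub hwJ), integral_sub (hpi t) hwJ, integral_indicator (hJm t),
      ← havg t, avg_map_apply hγ ν (hB.inter measurableSet_Ioc), sub_self, add_zero]
  refine isUIMartingale_of_integral_eq (f := fun t => b + ν (B ∩ Ioc 0 t))
    (Z := fun ω => |X₀ ω| + (V + D.indicator (fun ω => |w ω|) ω)) ?_ ?_ ?_ ?_ ?_ ?_ ?_
  · intro t
    simp_rw [hpath]
    exact hX₀.add ((hpm t).sub (hwm.indicator (hJm t)))
  · intro t ω h
    simp only [hpath]
    rw [hX₀c ω (zero_le.trans_lt h), inter_assoc, Ioc_inter_pre_of_lt h,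
      indicator_of_notMem, sub_zero]
    rintro ⟨s, hs, h'⟩
    rw [← h'] at h
    exact (ENNReal.coe_lt_coe.1 h).not_ge hs.2.2
  · intro s t ω h hst
    simp only [hpath]
    have hJst : ω ∈ J t ↔ ω ∈ J s := by
      simp only [hJ, mem_preimage, image_coe_inter_Ioc]
      exact ⟨fun h' => ⟨h'.1, h, h'.2.2⟩,
        fun h' => ⟨h'.1, h.trans (ENNReal.coe_le_coe.2 hst), h'.2.2⟩⟩
    have h1 : Ioc 0 t ∩ pre (γ ω) = Ioc 0 s ∩ pre (γ ω) := by
      ext r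
      simp only [mem_inter_iff, mem_Ioc, pre, mem_ofPred_eq]
      exact ⟨fun h' => ⟨⟨h'.1.1, ENNReal.coe_le_coe.1 (h'.2.le.trans h)⟩, h'.2⟩,
        fun h' => ⟨⟨h'.1.1, h'.1.2.trans hst⟩, h'.2⟩⟩
    rw [inter_assoc, inter_assoc, h1]
    congr 2
    by_cases h2 : ω ∈ J s
    · rw [indicator_of_mem h2, indicator_of_mem (hJst.2 h2)]
    · rw [indicator_of_notMem h2, indicator_of_notMem (hJst.not.2 h2)]
  · exact fun t => (hE t).trans (hE 0).symm
  · exact hX₀i.abs.add ((integrable_const V).add ((integrable_indicator_iff hDm).2 hwi.abs))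
  · intro t ω
    simp only [hpath]
    refine (abs_add_le _ _).trans (add_le_add_right ((abs_sub _ _).trans
      (add_le_add (abs_signedMeasure_le ν _) ?_)) _)
    by_cases h2 : ω ∈ J t
    · rw [indicator_of_mem h2, indicator_of_mem (hJD t h2)]
    · rw [indicator_of_notMem h2, abs_zero]
      exact indicator_nonneg (fun _ _ => abs_nonneg _) _
  · exact fun ω => (isCadlag_const _).add (isCadlag_restrictedPath ν hB _ _ _)

end Law

/-! ### Changing the values of `H` -/

/-- The value of `H` at `0` is free: the balance integrates over `(0,t]`, and `t_G > 0` because `γ`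
is positive with positive probability, so the boundary condition does not look at `0` either. -/
lemma ConditionM.congr {μ : Measure ℝ≥0∞} [IsProbabilityMeasure μ] {F H H' : ℝ≥0 → ℝ}
    (h : ConditionM μ F H) (hμ : 0 < μ (Ioi 0)) (hH : ∀ t ∈ domT μ, 0 < t → H' t = H t) :
    ConditionM μ F H' where
  locAC := h.locAC
  l1loc := by
    have := isFiniteMeasure_dG μ
    refine ⟨?_, fun t ht => integrableOn_Icc_of_Ioc ?_⟩
    · classical
      have h1 : (domT μ).domRestrict H' =
          {t : domT μ | t.1 = 0}.piecewise (fun _ => H' 0) ((domT μ).domRestrict H) := by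
        ext t
        by_cases ht : t.1 = 0
        · rw [piecewise_eq_of_mem _ _ _ (show t ∈ {t : domT μ | t.1 = 0} from ht)]
          simp [ht]
        · rw [piecewise_eq_of_notMem _ _ _ (show t ∉ {t : domT μ | t.1 = 0} from ht)]
          exact hH t t.2 (pos_iff_ne_zero.2 ht)
      rw [h1]
      exact Measurable.piecewise (measurable_subtype_coe (measurableSet_singleton 0))
        measurable_const h.l1loc.1
    · refine ((h.l1loc.2 t ht).mono_set Ioc_subset_Icc_self).congr_fun (fun s hs => ?_)
        measurableSet_Ioc
      exact (hH s (mem_domT_of_le hs.2 ht) hs.1).symm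
  balance t ht := by
    rw [← h.balance t ht]
    congr 1
    refine setIntegral_congr_fun measurableSet_Ioc fun s hs => ?_
    exact hH s (mem_domT_of_le hs.2 (mem_domT_of_tail_pos ((lt_tG_iff μ t).1 ht))) hs.1
  caseB h1 h2 := by
    have h3 : ((tG μ).toNNReal : ℝ≥0∞) = tG μ := ENNReal.coe_toNNReal h1.ne
    rw [hH]
    · exact h.caseB h1 h2
    · refine mem_domT.2 (h2.trans_le (measure_mono ?_))
      rw [h3]
      exact singleton_subset_iff.2 self_mem_Ici
    · have := (lt_tG_iff μ 0).2 (by simpa using hμ)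
      rw [← ENNReal.coe_pos, h3]
      simpa using this

lemma measurable_indicator_of_domRestrict {s : Set ℝ≥0} (hs : MeasurableSet s) {H : ℝ≥0 → ℝ}
    (hH : Measurable (s.domRestrict H)) : Measurable (s.indicator H) := by
  refine measurable_of_restrict_of_restrict_compl hs ?_ ?_
  · convert hH using 1
    ext t
    simp
  · convert measurable_const (a := (0 : ℝ)) using 1
    ext t
    simp [indicator_of_notMem t.2]

/-! ### Conditions `E[|X| | γ] < ∞` and `E[X | γ] = 0` -/

section Law

variable {Ω : Type*} [mΩ : MeasurableSpace Ω] {P : Measure Ω} {γ : Ω → ℝ≥0∞}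

lemma ae_tail_pos (hγ : Measurable γ) (T : ℝ≥0) :
    ∀ᵐ ω ∂P, (T : ℝ≥0∞) < γ ω → 0 < P.map γ (Ioi (T : ℝ≥0∞)) := by
  by_cases h : 0 < P.map γ (Ioi (T : ℝ≥0∞))
  · exact Eventually.of_forall fun _ _ => h
  · have h0 : P (γ ⁻¹' Ioi (T : ℝ≥0∞)) = 0 := by
      rw [← Measure.map_apply hγ measurableSet_Ioi]
      exact not_not.1 fun hc => h (pos_iff_ne_zero.2 hc)
    filter_upwards [measure_eq_zero_iff_ae_notMem.1 h0] with ω hω hT using absurd hT hω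

variable [IsProbabilityMeasure P]

/-- The conditional expectation of `|X|` is a function `q` of `γ`, and `X` is integrable where `q ≤
n`. The set `{q = ∞}` is charged with probability zero and is added only so that the sets exhaust
`[0,∞]` exactly. -/
lemma exists_sets_of_genCondExp_comap (hγ : Measurable γ) {X : Ω → ℝ} (hX : Measurable X)
    (h1 : CondIntegrable (MeasurableSpace.comap γ inferInstance) P X)
    (h2 : genCondExp (MeasurableSpace.comap γ inferInstance) P X =ᵐ[P] 0) :
    ∃ E : ℕ → Set ℝ≥0∞, Monotone E ∧ (∀ n, MeasurableSet (E n)) ∧ (⋃ n, E n) = univ ∧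
      ∀ n, IntegrableOn X (γ ⁻¹' E n) P ∧
        ∀ A, MeasurableSet A → A ⊆ E n → ∫ ω in γ ⁻¹' A, X ω ∂P = 0 := by
  have hm := hγ.comap_le
  obtain ⟨q, hq, hqγ⟩ := (measurable_condLExp (MeasurableSpace.comap γ inferInstance) P
    fun ω => ENNReal.ofReal |X ω|).exists_eq_measurable_comp
  have hE : ∀ n : ℕ, IntegrableOn X (γ ⁻¹' {y | q y ≤ n ∨ q y = ∞}) P := fun n => by
    refine integrableOn_of_condLExp_le hm hX (D := γ ⁻¹' {y | q y ≤ n ∨ q y = ∞})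
      ⟨_, (hq measurableSet_Iic).union (hq (measurableSet_singleton _)), rfl⟩
      (ENNReal.natCast_ne_top n) ?_
    filter_upwards [h1] with ω hω hωn
    rw [hqγ] at hω ⊢
    exact hωn.resolve_right hω.ne
  refine ⟨fun n => {y | q y ≤ n ∨ q y = ∞}, fun n k hnk y hy =>
    hy.imp_left fun h => h.trans (by exact_mod_cast hnk),
    fun n => (hq measurableSet_Iic).union (hq (measurableSet_singleton _)),
    eq_univ_of_forall fun y => mem_iUnion.2 ?_, fun n => ⟨hE n, fun A hA hAn => ?_⟩⟩
  · by_cases hy : q y = ∞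
    · exact ⟨0, Or.inr hy⟩
    · obtain ⟨n, hn⟩ := ENNReal.exists_nat_gt hy
      exact ⟨n, Or.inl hn.le⟩
  · exact setIntegral_eq_zero_of_genCondExp hm ⟨A, hA, rfl⟩
      ((hE n).mono_set (preimage_mono hAn)) h2

lemma genCondExp_comap_of_sets (hγ : Measurable γ) {X : Ω → ℝ} {E : ℕ → Set ℝ≥0∞}
    (hE : ∀ n, MeasurableSet (E n)) (hcov : ∀ᵐ ω ∂P, ∃ n, γ ω ∈ E n)
    (h : ∀ n, IntegrableOn X (γ ⁻¹' E n) P ∧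
      ∀ A, MeasurableSet A → A ⊆ E n → ∫ ω in γ ⁻¹' A, X ω ∂P = 0) :
    CondIntegrable (MeasurableSpace.comap γ inferInstance) P X ∧
      genCondExp (MeasurableSpace.comap γ inferInstance) P X =ᵐ[P] 0 := by
  have hD : ∀ n, MeasurableSet[MeasurableSpace.comap γ inferInstance] (γ ⁻¹' E n) :=
    fun n => ⟨_, hE n, rfl⟩
  refine ⟨condIntegrable_of_cover hγ.comap_le hD hcov fun n => (h n).1,
    genCondExp_ae_eq_zero_of_cover hγ.comap_le hD hcov (fun n => (h n).1) ?_⟩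
  rintro n _ ⟨A, hA, rfl⟩ hAn
  have h3 : γ ⁻¹' A = γ ⁻¹' (A ∩ E n) := by
    rw [preimage_inter, inter_eq_left.2 hAn]
  rw [h3]
  exact (h n).2 _ (hA.inter (hE n)) inter_subset_right

/-- The measure equation supplies the compensation identity for `H(γ)`, and `L'` contributes nothing
as its integrals over `γ`-sets inside `B` vanish. It serves both the `σ`-martingale construction
(varying `B`, starting at `0`) and the local martingale one (`B = [0,T]`, starting at `M 0`). -/
lemma ConditionM.exists_isUIMartingale (hγ : Measurable γ) {F H : ℝ≥0 → ℝ}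
    (h : ConditionM (P.map γ) F H) (hH : Measurable H) {T : ℝ≥0} (hT : T ∈ domT (P.map γ)) :
    ∃ ν : SignedMeasure ℝ≥0,
      (∀ s ≤ T, 0 < P.map γ (Ioi (s : ℝ≥0∞)) → F s = F 0 + ν (Ioc 0 s)) ∧
      ∀ B ⊆ Iic T, MeasurableSet B → ∀ L' : Ω → ℝ, Measurable L' →
        IntegrableOn L' (γ ⁻¹' ((↑) '' (B ∩ Ioi 0))) P →
        (∀ C ⊆ B ∩ Ioi 0, MeasurableSet C → ∫ ω in γ ⁻¹' ((↑) '' C), L' ω ∂P = 0) →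
        ∀ X₀ : Ω → ℝ, Measurable X₀ → Integrable X₀ P → ∀ b, (∀ ω, 0 < γ ω → X₀ ω = b) →
        IsUIMartingale (filtration γ) P fun t ω =>
          X₀ ω + restrictedPath ν B (F 0) (γ ω) (H (γ ω).toNNReal + L' ω) t := by
  have := Measure.isProbabilityMeasure_map (μ := P) hγ.aemeasurable
  have := isFiniteMeasure_dG (P.map γ)
  obtain ⟨ν, h1, h2, h3⟩ := h.exists_signedMeasure hT
  refine ⟨ν, h1, fun B hBT hB L' hL hLi hL0 X₀ hX₀ hX₀i b hb => ?_⟩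
  have hBI : B ∩ Ioi 0 ⊆ Ioc 0 T := fun s hs => ⟨hs.2, hBT hs.1⟩
  have hHγ : Measurable fun ω => H (γ ω).toNNReal := hH.comp (ENNReal.measurable_toNNReal.comp hγ)
  have hwm : Measurable fun s => F 0 + ν (Ioo 0 s) - H s :=
    ((measurable_signedMeasure_Ioo ν).const_add _).sub hH
  refine isUIMartingale_restrictedPath hγ ν hB (hHγ.add hL) hX₀ hX₀i hb (Integrable.add ?_ hLi)
    fun t => ?_
  · rw [← IntegrableOn, ← integrableOn_dG_map hγ hH (hB.inter measurableSet_Ioi)]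
    exact (h.l1loc.2 T hT).mono_set (hBI.trans Ioc_subset_Icc_self)
  · have hC : MeasurableSet (B ∩ Ioc 0 t) := hB.inter measurableSet_Ioc
    have hCB : B ∩ Ioc 0 t ⊆ B ∩ Ioi 0 := inter_subset_inter_right _ Ioc_subset_Ioi_self
    have hwi : IntegrableOn (fun ω => F 0 + ν (Ioo 0 (γ ω).toNNReal) - H (γ ω).toNNReal)
        (γ ⁻¹' ((↑) '' (B ∩ Ioc 0 t))) P :=
      (integrableOn_dG_map hγ hwm hC).1 (h2.mono_set (hCB.trans hBI))
    rw [h3 _ hC (hCB.trans hBI), setIntegral_dG_map hγ hwm hC]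
    simp only [Pi.add_apply, ← sub_sub]
    rw [integral_sub hwi (hLi.mono_set (preimage_mono (image_mono hCB))), hL0 _ hCB hC, sub_zero]

lemma isLocalMartingale_zero : IsLocalMartingale (filtration γ) P fun _ _ => 0 := by
  have h0 : IsUIMartingale (filtration γ) P fun _ _ => 0 :=
    isUIMartingale_of_integral_eq (f := 0) (Z := 0) (fun _ => measurable_const)
      (fun _ _ _ => rfl) (fun _ _ _ _ _ => rfl) (fun _ => rfl) (integrable_zero _ _ _)
      (fun _ _ => by simp) fun _ => isCadlag_const 0
  exact ⟨h0.1.1, h0.2.2, fun _ _ => ⊤, isLocalizingSequence_const_top _ _, fun _ => h0⟩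

lemma Represents.isSigmaMartingale (hγ : Measurable γ) {M : ℝ≥0 → Ω → ℝ}
    (hM : StronglyAdapted (filtration γ) M)
    (hMrc : ∀ᵐ ω ∂P, ∀ t, ContinuousWithinAt (fun s => M s ω) (Ici t) t)
    {F H : ℝ≥0 → ℝ} {L' : Ω → ℝ} (hFH : ConditionM (P.map γ) F H) (hH : Measurable H)
    (hL : Measurable L')
    (hL1 : CondIntegrable (MeasurableSpace.comap γ inferInstance) P ({ω | 0 < γ ω}.indicator L'))
    (hL2 : genCondExp (MeasurableSpace.comap γ inferInstance) P
      ({ω | 0 < γ ω}.indicator L') =ᵐ[P] 0) (hr : Represents P γ F H L' M) :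
    IsSigmaMartingale (filtration γ) P M := by
  have := Measure.isProbabilityMeasure_map (μ := P) hγ.aemeasurable
  have hpos : MeasurableSet {ω | 0 < γ ω} := measurableSet_lt measurable_const hγ
  have hbv : ∀ᵐ ω ∂P, LocallyBoundedVariationOn (fun t => M t ω) univ := by
    filter_upwards [hr, ae_le_imp_mem_domT hγ] with ω h1 h2
    refine locallyBoundedVariationOn_of_pre (x := γ ω) (c := H (γ ω).toNNReal + L' ω)
      (fun T hT => ?_) fun s hs => (h1 s).2 hs
    obtain ⟨ν, hν, -⟩ := hFH.exists_signedMeasure (h2 T hT)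
    refine ⟨fun s => F 0 + ν (Ioc 0 s), locallyBoundedVariationOn_signedMeasure_Ioc ν _,
      fun s hs => ?_⟩
    rw [(h1 s).1 (lt_of_lt_of_le (ENNReal.coe_lt_coe.2 hs) hT),
      hν s hs.le (tail_pos_of_lt (h2 T hT) hs)]
  -- `M` itself has finite variation, so the local martingale part of the decomposition can be zero.
  refine ⟨⟨fun _ _ => 0, M, isLocalMartingale_zero, ⟨hM, ?_⟩, fun t ω => (zero_add _).symm⟩, ?_⟩
  · filter_upwards [hbv, hMrc] with ω h1 h2
    exact ⟨isCadlag_of_locallyBoundedVariationOn h1 h2, h1⟩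
  obtain ⟨E, hEm, hE, hEu, hEL⟩ := exists_sets_of_genCondExp_comap hγ (hL.indicator hpos) hL1 hL2
  obtain ⟨u, hum, hu, hucov⟩ := exists_seq_domT (P.map γ)
  set B : ℕ → Set ℝ≥0 := fun n => Iic (u n) ∩ ((↑) ⁻¹' E n) with hB
  have hBm : ∀ n, MeasurableSet (B n) := fun n =>
    measurableSet_Iic.inter (measurable_coe_nnreal_ennreal (hE n))
  have hS : ∀ n, MeasurableSet (B n ∪ (domT (P.map γ))ᶜ) := fun n =>
    (hBm n).union (measurableSet_domT _).compl
  -- `B n` bounds time inside `𝒯` and keeps `γ` where `L'` is integrable. The complement of `𝒯`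
  -- makes the union everything; a.s. it contains no time up to `γ`, so it does not change the
  -- integrals.
  refine ⟨fun n => (B n ∪ (domT (P.map γ))ᶜ) ×ˢ univ,
    fun n => measurableSet_predictable_prod_univ (hS n), fun n k hnk => ?_, ?_, fun n => ?_⟩
  · refine prod_mono (union_subset_union_left _ ?_) subset_rfl
    exact inter_subset_inter (Iic_subset_Iic.2 (hum hnk)) (preimage_mono (hEm hnk))
  · refine eq_univ_of_forall fun p => mem_iUnion.2 ?_
    by_cases hp : p.1 ∈ domT (P.map γ)
    · obtain ⟨n, hn⟩ := hucov _ hp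
      obtain ⟨k, hk⟩ := mem_iUnion.1 (hEu ▸ mem_univ (p.1 : ℝ≥0∞))
      exact ⟨max n k, Or.inl ⟨hn.trans (hum (le_max_left _ _)), hEm (le_max_right _ _) hk⟩,
        mem_univ _⟩
    · exact ⟨0, Or.inr hp, mem_univ _⟩
  · obtain ⟨ν, hν, hY⟩ := hFH.exists_isUIMartingale hγ hH (hu n)
    have hsub : ((↑) : ℝ≥0 → ℝ≥0∞) '' (B n ∩ Ioi 0) ⊆ E n ∩ Ioi 0 := by
      rintro _ ⟨s, hs, rfl⟩
      exact ⟨hs.1.2, ENNReal.coe_pos.2 hs.2⟩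
    have hind : ∀ C ⊆ E n ∩ Ioi 0,
        EqOn ({ω | 0 < γ ω}.indicator L') L' (γ ⁻¹' C) := fun C hC ω hω =>
      indicator_of_mem (show ω ∈ {ω | 0 < γ ω} from (hC hω).2) _
    have hD := measurableSet_image_coe ((hBm n).inter (measurableSet_Ioi (a := 0)))
    refine ⟨_, hY (B n) inter_subset_left (hBm n) L' hL ?_ ?_ (fun _ => 0) measurable_const
      (integrable_zero _ _ _) 0 fun _ _ => rfl, ?_⟩
    · refine IntegrableOn.congr_fun ((hEL n).1.mono_set (preimage_mono ?_)) (hind _ hsub)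
        (hγ hD)
      exact hsub.trans inter_subset_left
    · intro C hC hCm
      have hCE := (image_mono hC).trans hsub
      have hC' := measurableSet_image_coe hCm
      rw [← setIntegral_congr_fun (hγ hC') (hind _ hCE)]
      exact (hEL n).2 _ hC' (hCE.trans inter_subset_left)
    · filter_upwards [hbv, hMrc, hr, ae_le_imp_mem_domT hγ, ae_tail_pos hγ (u n)]
        with ω h1 h2 h3 h4 h5 t
      have key := lsIntegral_eq_restrictedPath h1 h2 (x := γ ω) (c := H (γ ω).toNNReal + L' ω)
        (fun s hs => (h3 s).2 hs) (ν := ν) (T := u n) (fun s hs hsx => ?_) (hBm n)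
        inter_subset_left (hS n) (fun s _ hsx => ?_) t
      · simp only [mem_prod, mem_univ, and_true]
        refine Eq.trans ?_ key.symm
        rw [zero_add]
        rcases eq_or_ne (γ ω) 0 with h0 | h0
        · rw [h0, restrictedPath_jump_zero, restrictedPath_jump_zero]
        · rw [(h3 0).1 (pos_iff_ne_zero.2 h0)]
      · rw [(h3 s).1 hsx, (h3 0).1 (zero_le.trans_lt hsx), hν s hs]
        rcases hs.eq_or_lt with rfl | hs
        · exact h5 hsx
        · exact tail_pos_of_lt (hu n) hs
      · exact ⟨fun h => h.resolve_right fun h' => h' (h4 s hsx), Or.inl⟩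

end Law

/-! ### The structure of `σ`-martingales -/

section Structure

variable {Ω : Type*} [mΩ : MeasurableSpace Ω] {P : Measure Ω} {γ : Ω → ℝ≥0∞}
  {M : ℝ≥0 → Ω → ℝ}

/-- On `{γ < ∞}` the sequence `M n` is eventually constant; taking its limit, rather than evaluating
`M` at the random time `γ`, gives measurability of the terminal value. -/
lemma exists_terminal_of_const_after (hγ : Measurable γ) (hM : ∀ t, Measurable (M t))
    (h : ∀ᵐ ω ∂P, ∀ s t : ℝ≥0, γ ω ≤ s → γ ω ≤ t → M s ω = M t ω) :
    ∃ ξ : Ω → ℝ, Measurable ξ ∧ ∀ᵐ ω ∂P, ∀ t : ℝ≥0, γ ω ≤ t → M t ω = ξ ω := by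
  have hlim : ∀ᵐ ω ∂P, ∃ l : ℝ,
      Tendsto (fun n : ℕ => {ω | γ ω < ∞}.indicator (M n) ω) atTop (𝓝 l) ∧
        ∀ t : ℝ≥0, γ ω ≤ t → M t ω = l := by
    filter_upwards [h] with ω hω
    rcases eq_or_ne (γ ω) ∞ with ht | ht
    · refine ⟨0, tendsto_const_nhds.congr fun n => (indicator_of_notMem ?_ _).symm, fun t h => ?_⟩
      · simp [ht]
      · exact absurd (ht ▸ h) (not_le.2 ENNReal.coe_lt_top)
    · have hx : ((γ ω).toNNReal : ℝ≥0∞) = γ ω := ENNReal.coe_toNNReal ht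
      refine ⟨M (γ ω).toNNReal ω, tendsto_const_nhds.congr' ?_, fun t h => hω _ _ h hx.ge⟩
      obtain ⟨n, hn⟩ := exists_nat_ge (γ ω).toNNReal
      filter_upwards [eventually_ge_atTop n] with k hk
      rw [indicator_of_mem (show ω ∈ {ω | γ ω < ∞} from ht.lt_top)]
      refine hω _ _ hx.ge (hx.ge.trans (ENNReal.coe_le_coe.2 (hn.trans ?_)))
      exact_mod_cast hk
  obtain ⟨ξ, hξ, hξl⟩ := measurable_limit_of_tendsto_metrizable_ae (L := atTop)
    (f := fun n : ℕ => {ω | γ ω < ∞}.indicator (M n)) (μ := P)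
    (fun n => ((hM n).indicator (measurableSet_lt hγ measurable_const)).aemeasurable)
    (hlim.mono fun ω ⟨l, hl⟩ => ⟨l, hl.1⟩)
  refine ⟨ξ, hξ, ?_⟩
  filter_upwards [hlim, hξl] with ω ⟨l, h1, h2⟩ h3 t ht
  rw [h2 t ht, tendsto_nhds_unique h1 h3]

/-- A single regular path that jumps late enough already displays `F`. If the tail at `T` is
positive the path must jump strictly after `T`, so that `F T` is displayed as well. -/
lemma exists_signedMeasure_of_ae_locallyBoundedVariationOn (hγ : Measurable γ)
    (hbv : ∀ᵐ ω ∂P, LocallyBoundedVariationOn (fun t => M t ω) univ)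
    (hMrc : ∀ᵐ ω ∂P, ∀ t, ContinuousWithinAt (fun s => M s ω) (Ici t) t) {F : ℝ≥0 → ℝ}
    (hF : ∀ (t : ℝ≥0) ω, (t : ℝ≥0∞) < γ ω → M t ω = F t) {T : ℝ≥0} (hT : T ∈ domT (P.map γ)) :
    ∃ ν : SignedMeasure ℝ≥0,
      ∀ s ≤ T, 0 < P.map γ (Ioi (s : ℝ≥0∞)) → F s = F 0 + ν (Ioc 0 s) := by
  have hfreq : ∃ᵐ ω ∂P, (T : ℝ≥0∞) ≤ γ ω ∧ (0 < P.map γ (Ioi (T : ℝ≥0∞)) → T < γ ω) := by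
    by_cases h : 0 < P.map γ (Ioi (T : ℝ≥0∞))
    · have h' := h
      rw [Measure.map_apply hγ measurableSet_Ioi] at h'
      exact (frequently_ae_iff.2 h'.ne').mono fun ω hω => ⟨le_of_lt hω, fun _ => hω⟩
    · have h' := mem_domT.1 hT
      rw [Measure.map_apply hγ measurableSet_Ici] at h'
      exact (frequently_ae_iff.2 h'.ne').mono fun ω hω => ⟨hω, fun hc => absurd hc h⟩
  obtain ⟨ω, ⟨hω, hω'⟩, h1, h2⟩ := (hfreq.and_eventually (hbv.and hMrc)).exists
  obtain ⟨κ, hκ, -⟩ := exists_signedMeasure_lsIntegral h1 h2 T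
  refine ⟨κ, fun s hs hs' => ?_⟩
  have hsγ : (s : ℝ≥0∞) < γ ω := by
    rcases hs.eq_or_lt with rfl | hs
    · exact hω' hs'
    · exact lt_of_lt_of_le (ENNReal.coe_lt_coe.2 hs) hω
  rw [hκ 0 s zero_le, min_eq_left hs, min_eq_left zero_le, hF s ω hsγ,
    hF 0 ω (lt_of_le_of_lt (ENNReal.coe_le_coe.2 zero_le) hsγ)]
  ring

variable [IsProbabilityMeasure P]

lemma IsSigmaMartingale.ae_const_after (hσ : IsSigmaMartingale (filtration γ) P M)
    (hγ : Measurable γ)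
    (hMrc : ∀ᵐ ω ∂P, ∀ t, ContinuousWithinAt (fun s => M s ω) (Ici t) t) :
    ∀ᵐ ω ∂P, ∀ s t : ℝ≥0, γ ω ≤ s → γ ω ≤ t → M s ω = M t ω := by
  obtain ⟨hsm, S, hS, hSm, hSu, hY⟩ := hσ
  choose Y hYm hYS using hY
  filter_upwards [hsm.ae_locallyBoundedVariationOn hγ, hMrc,
    ae_all_iff.2 fun n => (hYm n).ae_const_after hγ, ae_all_iff.2 hYS] with ω h1 h2 h3 h4
  have key : ∀ s t : ℝ≥0, γ ω ≤ s → s ≤ t → M t ω = M s ω := fun s t hs hst => by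
    refine eq_of_lsIntegral_eq h1 h2 (S := fun n => {r | (r, ω) ∈ S n})
      (fun n => measurable_prodMk_right (measurableSet_of_predictable (hS n)))
      (fun n k hnk r hr => hSm hnk hr) (eq_univ_of_forall fun r => ?_) hst fun n => ?_
    · obtain ⟨n, hn⟩ := mem_iUnion.1 (hSu ▸ mem_univ (r, ω))
      exact mem_iUnion.2 ⟨n, hn⟩
    · rw [← h4 n t, ← h4 n s]
      exact h3 n t s (hs.trans (ENNReal.coe_le_coe.2 hst)) hs
  intro s t hs ht
  rcases le_total s t with hst | hst
  · exact (key s t hs hst).symm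
  · exact key t s ht hst

/-- The contributions of `ν` are bounded, so integrability of the path at time `t` is passed on to
`ξ` over the jumps in `B ∩ (0,t]`. -/
lemma integral_restrictedPath_eq (hγ : Measurable γ) (ν : SignedMeasure ℝ≥0) {B : Set ℝ≥0}
    (hB : MeasurableSet B) (a : ℝ) (ξ : Ω → ℝ) (t : ℝ≥0)
    (hint : Integrable (fun ω => restrictedPath ν B a (γ ω) (ξ ω) t) P) :
    IntegrableOn ξ (γ ⁻¹' ((↑) '' (B ∩ Ioc 0 t))) P ∧
      ∫ ω, restrictedPath ν B a (γ ω) (ξ ω) t ∂P = avg (P.map γ) ν (B ∩ Ioc 0 t) -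
        ∫ ω in γ ⁻¹' ((↑) '' (B ∩ Ioc 0 t)), (a + ν (Ioo 0 (γ ω).toNNReal) - ξ ω) ∂P := by
  set J : Set Ω := γ ⁻¹' ((↑) '' (B ∩ Ioc 0 t)) with hJ
  set w : Ω → ℝ := fun ω => a + ν (Ioo 0 (γ ω).toNNReal) - ξ ω with hw
  set V := ν.totalVariation.real univ
  have hC := hB.inter (measurableSet_Ioc (a := (0 : ℝ≥0)) (b := t))
  have hJm : MeasurableSet J := hγ (measurableSet_image_coe hC)
  have hνm : Measurable fun ω => ν (Ioo 0 (γ ω).toNNReal) :=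
    (measurable_signedMeasure_Ioo ν).comp (ENNReal.measurable_toNNReal.comp hγ)
  have hpi : Integrable (fun ω => ν (B ∩ Ioc 0 t ∩ pre (γ ω))) P :=
    Integrable.of_bound ((measurable_signedMeasure_inter_pre ν hC).comp hγ).aestronglyMeasurable V
      (Eventually.of_forall fun _ => abs_signedMeasure_le ν _)
  have hpath : ∀ ω, restrictedPath ν B a (γ ω) (ξ ω) t =
      ν (B ∩ Ioc 0 t ∩ pre (γ ω)) - J.indicator w ω := fun ω => by
    rw [restrictedPath, ← image_coe_inter_Ioc, sub_eq_add_neg]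
    congr 1
    by_cases h : γ ω ∈ ((↑) : ℝ≥0 → ℝ≥0∞) '' (B ∩ Ioc 0 t)
    · rw [indicator_of_mem h, indicator_of_mem (show ω ∈ J from h), hw]
      ring
    · rw [indicator_of_notMem h, indicator_of_notMem (show ω ∉ J from h), neg_zero]
  have hwi : Integrable (J.indicator w) P := by
    refine (hpi.sub hint).congr (Eventually.of_forall fun ω => ?_)
    simp only [Pi.sub_apply, hpath]
    ring
  refine ⟨?_, ?_⟩
  · have h1 : IntegrableOn (fun ω => a + ν (Ioo 0 (γ ω).toNNReal)) J P :=
      Integrable.of_bound (hνm.const_add a).aestronglyMeasurable (|a| + V)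
        (Eventually.of_forall fun ω => (abs_add_le _ _).trans
          (add_le_add_right (abs_signedMeasure_le ν _) _))
    refine (h1.sub ((integrable_indicator_iff hJm).1 hwi)).congr
      (Eventually.of_forall fun ω => ?_)
    simp only [hw, Pi.sub_apply]
    ring
  · simp_rw [hpath]
    rw [integral_sub hpi hwi, integral_indicator hJm, avg_map_apply hγ ν hC]

theorem IsSigmaMartingale.exists_represents (hσ : IsSigmaMartingale (filtration γ) P M)
    (hγ : Measurable γ) (hM : StronglyAdapted (filtration γ) M)
    (hMrc : ∀ᵐ ω ∂P, ∀ t, ContinuousWithinAt (fun s => M s ω) (Ici t) t) :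
    ∃ (F H : ℝ≥0 → ℝ) (L' : Ω → ℝ), ConditionM (P.map γ) F H ∧ Measurable L' ∧
      CondIntegrable (MeasurableSpace.comap γ inferInstance) P ({ω | 0 < γ ω}.indicator L') ∧
      genCondExp (MeasurableSpace.comap γ inferInstance) P
        ({ω | 0 < γ ω}.indicator L') =ᵐ[P] 0 ∧
      Represents P γ F H L' M := by
  have := Measure.isProbabilityMeasure_map (μ := P) hγ.aemeasurable
  have hMm : ∀ t, Measurable (M t) := fun t => ((hM t).mono ((filtration γ).le t)).measurable
  obtain ⟨F, hF⟩ := exists_pre_of_stronglyAdapted hM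
  obtain ⟨ξ, hξ, hMξ⟩ := exists_terminal_of_const_after hγ hMm (hσ.ae_const_after hγ hMrc)
  obtain ⟨hsm, S, hS, hSm, hSu, hY⟩ := hσ
  have hbv := hsm.ae_locallyBoundedVariationOn hγ
  choose Y hYm hYS using hY
  choose B₀ hB₀ hB₀S using fun n => exists_of_predictable (hS n)
  -- The sets `B₀ n` are determined only at times that some outcome reaches before or at its jump;
  -- elsewhere they need not increase. Unions restore monotonicity without affecting the traces on
  -- `(0,γ]`.
  set B : ℕ → Set ℝ≥0 := fun n => ⋃ k ≤ n, B₀ k with hB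
  have hBmeas : ∀ n, MeasurableSet (B n) := fun n =>
    MeasurableSet.biUnion (to_countable _) fun k _ => hB₀ k
  have hBmono : Monotone B := fun n k hnk => biUnion_subset_biUnion_left fun i hi => le_trans hi hnk
  have hBS : ∀ n (t : ℝ≥0) ω, 0 < t → (t : ℝ≥0∞) ≤ γ ω → ((t, ω) ∈ S n ↔ t ∈ B n) := by
    intro n t ω ht htω
    simp only [hB, mem_iUnion, exists_prop]
    constructor
    · exact fun h => ⟨n, le_rfl, (hB₀S n t ω ht htω).1 h⟩
    · rintro ⟨k, hk, h⟩
      exact hSm hk ((hB₀S k t ω ht htω).2 h)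
  have hBcov : ∀ s ∈ domT (P.map γ), 0 < s → ∃ n, s ∈ B n := fun s hs hs0 => by
    have h := mem_domT.1 hs
    rw [Measure.map_apply hγ measurableSet_Ici] at h
    obtain ⟨ω, hω⟩ := nonempty_of_measure_ne_zero h.ne'
    obtain ⟨n, hn⟩ := mem_iUnion.1 (hSu ▸ mem_univ (s, ω))
    exact ⟨n, (hBS n s ω hs0 hω).1 hn⟩
  have hT : ∀ T ∈ domT (P.map γ), ∃ ν : SignedMeasure ℝ≥0,
      (∀ s ≤ T, 0 < P.map γ (Ioi (s : ℝ≥0∞)) → F s = F 0 + ν (Ioc 0 s)) ∧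
      ∀ n, ∀ t ≤ T, IntegrableOn ξ (γ ⁻¹' ((↑) '' (B n ∩ Ioc 0 t))) P ∧
        avg (P.map γ) ν (B n ∩ Ioc 0 t) =
          ∫ ω in γ ⁻¹' ((↑) '' (B n ∩ Ioc 0 t)), (F 0 + ν (Ioo 0 (γ ω).toNNReal) - ξ ω) ∂P := by
    intro T hT
    obtain ⟨ν, hν⟩ := exists_signedMeasure_of_ae_locallyBoundedVariationOn hγ hbv hMrc hF hT
    refine ⟨ν, hν, fun n t ht => ?_⟩
    have hpath : ∀ s ≤ T,
        Y n s =ᵐ[P] fun ω => restrictedPath ν (B n ∩ Iic T) (F 0) (γ ω) (ξ ω) s := by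
      intro s hs
      filter_upwards [hbv, hMrc, hMξ, ae_tail_pos hγ T, hYS n] with ω h1 h2 h3 h4 h5
      -- Cutting at `T` is necessary since `ν` describes `F` only up to `T`; integrals up to `s ≤ T`
      -- do not notice it.
      have key := lsIntegral_eq_restrictedPath (S := {r | (r, ω) ∈ S n} ∩ Iic T) h1 h2 (x := γ ω)
        (c := ξ ω) h3 (ν := ν) (T := T) (fun r hr hrx => ?_) ((hBmeas n).inter measurableSet_Iic)
        inter_subset_right ((measurable_prodMk_right (measurableSet_of_predictable (hS n))).inter
          measurableSet_Iic) (fun r hr hrx => and_congr_left' (hBS n r ω hr hrx)) s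
      · have hcut : {r | (r, ω) ∈ S n} ∩ Iic T ∩ Ioc 0 s = {r | (r, ω) ∈ S n} ∩ Ioc 0 s := by
          rw [inter_assoc, inter_eq_right.2 (Ioc_subset_Iic_self.trans (Iic_subset_Iic.2 hs))]
        rw [h5 s]
        have h6 : lsIntegral {r | (r, ω) ∈ S n} (fun s => M s ω) s =
            lsIntegral ({r | (r, ω) ∈ S n} ∩ Iic T) (fun s => M s ω) s := by
          simp only [lsIntegral, hcut]
        rw [h6, key]
        rcases eq_or_ne (γ ω) 0 with h0 | h0
        · rw [h0, restrictedPath_jump_zero, restrictedPath_jump_zero]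
        · rw [hF 0 ω (pos_iff_ne_zero.2 h0)]
      · rw [hF r ω hrx, hF 0 ω (zero_le.trans_lt hrx), hν r hr]
        rcases hr.eq_or_lt with rfl | hr
        · exact h4 hrx
        · exact tail_pos_of_lt hT hr
    have hcut : B n ∩ Iic T ∩ Ioc 0 t = B n ∩ Ioc 0 t := by
      rw [inter_assoc, inter_eq_right.2 (Ioc_subset_Iic_self.trans (Iic_subset_Iic.2 ht))]
    have h1 := integral_restrictedPath_eq hγ ν ((hBmeas n).inter measurableSet_Iic) (F 0) ξ t
      (((hYm n).1.integrable t).congr (hpath t ht))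
    rw [hcut, ← integral_congr_ae (hpath t ht)] at h1
    refine ⟨h1.1, ?_⟩
    -- The integral process starts at `0`, so its constant expectation is `0`.
    have h2 : ∫ ω, Y n t ω ∂P = 0 := by
      have h3 := (hYm n).1.setIntegral_eq (zero_le (a := t)) MeasurableSet.univ
      rw [setIntegral_univ, setIntegral_univ, integral_congr_ae (hpath 0 zero_le)] at h3
      simpa [restrictedPath_at_zero] using h3.symm
    linarith [h1.2]
  set fin : Set Ω := {ω | 0 < γ ω ∧ γ ω ≠ ∞} with hfin
  have hfinm : MeasurableSet fin :=
    (measurableSet_lt measurable_const hγ).inter (hγ (measurableSet_singleton ∞)).compl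
  obtain ⟨h, hh, hhγ⟩ := (measurable_genCondExp (m := MeasurableSpace.comap γ inferInstance) P
    (fin.indicator ξ)).exists_eq_measurable_comp
  have hhγ' : ∀ ω, genCondExp (MeasurableSpace.comap γ inferInstance) P (fin.indicator ξ) ω =
    h (γ ω) := fun ω => congrFun hhγ ω
  set H : ℝ≥0 → ℝ := fun s => h s with hH
  have hHm : Measurable H := hh.comp measurable_coe_nnreal_ennreal
  -- On `{γ = ∞}` the representation never uses `L'`, so it is put equal to `0` there. On `{γ = 0}`
  -- it is whatever makes the representation exact; the conditions on `L'` ignore that event.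
  set L' : Ω → ℝ := fin.indicator (fun ω => ξ ω - h (γ ω)) + {ω | γ ω = 0}.indicator
    (fun ω => ξ ω - h (γ ω)) with hL'
  have hLm : Measurable L' := ((hξ.sub (hh.comp hγ)).indicator hfinm).add
    ((hξ.sub (hh.comp hγ)).indicator (hγ (measurableSet_singleton 0)))
  have hfinC : ∀ C ⊆ Ioi (0 : ℝ≥0), γ ⁻¹' ((↑) '' C) ⊆ fin := by
    rintro C hC ω ⟨s, hs, hsω⟩
    refine ⟨?_, ?_⟩ <;> rw [← hsω]
    · exact ENNReal.coe_pos.2 (hC hs)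
    · exact ENNReal.coe_ne_top
  have hcond : ∀ n T, T ∈ domT (P.map γ) → ∀ C ⊆ B n ∩ Ioc 0 T, MeasurableSet C →
      IntegrableOn ξ (γ ⁻¹' ((↑) '' C)) P ∧
      IntegrableOn (fun ω => h (γ ω)) (γ ⁻¹' ((↑) '' C)) P ∧
      ∫ ω in γ ⁻¹' ((↑) '' C), h (γ ω) ∂P = ∫ ω in γ ⁻¹' ((↑) '' C), ξ ω ∂P := by
    intro n T hTd C hC hCm
    obtain ⟨ν, -, h1⟩ := hT T hTd
    have hCi := measurableSet_image_coe hCm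
    have hfin' := hfinC C fun s hs => (hC hs).2.1
    have hξi : IntegrableOn ξ (γ ⁻¹' ((↑) '' C)) P :=
      (h1 n T le_rfl).1.mono_set (preimage_mono (image_mono hC))
    have heq : EqOn ξ (fin.indicator ξ) (γ ⁻¹' ((↑) '' C)) := fun ω hω =>
      (indicator_of_mem (hfin' hω) _).symm
    have hηi := hξi.congr_fun heq (hγ hCi)
    have hD : MeasurableSet[MeasurableSpace.comap γ inferInstance] (γ ⁻¹' ((↑) '' C)) :=
      ⟨_, hCi, rfl⟩
    have h2 := integrableOn_genCondExp hγ.comap_le hD hηi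
    have h3 := setIntegral_genCondExp hγ.comap_le hD hηi
    simp_rw [hhγ'] at h3
    refine ⟨hξi, ?_, ?_⟩
    · rwa [hhγ] at h2
    · rw [h3]
      exact setIntegral_congr_fun (hγ hCi) heq.symm
  refine ⟨F, H, L', ?_, hLm, ?_⟩
  · refine conditionM_of_avg _ hHm hBmeas hBmono hBcov fun T hTd => ?_
    obtain ⟨ν, hν, h1⟩ := hT T hTd
    have hνm : Measurable fun s => F 0 + ν (Ioo 0 s) :=
      (measurable_signedMeasure_Ioo ν).const_add _
    have hνi : ∀ D : Set Ω, IntegrableOn (fun ω => F 0 + ν (Ioo 0 (γ ω).toNNReal)) D P :=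
      fun D => Integrable.of_bound (hνm.comp (ENNReal.measurable_toNNReal.comp
        hγ)).aestronglyMeasurable (|F 0| + ν.totalVariation.real univ)
        (Eventually.of_forall fun ω => (abs_add_le _ _).trans
          (add_le_add_right (abs_signedMeasure_le ν _) _))
    have hwm : Measurable fun s => F 0 + ν (Ioo 0 s) - H s := hνm.sub hHm
    have hHγ : ∀ C : Set ℝ≥0,
        EqOn (fun ω => h (γ ω)) (fun ω => H (γ ω).toNNReal) (γ ⁻¹' ((↑) '' C)) := by
      rintro C ω ⟨s, -, hsω⟩
      simp only [hH, ← hsω, ENNReal.toNNReal_coe]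
    refine ⟨ν, hν, fun n => ⟨?_, fun t ht => ?_⟩⟩
    · have hC := (hBmeas n).inter (measurableSet_Ioc (a := (0 : ℝ≥0)) (b := T))
      obtain ⟨-, h2, -⟩ := hcond n T hTd _ subset_rfl hC
      refine (integrableOn_dG_map hγ hwm hC).2 ((hνi _).sub ?_)
      exact h2.congr_fun (hHγ _) (hγ (measurableSet_image_coe hC))
    · have hC := (hBmeas n).inter (measurableSet_Ioc (a := (0 : ℝ≥0)) (b := t))
      obtain ⟨h2, h3, h4⟩ := hcond n T hTd _ (inter_subset_inter_right _
        (Ioc_subset_Ioc_right ht)) hC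
      have h5 := h3.congr_fun (hHγ _) (hγ (measurableSet_image_coe hC))
      rw [(h1 n t ht).2, setIntegral_dG_map hγ hwm hC, integral_sub (hνi _) h2,
        integral_sub (hνi _) h5, ← h4,
        setIntegral_congr_fun (hγ (measurableSet_image_coe hC)) (hHγ _)]
  rw [← and_assoc]
  refine ⟨?_, ?_⟩
  · have hind : {ω | 0 < γ ω}.indicator L' = fin.indicator (fun ω => ξ ω - h (γ ω)) := by
      ext ω
      by_cases h0 : γ ω = 0
      · simp [hfin, h0]
      · simp [hL', h0, pos_iff_ne_zero.2 h0]
    rw [hind]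
    obtain ⟨u, hum, hu, hucov⟩ := exists_seq_domT (P.map γ)
    -- The first set collects the values of `γ` where the variable to be centred is zero; the others
    -- exhaust `𝒯 ∩ (0,∞)` by sets on which `ξ` is integrable.
    set K : ℕ → Set ℝ≥0∞ := fun n => Nat.casesOn n {0, ∞} fun n => (↑) '' (B n ∩ Ioc 0 (u n))
      with hK
    refine genCondExp_comap_of_sets hγ (E := K) (fun n => ?_) ?_ fun n => ?_
    · cases n with
      | zero => exact (measurableSet_singleton _).insert _
      | succ n => exact measurableSet_image_coe ((hBmeas n).inter measurableSet_Ioc)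
    · filter_upwards [ae_le_imp_mem_domT (P := P) hγ] with ω hω
      by_cases h0 : γ ω = 0
      · exact ⟨0, Or.inl h0⟩
      by_cases h1 : γ ω = ∞
      · exact ⟨0, Or.inr h1⟩
      obtain ⟨s, hs⟩ : ∃ s : ℝ≥0, (s : ℝ≥0∞) = γ ω := ⟨_, ENNReal.coe_toNNReal h1⟩
      have hsd := hω s hs.le
      have hs0 : 0 < s := by
        rw [← ENNReal.coe_pos, hs]
        exact pos_iff_ne_zero.2 h0
      obtain ⟨n, hn⟩ := hBcov s hsd hs0
      obtain ⟨k, hk⟩ := hucov s hsd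
      exact ⟨max n k + 1, s, ⟨hBmono (le_max_left _ _) hn, hs0, hk.trans (hum (le_max_right _ _))⟩,
        hs⟩
    · cases n with
      | zero =>
        have hz : ∀ A : Set ℝ≥0∞, A ⊆ {0, ∞} →
            EqOn (fun _ => 0) (fin.indicator fun ω => ξ ω - h (γ ω)) (γ ⁻¹' A) := by
          intro A hA ω hω
          rw [indicator_of_notMem]
          exact fun hf => (hA hω).elim hf.1.ne' hf.2
        refine ⟨integrableOn_zero.congr_fun (hz _ subset_rfl) (hγ ?_), fun A hA hAK => ?_⟩
        · exact (measurableSet_singleton _).insert _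
        · rw [← setIntegral_congr_fun (hγ hA) (hz A hAK)]
          simp
      | succ n =>
        have hz : ∀ C ⊆ B n ∩ Ioc 0 (u n), EqOn (fun ω => ξ ω - h (γ ω))
            (fin.indicator fun ω => ξ ω - h (γ ω)) (γ ⁻¹' ((↑) '' C)) := fun C hC ω hω =>
          (indicator_of_mem (hfinC C (fun s hs => (hC hs).2.1) hω) fun ω => ξ ω - h (γ ω)).symm
        have hC := (hBmeas n).inter (measurableSet_Ioc (a := (0 : ℝ≥0)) (b := u n))
        obtain ⟨h1, h2, -⟩ := hcond n _ (hu n) _ subset_rfl hC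
        refine ⟨(h1.sub h2).congr_fun (hz _ subset_rfl) (hγ (measurableSet_image_coe hC)),
          fun A hA hAK => ?_⟩
        obtain ⟨C, hCs, rfl⟩ := subset_image_iff.1 hAK
        have hCm : MeasurableSet C := measurableEmbedding_coe.measurableSet_image.1 hA
        obtain ⟨h1, h2, h3⟩ := hcond n _ (hu n) C hCs hCm
        rw [← setIntegral_congr_fun (hγ hA) (hz C hCs), integral_sub h1 h2, h3, sub_self]
  · filter_upwards [hMξ] with ω hω t
    refine ⟨hF t ω, fun ht => ?_⟩
    have hx : γ ω ≠ ∞ := ne_top_of_le_ne_top ENNReal.coe_ne_top ht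
    have hHx : H (γ ω).toNNReal = h (γ ω) := by simp only [hH, ENNReal.coe_toNNReal hx]
    rw [hω t ht, hHx]
    by_cases h0 : γ ω = 0
    · simp [hL', hfin, h0]
    · simp [hL', hfin, h0, hx, pos_iff_ne_zero]

end Structure

/-! ### Stopping before the jump -/

open scoped Classical in
/-- The time which is infinite if the jump occurs before `u`, and equal to `u` otherwise. -/
noncomputable def stopBefore (γ : Ω → ℝ≥0∞) (u : ℝ≥0) (ω : Ω) : WithTop ℝ≥0 :=
  if γ ω ≤ u then ⊤ else u

lemma stoppedProcess_stopBefore_of_le {Ω : Type*} {γ : Ω → ℝ≥0∞} {M : ℝ≥0 → Ω → ℝ}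
    {u t : ℝ≥0} {ω : Ω} (h : γ ω ≤ u) :
    stoppedProcess M (stopBefore γ u) t ω = M t ω :=
  stoppedProcess_eq_of_le (by rw [stopBefore, if_pos h]; exact le_top)

lemma stoppedProcess_stopBefore_of_lt {Ω : Type*} {γ : Ω → ℝ≥0∞} {M : ℝ≥0 → Ω → ℝ}
    {u t : ℝ≥0} {ω : Ω} (h : (u : ℝ≥0∞) < γ ω) :
    stoppedProcess M (stopBefore γ u) t ω = M (min t u) ω := by
  rw [stoppedProcess, stopBefore, if_neg h.not_ge, ← WithTop.coe_min]
  rfl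

/-! ### Changing the representation -/

lemma ConditionM.exists_measurable {μ : Measure ℝ≥0∞} [IsProbabilityMeasure μ] {F H : ℝ≥0 → ℝ}
    (h : ConditionM μ F H) (hμ : 0 < μ (Ioi 0)) :
    ∃ H', Measurable H' ∧ ConditionM μ F H' ∧ ∀ t ∈ domT μ, H' t = H t :=
  ⟨(domT μ).indicator H, measurable_indicator_of_domRestrict (measurableSet_domT μ) h.l1loc.1,
    h.congr hμ fun _ ht _ => indicator_of_mem ht H, fun _ ht => indicator_of_mem ht H⟩

section Representation

variable {Ω : Type*} [mΩ : MeasurableSpace Ω] {P : Measure Ω} [IsProbabilityMeasure P]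
  {γ : Ω → ℝ≥0∞} {M : ℝ≥0 → Ω → ℝ} {F H : ℝ≥0 → ℝ} {L' : Ω → ℝ}

lemma Represents.congr (hγ : Measurable γ) (hr : Represents P γ F H L' M) {H' : ℝ≥0 → ℝ}
    (hH : ∀ t ∈ domT (P.map γ), H' t = H t) : Represents P γ F H' L' M := by
  filter_upwards [hr, ae_le_imp_mem_domT hγ] with ω h1 h2 t
  refine ⟨(h1 t).1, fun ht => ?_⟩
  rw [(h1 t).2 ht, hH]
  exact h2 _ (ENNReal.coe_toNNReal (ne_top_of_le_ne_top ENNReal.coe_ne_top ht)).le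

lemma Represents.integrable_zero_time (hγ : Measurable γ) (hL : Measurable L')
    (hL1 : CondIntegrable (MeasurableSpace.comap γ inferInstance) P L')
    (hL2 : genCondExp (MeasurableSpace.comap γ inferInstance) P L' =ᵐ[P] 0)
    (hr : Represents P γ F H L' M) : Integrable (M 0) P := by
  obtain ⟨E, -, -, hEu, hEL⟩ := exists_sets_of_genCondExp_comap hγ hL hL1 hL2
  obtain ⟨n, hn⟩ := mem_iUnion.1 (hEu ▸ mem_univ (0 : ℝ≥0∞))
  have h0 : MeasurableSet (γ ⁻¹' {0}) := hγ (measurableSet_singleton 0)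
  have hLi : IntegrableOn L' (γ ⁻¹' {0}) P :=
    (hEL n).1.mono_set (preimage_mono (singleton_subset_iff.2 hn))
  have h1 : Integrable ((γ ⁻¹' {0}).indicator (fun ω => H 0 + L' ω)) P :=
    (integrable_indicator_iff h0).2 ((integrable_const _).add hLi)
  have h2 : Integrable ((γ ⁻¹' {0})ᶜ.indicator fun _ => F 0) P :=
    (integrable_const _).indicator h0.compl
  refine (h1.add h2).congr ?_
  filter_upwards [hr] with ω hω
  by_cases h : γ ω = 0
  · rw [(hω 0).2 (by simp [h])]
    simp [h]
  · rw [(hω 0).1 (pos_iff_ne_zero.2 h)]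
    simp [h]

lemma genCondExp_indicator_pos (hγ : Measurable γ) (hL : Measurable L')
    (hL1 : CondIntegrable (MeasurableSpace.comap γ inferInstance) P L')
    (hL2 : genCondExp (MeasurableSpace.comap γ inferInstance) P L' =ᵐ[P] 0) :
    CondIntegrable (MeasurableSpace.comap γ inferInstance) P ({ω | 0 < γ ω}.indicator L') ∧
      genCondExp (MeasurableSpace.comap γ inferInstance) P
        ({ω | 0 < γ ω}.indicator L') =ᵐ[P] 0 := by
  obtain ⟨E, -, hE, hEu, hEL⟩ := exists_sets_of_genCondExp_comap hγ hL hL1 hL2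
  have hpos : MeasurableSet {ω | 0 < γ ω} := measurableSet_lt measurable_const hγ
  refine genCondExp_comap_of_sets hγ hE
    (Eventually.of_forall fun ω => mem_iUnion.1 (hEu ▸ mem_univ (γ ω)))
    fun n => ⟨(hEL n).1.indicator hpos, fun A hA hAn => ?_⟩
  rw [setIntegral_indicator hpos]
  exact (hEL n).2 (A ∩ Ioi 0) (hA.inter measurableSet_Ioi) (inter_subset_left.trans hAn)

/-- The value `H 0` is free, so it is chosen as the mean of `M 0` given `γ = 0`, and the centred
remainder of `M 0` becomes the new `L'` on that event. -/
lemma Represents.exists_centered (hγ : Measurable γ) (hμ : 0 < P.map γ (Ioi 0))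
    (hM : Measurable (M 0)) (hMi : Integrable (M 0) P) (hFH : ConditionM (P.map γ) F H)
    (hL : Measurable L')
    (hL1 : CondIntegrable (MeasurableSpace.comap γ inferInstance) P ({ω | 0 < γ ω}.indicator L'))
    (hL2 : genCondExp (MeasurableSpace.comap γ inferInstance) P
      ({ω | 0 < γ ω}.indicator L') =ᵐ[P] 0) (hr : Represents P γ F H L' M) :
    ∃ (H' : ℝ≥0 → ℝ) (L'' : Ω → ℝ), ConditionM (P.map γ) F H' ∧ Measurable L'' ∧
      CondIntegrable (MeasurableSpace.comap γ inferInstance) P L'' ∧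
      genCondExp (MeasurableSpace.comap γ inferInstance) P L'' =ᵐ[P] 0 ∧
      Represents P γ F H' L'' M := by
  have := Measure.isProbabilityMeasure_map (μ := P) hγ.aemeasurable
  have hpos : MeasurableSet {ω | 0 < γ ω} := measurableSet_lt measurable_const hγ
  have hL' := hL.indicator hpos
  obtain ⟨E, -, hE, hEu, hEL⟩ := exists_sets_of_genCondExp_comap hγ hL' hL1 hL2
  have h0 : MeasurableSet (γ ⁻¹' {0}) := hγ (measurableSet_singleton 0)
  -- If `γ = 0` has probability zero, the quotient is `0` by convention and its value is immaterial.
  set m : ℝ := (∫ ω in γ ⁻¹' {0}, M 0 ω ∂P) / P.real (γ ⁻¹' {0}) with hm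
  set Z : Ω → ℝ := (γ ⁻¹' {0}).indicator fun ω => M 0 ω - m with hZ
  have hMm : Integrable (fun ω => M 0 ω - m) P := hMi.sub (integrable_const m)
  have hZi : Integrable Z P := hMm.indicator h0
  have hZ0 : ∫ ω in γ ⁻¹' {0}, (M 0 ω - m) ∂P = 0 := by
    rw [integral_sub hMi.integrableOn (integrable_const m).integrableOn, setIntegral_const,
      smul_eq_mul]
    rcases eq_or_ne (P.real (γ ⁻¹' {0})) 0 with h | h
    · have h' : P (γ ⁻¹' {0}) = 0 := (measureReal_eq_zero_iff).1 h
      rw [h, zero_mul, Measure.restrict_eq_zero.2 h', integral_zero_measure, sub_zero]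
    · rw [hm, mul_div_cancel₀ _ h, sub_self]
  have hL'' := genCondExp_comap_of_sets (X := {ω | 0 < γ ω}.indicator L' + Z) hγ hE
    (Eventually.of_forall fun ω => mem_iUnion.1 (hEu ▸ mem_univ (γ ω)))
    fun n => ⟨(hEL n).1.add hZi.integrableOn, fun A hA hAn => by
      simp only [Pi.add_apply]
      rw [integral_add ((hEL n).1.mono_set (preimage_mono hAn)) hZi.integrableOn,
        (hEL n).2 A hA hAn, zero_add, hZ, setIntegral_indicator h0, ← preimage_inter]
      by_cases h : (0 : ℝ≥0∞) ∈ A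
      · rw [inter_eq_right.2 (singleton_subset_iff.2 h), hZ0]
      · rw [inter_singleton_eq_empty.2 h, preimage_empty, Measure.restrict_empty,
          integral_zero_measure]⟩
  refine ⟨Function.update H 0 m, {ω | 0 < γ ω}.indicator L' + Z,
    hFH.congr hμ fun t _ ht => Function.update_of_ne ht.ne' _ _,
    hL'.add ((hM.sub_const m).indicator h0), hL''.1, hL''.2, ?_⟩
  filter_upwards [hr] with ω hω t
  refine ⟨(hω t).1, fun ht => ?_⟩
  by_cases h : γ ω = 0
  · rw [(hω t).2 ht, ← (hω 0).2 (by simp [h])]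
    have hx : (γ ω).toNNReal = 0 := by simp [h]
    rw [hx, Function.update_self]
    simp [h, hZ]
  · have hx : γ ω ≠ ∞ := ne_top_of_le_ne_top ENNReal.coe_ne_top ht
    rw [(hω t).2 ht, Function.update_of_ne]
    · simp [h, hZ, pos_iff_ne_zero]
    · simp [ENNReal.toNNReal_eq_zero_iff, h, hx]

lemma ae_eq_zero_of_genCondExp_comap (hγ : Measurable γ)
    (hmΩ : mΩ = MeasurableSpace.comap γ inferInstance) (hL : Measurable L')
    (hL1 : CondIntegrable (MeasurableSpace.comap γ inferInstance) P L')
    (hL2 : genCondExp (MeasurableSpace.comap γ inferInstance) P L' =ᵐ[P] 0) :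
    L' =ᵐ[P] 0 := by
  obtain ⟨E, -, hE, hEu, hEL⟩ := exists_sets_of_genCondExp_comap hγ hL hL1 hL2
  have key : ∀ n, (γ ⁻¹' E n).indicator L' =ᵐ[P] 0 := fun n => by
    have hEn : MeasurableSet (γ ⁻¹' E n) := hγ (hE n)
    refine Integrable.ae_eq_zero_of_forall_setIntegral_eq_zero
      ((integrable_indicator_iff hEn).2 (hEL n).1) fun s hs _ => ?_
    obtain ⟨A, hA, rfl⟩ : MeasurableSet[MeasurableSpace.comap γ inferInstance] s := by
      rw [← hmΩ]; exact hs
    rw [setIntegral_indicator hEn, ← preimage_inter]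
    exact (hEL n).2 _ (hA.inter (hE n)) inter_subset_right
  filter_upwards [ae_all_iff.2 key] with ω hω
  obtain ⟨n, hn⟩ := mem_iUnion.1 (hEu ▸ mem_univ (γ ω))
  have := hω n
  rwa [indicator_of_mem (show ω ∈ γ ⁻¹' E n from hn)] at this

/-! ### The local martingale property when `L' = 0` -/

/-- The event of having stopped by time `i` is empty or equals `{u n < γ}`, which for `u n ≤ i`
contains `{i < γ}`. If `𝒯` is bounded the `u n` do not tend to infinity; this is why the time is
infinite once the jump has occurred by `u n`. -/
lemma isLocalizingSequence_stopBefore (hγ : Measurable γ) {u : ℕ → ℝ≥0} (hum : Monotone u)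
    (hucov : ∀ t ∈ domT (P.map γ), ∃ n, t ≤ u n) :
    IsLocalizingSequence (filtration γ) (fun n => stopBefore γ (u n)) P where
  isStoppingTime n i := by
    have h : ∀ ω, stopBefore γ (u n) ω ≤ i ↔ (u n : ℝ≥0∞) < γ ω ∧ u n ≤ i := fun ω => by
      rw [stopBefore]
      split_ifs with h
      · exact iff_of_false (not_le.2 (WithTop.coe_lt_top i)) fun h' => h'.1.not_ge h
      · exact WithTop.coe_le_coe.trans (by simp [not_le.1 h])
    simp_rw [h]
    by_cases hi : u n ≤ i
    · refine measurableSet_filtration_of_superset ?_ fun ω hω => ⟨?_, hi⟩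
      · simpa [hi] using measurableSet_lt measurable_const hγ
      · exact lt_of_le_of_lt (ENNReal.coe_le_coe.2 hi) hω
    · simp [hi]
  mono := Eventually.of_forall fun ω n k hnk => by
    have h1 : (u n : ℝ≥0∞) ≤ u k := ENNReal.coe_le_coe.2 (hum hnk)
    simp only [stopBefore]
    by_cases h : γ ω ≤ u n
    · rw [if_pos h, if_pos (h.trans h1)]
    · rw [if_neg h]
      split_ifs
      · exact le_top
      · exact WithTop.coe_le_coe.2 (hum hnk)
  tendsto_top := by
    filter_upwards [ae_le_imp_mem_domT (P := P) hγ] with ω hω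
    rcases eq_or_ne (γ ω) ∞ with hx | hx
    · refine tendsto_order.2 ⟨fun a ha => ?_, fun a ha => absurd ha not_top_lt⟩
      lift a to ℝ≥0 using ha.ne
      obtain ⟨n, hn⟩ := hucov (a + 1) (hω _ (by simp [hx]))
      filter_upwards [eventually_ge_atTop n] with k hk
      rw [stopBefore, if_neg (by simp [hx])]
      exact WithTop.coe_lt_coe.2 ((lt_add_one a).trans_le (hn.trans (hum hk)))
    · have hx' : ((γ ω).toNNReal : ℝ≥0∞) = γ ω := ENNReal.coe_toNNReal hx
      obtain ⟨n, hn⟩ := hucov _ (hω _ hx'.le)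
      refine tendsto_const_nhds.congr' ?_
      filter_upwards [eventually_ge_atTop n] with k hk
      rw [stopBefore, if_pos]
      rw [← hx']
      exact ENNReal.coe_le_coe.2 (hn.trans (hum hk))

lemma stronglyAdapted_stoppedProcess_stopBefore (hγ : Measurable γ)
    (hM : StronglyAdapted (filtration γ) M) (u : ℝ≥0) :
    StronglyAdapted (filtration γ) (stoppedProcess M (stopBefore γ u)) := by
  classical
  intro t
  have hMm : ∀ t, Measurable (M t) := fun t => ((hM t).mono ((filtration γ).le t)).measurable
  obtain ⟨f, hf⟩ := exists_pre_of_stronglyAdapted hM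
  have heq : stoppedProcess M (stopBefore γ u) t =
      {ω | γ ω ≤ u}.piecewise (M t) (M (min t u)) := by
    ext ω
    by_cases h : γ ω ≤ u
    · rw [stoppedProcess_stopBefore_of_le h,
        piecewise_eq_of_mem _ _ _ (show ω ∈ {ω | γ ω ≤ u} from h)]
    · rw [stoppedProcess_stopBefore_of_lt (not_le.1 h),
        piecewise_eq_of_notMem _ _ _ (show ω ∉ {ω | γ ω ≤ u} from h)]
  refine stronglyMeasurable_filtration (c := f (min t u)) ?_ fun ω hω => ?_
  · rw [heq]
    exact Measurable.piecewise (measurableSet_le hγ measurable_const) (hMm _) (hMm _)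
  · rcases le_or_gt (γ ω) u with h | h
    · have htu : t ≤ u := ENNReal.coe_le_coe.1 (hω.le.trans h)
      rw [stoppedProcess_stopBefore_of_le h, min_eq_left htu, hf t ω hω]
    · rw [stoppedProcess_stopBefore_of_lt h]
      exact hf _ ω (lt_of_le_of_lt (ENNReal.coe_le_coe.2 (min_le_right _ _)) h)

/-- Without `L'`, local integrability of `H` alone makes the jump integrable on `{γ ≤ u n}`, so no
`γ`-sets have to be cut out. The stopped process is `M 0` plus the restricted path for `B = [0, u
n]`. -/
lemma Represents.isLocalMartingale (hγ : Measurable γ) (hM : StronglyAdapted (filtration γ) M)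
    (hMc : ∀ᵐ ω ∂P, IsCadlag fun t => M t ω) (hM0 : Integrable (M 0) P)
    (hFH : ConditionM (P.map γ) F H) (hH : Measurable H)
    (hr : Represents P γ F H (fun _ => 0) M) : IsLocalMartingale (filtration γ) P M := by
  have := Measure.isProbabilityMeasure_map (μ := P) hγ.aemeasurable
  obtain ⟨u, hum, hu, hucov⟩ := exists_seq_domT (P.map γ)
  refine ⟨hM, hMc, _, isLocalizingSequence_stopBefore hγ hum hucov, fun n => ?_⟩
  obtain ⟨f, hf⟩ := exists_pre_of_stronglyAdapted hM
  obtain ⟨ν, hν, hY⟩ := hFH.exists_isUIMartingale hγ hH (hu n)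
  refine IsUIMartingale.congr (stronglyAdapted_stoppedProcess_stopBefore hγ hM (u n))
    (hY (Iic (u n)) subset_rfl measurableSet_Iic (fun _ => 0) measurable_const
      integrableOn_zero (fun _ _ _ => by simp) (M 0)
      ((hM 0).mono ((filtration γ).le 0)).measurable hM0 (f 0) fun ω hω => hf 0 ω hω) ?_
  filter_upwards [hr, ae_tail_pos hγ (u n)] with ω h1 h2 t
  rw [add_zero]
  have hcut : Iic (u n) ∩ Ioc 0 t = Ioc 0 (min t (u n)) := by
    ext s
    simp only [mem_inter_iff, mem_Iic, mem_Ioc, le_min_iff]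
    tauto
  rcases eq_or_ne (γ ω) 0 with h0 | h0
  · rw [h0, restrictedPath_jump_zero, add_zero, stoppedProcess_stopBefore_of_le (by simp [h0]),
      (h1 t).2 (by simp [h0]), (h1 0).2 (by simp [h0])]
  have hpos : 0 < γ ω := pos_iff_ne_zero.2 h0
  rw [(h1 0).1 hpos, restrictedPath, ← image_coe_inter_Ioc, hcut]
  -- Either the jump is still ahead at time `min t (u n)`, and both sides are the deterministic
  -- value, or it has occurred, and the compensated jump in the restricted path cancels `F 0 + ν
  -- (Ioo 0 γ)`, leaving `H(γ)`.
  rcases lt_or_ge ((min t (u n) : ℝ≥0) : ℝ≥0∞) (γ ω) with hx | hx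
  · have hsp : stoppedProcess M (stopBefore γ (u n)) t ω = F (min t (u n)) := by
      rw [← (h1 _).1 hx]
      rcases le_or_gt (γ ω) (u n) with h | h
      · rw [stoppedProcess_stopBefore_of_le h, min_eq_left]
        by_contra hc
        rw [min_eq_right (not_le.1 hc).le] at hx
        exact hx.not_ge h
      · rw [stoppedProcess_stopBefore_of_lt h]
    have htail : 0 < P.map γ (Ioi ((min t (u n) : ℝ≥0) : ℝ≥0∞)) := by
      rcases (min_le_right t (u n)).eq_or_lt with h | h
      · rw [h] at hx ⊢
        exact h2 hx
      · exact tail_pos_of_lt (hu n) h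
    rw [hsp, hν _ (min_le_right _ _) htail, Ioc_inter_pre_of_lt hx, indicator_of_notMem, add_zero]
    rintro ⟨s, hs, hsx⟩
    rw [← hsx] at hx
    exact (ENNReal.coe_lt_coe.1 hx).not_ge hs.2
  · obtain ⟨x, hxγ⟩ : ∃ x : ℝ≥0, (x : ℝ≥0∞) = γ ω :=
      ⟨_, ENNReal.coe_toNNReal (ne_top_of_le_ne_top ENNReal.coe_ne_top hx)⟩
    rw [← hxγ] at hx hpos
    have hxm := ENNReal.coe_le_coe.1 hx
    rw [stoppedProcess_stopBefore_of_le, (h1 t).2, ← hxγ, Ioc_inter_pre_coe hxm,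
      indicator_of_mem (show (x : ℝ≥0∞) ∈ _ '' Ioc 0 (min t (u n)) from
        ⟨x, ⟨ENNReal.coe_pos.1 hpos, hxm⟩, rfl⟩), ENNReal.toNNReal_coe]
    · ring
    · rw [← hxγ]
      exact ENNReal.coe_le_coe.2 (hxm.trans (min_le_left _ _))
    · rw [← hxγ]
      exact ENNReal.coe_le_coe.2 (hxm.trans (min_le_right _ _))

end Representation

end SingleJump

/-! ### The characterization theorem -/

theorem theorem3 {Ω : Type*} [mΩ : MeasurableSpace Ω] (P : Measure Ω) [IsProbabilityMeasure P]
    (γ : Ω → ℝ≥0∞) (hγ : Measurable γ) (hγ0 : 0 < P {ω | 0 < γ ω})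
    (M : ℝ≥0 → Ω → ℝ)
    (hM : StronglyAdapted (SingleJump.filtration γ) M)
    (hMrc : ∀ᵐ ω ∂P, ∀ t, ContinuousWithinAt (fun s => M s ω) (Ici t) t) :
    -- the characterization of `σ`-martingales; `L'` may fail to be integrable on `{γ = 0}`
    (SingleJump.IsSigmaMartingale (SingleJump.filtration γ) P M ↔
      ∃ (F H : ℝ≥0 → ℝ) (L' : Ω → ℝ),
        SingleJump.ConditionM (P.map γ) F H ∧ Measurable L' ∧
        SingleJump.CondIntegrable (MeasurableSpace.comap γ inferInstance) P
          ({ω | 0 < γ ω}.indicator L') ∧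
        SingleJump.genCondExp (MeasurableSpace.comap γ inferInstance) P
          ({ω | 0 < γ ω}.indicator L') =ᵐ[P] 0 ∧
        SingleJump.Represents P γ F H L' M) ∧
    -- the variant with `E[L'|γ] = 0` on the whole of `Ω`
    (SingleJump.IsSigmaMartingale (SingleJump.filtration γ) P M ∧ Integrable (M 0) P ↔
      ∃ (F H : ℝ≥0 → ℝ) (L' : Ω → ℝ),
        SingleJump.ConditionM (P.map γ) F H ∧ Measurable L' ∧
        SingleJump.CondIntegrable (MeasurableSpace.comap γ inferInstance) P L' ∧
        SingleJump.genCondExp (MeasurableSpace.comap γ inferInstance) P L' =ᵐ[P] 0 ∧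
        SingleJump.Represents P γ F H L' M) ∧
    -- the case where the `σ`-field is generated by `γ`
    (mΩ = MeasurableSpace.comap γ inferInstance →
      SingleJump.IsSigmaMartingale (SingleJump.filtration γ) P M → Integrable (M 0) P →
      SingleJump.IsLocalMartingale (SingleJump.filtration γ) P M) := by
  have := Measure.isProbabilityMeasure_map (μ := P) hγ.aemeasurable
  have hμ : 0 < P.map γ (Ioi 0) := by
    rw [Measure.map_apply hγ measurableSet_Ioi]
    exact hγ0
  have hM0 : Measurable (M 0) := ((hM 0).mono ((SingleJump.filtration γ).le 0)).measurable
  have hsigma : ∀ (F H : ℝ≥0 → ℝ) (L' : Ω → ℝ), SingleJump.ConditionM (P.map γ) F H →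
      Measurable L' →
      SingleJump.CondIntegrable (MeasurableSpace.comap γ inferInstance) P
        ({ω | 0 < γ ω}.indicator L') →
      SingleJump.genCondExp (MeasurableSpace.comap γ inferInstance) P
        ({ω | 0 < γ ω}.indicator L') =ᵐ[P] 0 →
      SingleJump.Represents P γ F H L' M →
      SingleJump.IsSigmaMartingale (SingleJump.filtration γ) P M := by
    intro F H L' hFH hL hL1 hL2 hr
    -- Condition M makes `H` measurable only on `𝒯`; it is replaced by a Borel function on the
    -- half-line, and a.s. finite values of `γ` lie in `𝒯`.
    obtain ⟨H', hH', hFH', hHH'⟩ := hFH.exists_measurable hμ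
    exact (hr.congr hγ hHH').isSigmaMartingale hγ hM hMrc hFH' hH' hL hL1 hL2
  have hcentered : SingleJump.IsSigmaMartingale (SingleJump.filtration γ) P M →
      Integrable (M 0) P → ∃ (F H : ℝ≥0 → ℝ) (L' : Ω → ℝ),
        SingleJump.ConditionM (P.map γ) F H ∧ Measurable L' ∧
        SingleJump.CondIntegrable (MeasurableSpace.comap γ inferInstance) P L' ∧
        SingleJump.genCondExp (MeasurableSpace.comap γ inferInstance) P L' =ᵐ[P] 0 ∧
        SingleJump.Represents P γ F H L' M := by
    intro hσ hi
    obtain ⟨F, H, L', hFH, hL, hL1, hL2, hr⟩ := hσ.exists_represents hγ hM hMrc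
    exact ⟨F, hr.exists_centered hγ hμ hM0 hi hFH hL hL1 hL2⟩
  refine ⟨⟨fun hσ => hσ.exists_represents hγ hM hMrc, ?_⟩, ⟨fun h => hcentered h.1 h.2, ?_⟩, ?_⟩
  · rintro ⟨F, H, L', hFH, hL, hL1, hL2, hr⟩
    exact hsigma F H L' hFH hL hL1 hL2 hr
  · rintro ⟨F, H, L', hFH, hL, hL1, hL2, hr⟩
    obtain ⟨h1, h2⟩ := SingleJump.genCondExp_indicator_pos hγ hL hL1 hL2
    exact ⟨hsigma F H L' hFH hL h1 h2 hr, hr.integrable_zero_time hγ hL hL1 hL2⟩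
  · intro hmΩ hσ hi
    obtain ⟨F, H, L', hFH, hL, hL1, hL2, hr⟩ := hcentered hσ hi
    obtain ⟨H', hH', hFH', hHH'⟩ := hFH.exists_measurable hμ
    have hL0 := SingleJump.ae_eq_zero_of_genCondExp_comap hγ hmΩ hL hL1 hL2
    have hr' : SingleJump.Represents P γ F H' (fun _ => 0) M := by
      filter_upwards [hr.congr hγ hHH', hL0] with ω h1 h2 t
      exact ⟨(h1 t).1, fun ht => ((h1 t).2 ht).trans (by rw [h2]; rfl)⟩
    refine hr'.isLocalMartingale hγ hM ?_ hi hFH' hH'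
    filter_upwards [hσ.1.ae_locallyBoundedVariationOn hγ, hMrc] with ω h1 h2
    exact SingleJump.isCadlag_of_locallyBoundedVariationOn h1 h2
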